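/- **Setting.** Let $d\in\mathbb N$. Let $v:\mathbb{R}^{2d}\to[0,\infty)$ be locally integrable, not identically $0$, submultiplicative ($v(z_1+z_2)\le v(z_1)v(z_2)$), of polynomial growth ($v(z)\le C(1+|z|)^s$ for some $C,s\ge 0$) and symmetric in each coordinate. Let $w:\mathbb{R}^{2d}\to[0,\infty)$ be locally integrable, not identically $0$, and $v$-moderate: $w(z_1+z_2)\le C\,v(z_1)w(z_2)$ for some constant $C$ and all $z_1,z_2$. Let $c$ be a permutation of $\{1,\dots,2d\}$ and $\mathfrak c(x_1,\dots,x_{2d})=(x_{c(1)},\dots,x_{c(2d)})$. Let $p_1,\dots,p_{2d}\in[1,\infty]$. For $z=(x,\xi)\in\mathbb R^{2d}$ put $\pi_z g(t)=e^{2\pi i t\cdot\xi}g(t-x)$, extended to tempered distributions. For $f\in S'(\mathbb R^d)$ and $\phi\in S(\mathbb R^d)$ put $V_\phi f(z)=\langle f,\pi_z\phi\rangle$, the bracket being linear in the first and conjugate linear in the second argument. The mixed norm is $$\|F\|_{L_w^{p_1,\dots,p_{2d}}}=\Bigl(\int_{\mathbb R}\cdots\Bigl(\int_{\mathbb R}|F(x)w(x)|^{p_1}dx_1\Bigr)^{p_2/p_1}\cdots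 dx_{2d}\Bigr)^{1/p_{2d}}$$ (with suprema for infinite exponents). Fix $0\ne\phi\in S(\mathbb R^d)$ and let $M(c)_w^{p_1,\dots,p_{2d}}$ be the set of all $f\in S'(\mathbb R^d)$ with $\|f\|_{M(c)_w^{p_1,\dots,p_{2d}}}=\|V_\phi f\circ\mathfrak c\|_{L_w^{p_1,\dots,p_{2d}}}<\infty$. For $f\in M(c)_{1/v}^{\infty,\dots,\infty}$ and $g\in M(c)_v^{1,\dots,1}$ the bracket is $\langle f,g\rangle=\|\phi\|_{L^2}^{-2}\int_{\mathbb R^{2d}}V_\phi f(z)\,\overline{V_\phi g(z)}\,dz$. For $\psi\in M(c)_v^{1,\dots,1}$ put $V_\psi f(z)=\langle f,\pi_z\psi\rangle$, and let $\Upsilon_\psi F=\int_{\mathbb R^{2d}}F(x)\,\pi_{\mathfrak c(x)}\psi\,dx$ be the weak integral: $(\Upsilon_\psi F)(h)=\int_{\mathbb{R}^{2d}} F(x)\int_{\mathbb R^d}\pi_{\mathfrak c(x)}\psi(t)h(t)\,dt\,dx$ for $h\in S(\mathbb R^d)$. **Theorem.** Let $\psi,\gamma\in M(c)_v^{1,\dots,1}$.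 * *(Well-definedness.)* For $f\in M(c)_{1/v}^{\infty,\dots,\infty}$ and $g\in M(c)_v^{1,\dots,1}$ the integral defining $\langle f,g\rangle$ converges absolutely, $|\langle f,g\rangle|\le K\|f\|_{M(c)_{1/v}^{\infty,\dots,\infty}}\|g\|_{M(c)_v^{1,\dots,1}}$ with $K$ independent of $f,g$, and for $g\in S(\mathbb R^d)$ the bracket is the usual one of $S'$ with $S$. Moreover $M(c)_w^{p_1,\dots,p_{2d}}\subseteq M(c)_{1/v}^{\infty,\dots,\infty}$. * *(a)* $\psi$ and $\gamma$ are functions in $L^2(\mathbb R^d)$, and for every $f\in M(c)_w^{p_1,\dots,p_{2d}}$ one has $\Upsilon_\psi(V_\gamma f\circ\mathfrak c)=\langle\psi,\gamma\rangle f$ in $S'(\mathbb{R}^d)$, where $\langle\psi,\gamma\rangle$ is the $L^2$ inner product and the outer integrals in the definition of $\Upsilon_\psi$ converge absolutely. * *(b)* If $\psi\ne 0$, then $M(c)_w^{p_1,\dots,p_{2d}}$ is a linear space, both $\|\cdot\|_{M(c)_w^{p_1,\dots,p_{2d}}}$ and $|||f|||=\|V_\psi f\circ\mathfrak c\|_{L_w^{p_1,\dots,p_{2d}}}$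 are norms on it, and there are $A,B>0$ with $A\|f\|_{M(c)_w^{p_1,\dots,p_{2d}}}\le|||f|||\le B\|f\|_{M(c)_w^{p_1,\dots,p_{2d}}}$ for all $f\in M(c)_{1/v}^{\infty,\dots,\infty}$ (values $\infty$ allowed; so $f\in M(c)_w^{p_1,\dots,p_{2d}}$ if and only if $|||f|||<\infty$). * *(Independence of the Schwartz window.)* If $0\ne\phi'\in S(\mathbb R^d)$, then replacing $\phi$ by $\phi'$ in the definition of $M(c)_w^{p_1,\dots,p_{2d}}$ gives the same space, and there are $A,B>0$ with $A\|V_\phi f\circ\mathfrak c\|_{L_w^{p_1,\dots,p_{2d}}}\le\|V_{\phi'} f\circ\mathfrak c\|_{L_w^{p_1,\dots,p_{2d}}}\le B\|V_\phi f\circ\mathfrak c\|_{L_w^{p_1,\dots,p_{2d}}}$ for all $f\in S'(\mathbb R^d)$. -/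

import Mathlib

open MeasureTheory
open scoped ENNReal NNReal SchwartzMap ComplexConjugate

noncomputable section

namespace MixedModulation

/-! ### Time-frequency shifts -/

/-- Euclidean space `ℝ^d`. -/
abbrev Space (d : ℕ) : Type := EuclideanSpace ℝ (Fin d)

/-- Phase space `ℝ^{2d}`: the first `d` coordinates are time, the last `d` are frequency. -/
abbrev Phase (d : ℕ) : Type := Fin (d + d) → ℝ

/-- The time part `(z₁, …, z_d)` of `z ∈ ℝ^{2d}`. -/
def timePart {d : ℕ} (z : Phase d) : Space d :=
  WithLp.toLp 2 fun i => z (Fin.castAdd d i)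

/-- The frequency part `(z_{d+1}, …, z_{2d})` of `z ∈ ℝ^{2d}`. -/
def freqPart {d : ℕ} (z : Phase d) : Space d :=
  WithLp.toLp 2 fun i => z (Fin.natAdd d i)

/-- The character `t ↦ e^{2π i t·ξ}`. -/
def character {d : ℕ} (ξ t : Space d) : ℂ :=
  Complex.exp (2 * Real.pi * Complex.I * (inner ℝ t ξ : ℝ))

/-- The time-frequency shift `π_z g = M_ξ T_x g`, `z = (x, ξ)`, of a function `g` on `ℝ^d`. -/
def shiftFun {d : ℕ} (z : Phase d) (g : Space d → ℂ) : Space d → ℂ :=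
  fun t => character (freqPart z) t * g (t - timePart z)

theorem hasTemperateGrowth_character {d : ℕ} (ξ : Space d) :
    Function.HasTemperateGrowth (character ξ) := by
  have hd : ∀ n : ℕ, iteratedDeriv n
      (fun s : ℝ => Complex.exp (2 * Real.pi * Complex.I * (s : ℂ))) =
      fun s : ℝ => (2 * Real.pi * Complex.I) ^ n *
        Complex.exp (2 * Real.pi * Complex.I * (s : ℂ)) := by
    intro n
    induction n with
    | zero => simp
    | succ n ih =>
      rw [iteratedDeriv_succ, ih]
      ext s
      have h1 : HasDerivAt (fun s : ℝ => 2 * Real.pi * Complex.I * (s : ℂ))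
          (2 * Real.pi * Complex.I * 1) s :=
        (Complex.ofRealCLM.hasDerivAt (x := s)).const_mul _
      have h2 := (h1.cexp.const_mul ((2 * Real.pi * Complex.I) ^ n)).deriv
      rw [h2]
      ring
  have hg : Function.HasTemperateGrowth
      (fun s : ℝ => Complex.exp (2 * Real.pi * Complex.I * (s : ℂ))) := by
    refine ⟨?_, fun n => ⟨0, (2 * Real.pi) ^ n, fun s => ?_⟩⟩
    · exact (contDiff_const.mul Complex.ofRealCLM.contDiff).cexp
    · rw [norm_iteratedFDeriv_eq_norm_iteratedDeriv, hd n]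
      have : ‖Complex.exp (2 * Real.pi * Complex.I * (s : ℂ))‖ = 1 := by
        have := Complex.norm_exp_ofReal_mul_I (2 * Real.pi * s)
        rw [← this]
        congr 2
        push_cast
        ring
      simp [this, abs_of_pos Real.pi_pos]
  have hl : Function.HasTemperateGrowth (fun t : Space d => inner ℝ t ξ) := by
    have := ((innerSL ℝ) ξ : Space d →L[ℝ] ℝ).hasTemperateGrowth
    convert this using 2 with t
    rw [innerSL_apply_apply, real_inner_comm]
  exact hg.comp hl

/-- The time-frequency shift `π_z = M_ξ T_x` on Schwartz functions. -/
def shift {d : ℕ} (z : Phase d) (g : 𝓢(Space d, ℂ)) : 𝓢(Space d, ℂ) :=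
  SchwartzMap.smulLeftCLM ℂ (character (freqPart z))
    (SchwartzMap.compSubConstCLM ℂ (timePart z) g)

theorem shift_apply {d : ℕ} (z : Phase d) (g : 𝓢(Space d, ℂ)) (t : Space d) :
    shift z g t = shiftFun z g t := by
  simp [shift, shiftFun, hasTemperateGrowth_character]

/-- Complex conjugation of Schwartz functions. -/
def conjS {d : ℕ} (g : 𝓢(Space d, ℂ)) : 𝓢(Space d, ℂ) :=
  SchwartzMap.postcompCLM (Complex.conjCLE : ℂ →L[ℝ] ℂ) g

theorem conjS_apply {d : ℕ} (g : 𝓢(Space d, ℂ)) (t : Space d) : conjS g t = conj (g t) := rfl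

/-- The time-frequency shift `π_z = M_ξ T_x` on tempered distributions, the transpose of
`T_{-x} M_ξ` on Schwartz functions. -/
def shiftDist {d : ℕ} (z : Phase d) (f : 𝓢'(Space d, ℂ)) : 𝓢'(Space d, ℂ) :=
  PointwiseConvergenceCLM.precomp ℂ
    ((SchwartzMap.compSubConstCLM ℂ (-timePart z)).comp
      (SchwartzMap.smulLeftCLM ℂ (character (freqPart z)))) f

/-- The action of `π_z` on distributions extends its action on Schwartz functions. -/
theorem shiftDist_coe {d : ℕ} (z : Phase d) (g : 𝓢(Space d, ℂ)) :
    shiftDist z (g : 𝓢'(Space d, ℂ)) = (shift z g : 𝓢'(Space d, ℂ)) := by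
  ext h
  have h1 : shiftDist z (g : 𝓢'(Space d, ℂ)) h = ∫ t : Space d,
      (character (freqPart z) (t - -timePart z) * h (t - -timePart z)) * g t := by
    change (g : 𝓢'(Space d, ℂ)) _ = _
    rw [SchwartzMap.coe_apply]
    simp [hasTemperateGrowth_character]
  rw [h1, SchwartzMap.coe_apply, ← integral_sub_right_eq_self _ (timePart z)]
  congr 1
  ext t
  simp [shift_apply, shiftFun]
  ring

/-! ### The Gabor transform -/

/-- The Gabor transform `V_φ f (z) = ⟨f, π_z φ⟩` of a tempered distribution `f`, for a Schwartz
window `φ`. The bracket is linear in `f` and conjugate linear in the second argument. -/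
def gabor {d : ℕ} (φ : 𝓢(Space d, ℂ)) (f : 𝓢'(Space d, ℂ)) (z : Phase d) : ℂ :=
  f (conjS (shift z φ))

/-- The bracket `⟨f, g⟩`, linear in `f` and conjugate linear in `g`, for tempered distributions
`f` and `g` such that `V_φ f · conj (V_φ g)` is integrable:
`⟨f, g⟩ = ‖φ‖₂⁻² ∫ V_φ f (z) conj (V_φ g (z)) dz`. This is the standard duality bracket of
modulation spaces; for `g` a Schwartz function it is the bracket of `𝓢'` with `𝓢`. -/
def bracket {d : ℕ} (φ : 𝓢(Space d, ℂ)) (f g : 𝓢'(Space d, ℂ)) : ℂ :=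
  ((∫ t, ‖φ t‖ ^ 2 : ℝ) : ℂ)⁻¹ * ∫ z : Phase d, gabor φ f z * conj (gabor φ g z)

/-- The Gabor transform `V_ψ f (z) = ⟨f, π_z ψ⟩` for a window `ψ` that need not be a Schwartz
function; `φ` is the Schwartz function that is used in the bracket. -/
def gaborDist {d : ℕ} (φ : 𝓢(Space d, ℂ)) (ψ f : 𝓢'(Space d, ℂ)) (z : Phase d) : ℂ :=
  bracket φ f (shiftDist z ψ)

/-! ### Weights -/

/-- A weight function on `ℝ^{2d}`: nonnegative and locally integrable. -/
structure IsWeight {d : ℕ} (v : Phase d → ℝ) : Prop where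
  nonneg : ∀ z, 0 ≤ v z
  locallyIntegrable : LocallyIntegrable v volume

/-- A submultiplicative weight function. -/
structure IsSubmultiplicative {d : ℕ} (v : Phase d → ℝ) : Prop extends IsWeight v where
  add_le : ∀ z₁ z₂, v (z₁ + z₂) ≤ v z₁ * v z₂

/-- Polynomial growth; `|z|` is the Euclidean norm of `z`. -/
def HasPolynomialGrowth {d : ℕ} (v : Phase d → ℝ) : Prop :=
  ∃ C s : ℝ, 0 ≤ C ∧ 0 ≤ s ∧
    ∀ z : Phase d, v z ≤ C * (1 + ‖(WithLp.toLp 2 z : EuclideanSpace ℝ (Fin (d + d)))‖) ^ s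

/-- Symmetry in each coordinate. -/
def IsCoordSymmetric {d : ℕ} (v : Phase d → ℝ) : Prop :=
  ∀ (z : Phase d) (i : Fin (d + d)), v (Function.update z i (-z i)) = v z

/-- `w` is a `v`-moderate weight function. -/
structure IsModerate {d : ℕ} (v w : Phase d → ℝ) : Prop extends IsWeight w where
  add_le : ∃ C : ℝ, ∀ z₁ z₂, w (z₁ + z₂) ≤ C * v z₁ * w z₂

/-! ### Mixed norms and mixed modulation spaces -/

/-- The mixed norm with exponents `p₀, …, p_{n-1}` of a `[0, ∞]`-valued function on `ℝ^n`:
the `L^{p₀}` norm in the first coordinate is taken first (innermost), that in the last coordinate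
is taken last. -/
def mixedNorm : (n : ℕ) → (Fin n → ℝ≥0∞) → ((Fin n → ℝ) → ℝ≥0∞) → ℝ≥0∞
  | 0, _, G => G Fin.elim0
  | n + 1, p, G => mixedNorm n (fun i => p i.succ)
      fun y => eLpNorm (fun t : ℝ => G (Fin.cons t y)) (p 0) volume

/-- The bijection of `ℝ^{2d}` that permutes the coordinates,
`(z₁, …, z_{2d}) ↦ (z_{c(1)}, …, z_{c(2d)})`. -/
def permute {d : ℕ} (c : Equiv.Perm (Fin (d + d))) (z : Phase d) : Phase d :=
  fun i => z (c i)

/-- The weighted mixed norm `‖F ∘ c‖` in `L_w^{p₁, …, p_{2d}}`. -/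
def permutedNorm {d : ℕ} (c : Equiv.Perm (Fin (d + d))) (w : Phase d → ℝ)
    (p : Fin (d + d) → ℝ≥0∞) (F : Phase d → ℂ) : ℝ≥0∞ :=
  mixedNorm (d + d) p fun z => ‖F (permute c z)‖ₑ * ENNReal.ofReal (w z)

/-- The norm `‖V_φ f ∘ c‖` in `L_w^{p₁, …, p_{2d}}` of a tempered distribution `f`. -/
def modNorm {d : ℕ} (φ : 𝓢(Space d, ℂ)) (c : Equiv.Perm (Fin (d + d))) (w : Phase d → ℝ)
    (p : Fin (d + d) → ℝ≥0∞) (f : 𝓢'(Space d, ℂ)) : ℝ≥0∞ :=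
  permutedNorm c w p (gabor φ f)

/-- The mixed modulation space `M(c)_w^{p₁, …, p_{2d}}`, defined with the Schwartz window `φ`. -/
def mixedModSpace {d : ℕ} (φ : 𝓢(Space d, ℂ)) (c : Equiv.Perm (Fin (d + d)))
    (w : Phase d → ℝ) (p : Fin (d + d) → ℝ≥0∞) : Set 𝓢'(Space d, ℂ) :=
  {f | modNorm φ c w p f < ∞}

/-- `S` is a linear subspace of the tempered distributions and `N` is a norm on it. -/
structure IsNormOn {d : ℕ} (S : Set 𝓢'(Space d, ℂ)) (N : 𝓢'(Space d, ℂ) → ℝ≥0∞) : Prop where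
  zero_mem : 0 ∈ S
  add_mem : ∀ f ∈ S, ∀ g ∈ S, f + g ∈ S
  smul_mem : ∀ a : ℂ, ∀ f ∈ S, a • f ∈ S
  finite : ∀ f ∈ S, N f < ∞
  add_le : ∀ f ∈ S, ∀ g ∈ S, N (f + g) ≤ N f + N g
  smul_eq : ∀ a : ℂ, ∀ f ∈ S, N (a • f) = ‖a‖ₑ * N f
  eq_zero : ∀ f ∈ S, N f = 0 → f = 0

/-! ### The synthesis operator -/

/-- The integrand of the synthesis operator paired with a test function `h`:
`x ↦ F(x) ∫ π_{c(x)} ψ (t) h(t) dt`. -/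
def synthesisIntegrand {d : ℕ} (c : Equiv.Perm (Fin (d + d))) (ψ : Space d → ℂ)
    (F : Phase d → ℂ) (h : 𝓢(Space d, ℂ)) (x : Phase d) : ℂ :=
  F x * ∫ t, shiftFun (permute c x) ψ t * h t

/-- The synthesis operator `Υ_ψ F = ∫ F(x) π_{c(x)} ψ dx`, a weak integral: its value at the test
function `h` is `∫ F(x) (∫ π_{c(x)} ψ (t) h(t) dt) dx`. -/
def synthesis {d : ℕ} (c : Equiv.Perm (Fin (d + d))) (ψ : Space d → ℂ)
    (F : Phase d → ℂ) (h : 𝓢(Space d, ℂ)) : ℂ :=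
  ∫ x : Phase d, synthesisIntegrand c ψ F h x

end MixedModulation

end

open MixedModulation

noncomputable section

namespace MixedModulation

/-! ### One-variable norms of `[0, ∞]`-valued functions -/

section OneVariable

variable {α β : Type*} [MeasurableSpace α] [MeasurableSpace β] {μ : Measure α} {ν : Measure β}

/-! Two tools carry the proof: a pointwise bound of one Gabor transform by a correlation of two
others, and Young's inequality for weighted mixed norms. The covariance `|V_φ(π_z ψ)(u)| = |V_φ ψ(u
- z)|` gives `|V_ψ f(z)| ≤ ‖φ‖₂⁻² ∫ |V_φ f(u)| |V_φ ψ(u - z)| du` (`enorm_gaborDist_le`). Young's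
inequality `mixedNorm_convolution_le` follows from Minkowski's integral inequality, translation
invariance and `w(x) ≤ C v(s) w(x + s)`. Together they give the upper bound in (b) and independence
of the Schwartz window. The permutation is additive and preserves volume, so it passes through these
convolutions.

For a tempered distribution `f` and Schwartz `a`, `b`, `h`, the orthogonality relation `∫ V_a f
conj(V_b h) = ⟨b, a⟩ ⟨f, h⟩` is Fourier inversion for `h`, to which `f` is applied under the
integral sign (`apply_eq_integral_apply`). That is legitimate because `f` factors through a Banach
space (`exists_factorization`), where the integral is a Bochner integral. With `a = b = φ` this
identifies the bracket on Schwartz functions. The case `h = φ`, applied to time-frequency shifts of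
`φ`, gives a reproducing formula; with Hölder's inequality it embeds the space in the one with
exponents `∞` and weight `1/v`.

Since `v ≥ 1`, a window in the space with exponents `1` has an integrable Gabor transform. As a
functional on Schwartz functions it is therefore bounded in the `L²` norm, hence an `L²` function by
Riesz, and orthogonality extends to such windows by density. The inversion formula
`integral_gaborDist_mul` expands `V_γ f` by the definition of the bracket, exchanges the integrals
and evaluates the integral over shifts by orthogonality. The exchange is justified by Young's
inequality with weight `1/v` and by `L^∞`-`L^1` duality.

The lower bound in (b) is the inversion formula with both windows equal to `ψ`, tested against `conj
(π_u φ)`: it bounds `‖ψ‖₂² |V_φ f(u)|` by a convolution of `|V_ψ f|` with `|V_φ ψ|`, and Young's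
inequality applies again. -/

theorem eLpNorm_top_ennreal (f : α → ℝ≥0∞) : eLpNorm f ∞ μ = essSup f μ := by
  simp [eLpNorm_exponent_top, eLpNormEssSup]

theorem eLpNorm_eq_lintegral_ennreal {p : ℝ≥0∞} (hp : 1 ≤ p) (hp' : p ≠ ∞) (f : α → ℝ≥0∞) :
    eLpNorm f p μ = (∫⁻ x, f x ^ p.toReal ∂μ) ^ (1 / p.toReal) := by
  rw [eLpNorm_eq_lintegral_rpow_enorm_toReal (by positivity) hp']
  simp

theorem one_le_toReal_of_one_le {p : ℝ≥0∞} (hp : 1 ≤ p) (hp' : p ≠ ∞) : 1 ≤ p.toReal := by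
  simpa using ENNReal.toReal_mono hp' hp

/-- A finite constant leaves the integral without any measurability of `f`. -/
theorem eLpNorm_const_mul_ennreal {p : ℝ≥0∞} (hp : 1 ≤ p) {a : ℝ≥0∞} (ha : a ≠ ∞)
    (f : α → ℝ≥0∞) : eLpNorm (fun x => a * f x) p μ = a * eLpNorm f p μ := by
  by_cases hp' : p = ∞
  · subst hp'
    rw [eLpNorm_top_ennreal, eLpNorm_top_ennreal, ENNReal.essSup_const_mul]
  · have h1 := one_le_toReal_of_one_le hp hp'
    rw [eLpNorm_eq_lintegral_ennreal hp hp', eLpNorm_eq_lintegral_ennreal hp hp']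
    simp_rw [ENNReal.mul_rpow_of_nonneg _ _ (zero_le_one.trans h1)]
    rw [lintegral_const_mul' _ _ (by finiteness),
      ENNReal.mul_rpow_of_nonneg _ _ (by positivity), ← ENNReal.rpow_mul,
      mul_one_div_cancel (by positivity), ENNReal.rpow_one]

/-- For `p = ∞` the essential supremum of a section exceeds `a` exactly when the section of `{f >
a}` has positive measure, and the measure of a section is a measurable function of the base point.
-/
theorem measurable_eLpNorm_section [SFinite ν] {p : ℝ≥0∞} (hp : 1 ≤ p) {f : α × β → ℝ≥0∞}
    (hf : Measurable f) : Measurable fun x => eLpNorm (fun y => f (x, y)) p ν := by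
  by_cases hp' : p = ∞
  · subst hp'
    simp_rw [eLpNorm_top_ennreal]
    refine measurable_of_Ioi fun a => ?_
    have : (fun x => essSup (fun y => f (x, y)) ν) ⁻¹' Set.Ioi a =
        {x | ν (Prod.mk x ⁻¹' {z | a < f z}) ≠ 0} := by
      ext x
      simp only [Set.mem_preimage, Set.mem_Ioi, Set.mem_ofPred_eq, ← not_le]
      refine not_congr ⟨fun h => ?_, fun h => ?_⟩
      · have := ENNReal.ae_le_essSup (μ := ν) (fun y => f (x, y))
        have h2 : ∀ᵐ y ∂ν, f (x, y) ≤ a := this.mono fun y hy => hy.trans h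
        rw [ae_iff] at h2
        simpa using h2
      · refine essSup_le_of_ae_le _ ?_
        rw [Filter.EventuallyLE, ae_iff]
        simpa using h
    rw [this]
    exact (measurable_measure_prodMk_left (measurableSet_lt measurable_const hf))
      (measurableSet_singleton 0).compl
  · simp_rw [eLpNorm_eq_lintegral_ennreal hp hp']
    exact (Measurable.lintegral_prod_right' (hf.pow_const _)).pow_const _

theorem lintegral_mul_le_eLpNorm_mul_eLpNorm {p q : ℝ≥0∞} (hpq : p.HolderConjugate q)
    {f g : α → ℝ≥0∞} (hf : Measurable f) (hg : Measurable g) :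
    ∫⁻ x, f x * g x ∂μ ≤ eLpNorm f p μ * eLpNorm g q μ := by
  -- The endpoint pair `(1, ∞)`; the pair `(∞, 1)` follows by exchanging the factors.
  have key : ∀ {f g : α → ℝ≥0∞}, Measurable f →
      ∫⁻ x, f x * g x ∂μ ≤ eLpNorm f 1 μ * eLpNorm g ∞ μ := by
    intro f g hf
    rw [eLpNorm_one_eq_lintegral_enorm, eLpNorm_top_ennreal]
    simp only [enorm_eq_self]
    rw [← lintegral_mul_const _ hf]
    refine lintegral_mono_ae ?_
    filter_upwards [ENNReal.ae_le_essSup (μ := μ) g] with x hx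
    gcongr
  by_cases hp : p = ∞
  · subst hp
    obtain rfl : q = 1 := ENNReal.HolderConjugate.unique ∞ q 1
    simp_rw [mul_comm (f _), mul_comm (eLpNorm f _ _)]
    exact key hg
  by_cases hq : q = ∞
  · subst hq
    have := hpq.symm
    obtain rfl : p = 1 := ENNReal.HolderConjugate.unique ∞ p 1
    exact key hf
  rw [eLpNorm_eq_lintegral_ennreal (ENNReal.HolderConjugate.one_le p q) hp,
    eLpNorm_eq_lintegral_ennreal (ENNReal.HolderConjugate.one_le q p) hq]
  exact ENNReal.lintegral_mul_le_Lp_mul_Lq μ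
    (ENNReal.HolderConjugate.toReal_of_ne_top hp hq) hf.aemeasurable hg.aemeasurable

/-- The key estimate of Minkowski's integral inequality, for a function `g` below `∫ f(·, u) du`
with finite norm. -/
theorem lintegral_rpow_le_of_le_lintegral [SFinite μ] [SFinite ν] {r : ℝ} (hr : 1 < r)
    {f : α × β → ℝ≥0∞} (hf : Measurable f) {g : α → ℝ≥0∞} (hg : Measurable g)
    (hgf : ∀ x, g x ≤ ∫⁻ u, f (x, u) ∂ν) (hfin : ∫⁻ x, g x ^ r ∂μ ≠ ∞) :
    (∫⁻ x, g x ^ r ∂μ) ^ (1 / r) ≤ ∫⁻ u, (∫⁻ x, f (x, u) ^ r ∂μ) ^ (1 / r) ∂ν := by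
  set A := ∫⁻ x, g x ^ r ∂μ with hA
  set M := ∫⁻ u, (∫⁻ x, f (x, u) ^ r ∂μ) ^ (1 / r) ∂ν
  have hr0 : 0 < r := zero_lt_one.trans hr
  by_cases hA0 : A = 0
  · rw [hA0, ENNReal.zero_rpow_of_pos (by positivity)]
    exact zero_le
  have hq : (r.conjExponent).HolderConjugate r := (Real.HolderConjugate.conjExponent hr).symm
  have hexp : (r - 1) * r.conjExponent = r := by
    rw [Real.conjExponent]
    field_simp [sub_ne_zero.2 hr.ne']
  -- Write `g^r = g^(r-1) g`, bound the last factor by `∫ f(x, u) du`, exchange the integrals and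
  -- use Hölder in `x`; `(r - 1) r' = r` turns the first Hölder factor back into a power of `A`.
  have h1 : A ≤ A ^ (1 / r.conjExponent) * M := by
    calc A ≤ ∫⁻ x, ∫⁻ u, g x ^ (r - 1) * f (x, u) ∂ν ∂μ := by
          refine lintegral_mono fun x => ?_
          rw [lintegral_const_mul _ (by fun_prop)]
          calc g x ^ r = g x ^ (r - 1) * g x := by
                conv_rhs => rw [← ENNReal.rpow_one (g x), ← ENNReal.rpow_mul, one_mul,
                  ← ENNReal.rpow_add_of_nonneg _ _ (by linarith) zero_le_one]
                simp
            _ ≤ _ := by gcongr; exact hgf x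
      _ = ∫⁻ u, ∫⁻ x, g x ^ (r - 1) * f (x, u) ∂μ ∂ν :=
          lintegral_lintegral_swap (by fun_prop)
      _ ≤ ∫⁻ u, A ^ (1 / r.conjExponent) * (∫⁻ x, f (x, u) ^ r ∂μ) ^ (1 / r) ∂ν := by
          refine lintegral_mono fun u => ?_
          have := ENNReal.lintegral_mul_le_Lp_mul_Lq μ hq (f := fun x => g x ^ (r - 1))
            (g := fun x => f (x, u)) (by fun_prop) (by fun_prop)
          simpa only [← ENNReal.rpow_mul, hexp, ← hA, Pi.mul_apply] using this
      _ = _ := lintegral_const_mul' _ _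
          (ENNReal.rpow_ne_top_of_nonneg (by have := hq.pos; positivity) hfin)
  have h2 : A = A ^ (1 / r.conjExponent) * A ^ (1 / r) := by
    rw [← ENNReal.rpow_add _ _ hA0 hfin, one_div, one_div, hq.inv_add_inv_eq_one,
      ENNReal.rpow_one]
  have h3 : A ^ (1 / r.conjExponent) * A ^ (1 / r) ≤ A ^ (1 / r.conjExponent) * M := by
    rwa [← h2]
  -- Cancelling `A^(1/r')` is where `A` has to be finite and nonzero.
  refine (ENNReal.mul_le_mul_iff_right ?_ ?_).1 h3
  · exact (ENNReal.rpow_pos (pos_iff_ne_zero.2 hA0) hfin).ne'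
  · exact ENNReal.rpow_ne_top_of_nonneg (by have := hq.pos; positivity) hfin

/-- Minkowski's integral inequality. -/
theorem eLpNorm_lintegral_le [SigmaFinite μ] [SFinite ν] {p : ℝ≥0∞} (hp : 1 ≤ p)
    {f : α × β → ℝ≥0∞} (hf : Measurable f) :
    eLpNorm (fun x => ∫⁻ u, f (x, u) ∂ν) p μ ≤ ∫⁻ u, eLpNorm (fun x => f (x, u)) p μ ∂ν := by
  by_cases hp' : p = ∞
  · subst hp'
    simp_rw [eLpNorm_top_ennreal]
    refine essSup_le_of_ae_le _ ?_
    have hm : Measurable fun u => essSup (fun x => f (x, u)) μ := by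
      have := measurable_eLpNorm_section (ν := μ) (p := ∞) hp (hf.comp measurable_swap)
      simpa only [eLpNorm_top_ennreal, Function.comp_apply, Prod.swap_prod_mk] using this
    -- The bound holds for each `u` and almost every `x`. Passing through the product measure
    -- exchanges the order of the two quantifiers.
    have h1 : ∀ᵐ z ∂(ν.prod μ), f (z.2, z.1) ≤ essSup (fun x => f (x, z.1)) μ := by
      rw [Measure.ae_prod_iff_ae_ae]
      · exact Filter.Eventually.of_forall fun u =>
          ENNReal.ae_le_essSup (μ := μ) (fun x => f (x, u))
      · exact measurableSet_le (by fun_prop) (hm.comp measurable_fst)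
    have h2 : ∀ᵐ x ∂μ, ∀ᵐ u ∂ν, f (x, u) ≤ essSup (fun x => f (x, u)) μ := by
      refine Measure.ae_ae_of_ae_prod (p := fun z : α × β => f z ≤ essSup (fun x => f (x, z.2)) μ) ?_
      rw [← Measure.prod_swap]
      exact (ae_map_iff measurable_swap.aemeasurable
        (measurableSet_le hf (hm.comp measurable_snd))).2 h1
    filter_upwards [h2] with x hx
    exact lintegral_mono_ae hx
  simp_rw [eLpNorm_eq_lintegral_ennreal hp hp']
  rcases (one_le_toReal_of_one_le hp hp').eq_or_lt with h1 | hr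
  · simp only [← h1, ENNReal.rpow_one, div_one]
    exact (lintegral_lintegral_swap (by fun_prop)).le
  set r := p.toReal
  have hr0 : 0 < r := zero_lt_one.trans hr
  set S : α → ℝ≥0∞ := fun x => ∫⁻ u, f (x, u) ∂ν
  have hS : Measurable S := by fun_prop
  -- Truncation in height and in space makes the norm finite, so that the key estimate applies;
  -- Fatou's lemma then removes the truncation.
  set g : ℕ → α → ℝ≥0∞ := fun n => (spanningSets μ n).indicator fun x => min (S x) n
  have hg : ∀ n, Measurable (g n) := fun n =>
    (hS.min measurable_const).indicator (measurableSet_spanningSets μ n)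
  have hgS : ∀ n x, g n x ≤ S x := fun n x =>
    Set.indicator_apply_le' (fun _ => min_le_left _ _) fun _ => zero_le
  have hfin : ∀ n, ∫⁻ x, g n x ^ r ∂μ ≠ ∞ := by
    intro n
    refine ne_top_of_le_ne_top (b := ((n : ℝ≥0∞) ^ r) * μ (spanningSets μ n)) ?_ ?_
    · exact ENNReal.mul_ne_top (ENNReal.rpow_ne_top_of_nonneg hr0.le (by simp))
        (measure_spanningSets_lt_top μ n).ne
    · rw [← lintegral_indicator_const (measurableSet_spanningSets μ n)]
      refine lintegral_mono fun x => ?_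
      by_cases hx : x ∈ spanningSets μ n
      · simp only [g, Set.indicator_of_mem hx]
        gcongr
        exact min_le_right _ _
      · simp [g, Set.indicator_of_notMem hx, hr0]
  have hbd := fun n => lintegral_rpow_le_of_le_lintegral hr hf (hg n) (hgS n) (hfin n)
  have hlim : ∀ x, Filter.Tendsto (fun n => g n x ^ r) Filter.atTop (nhds (S x ^ r)) := by
    intro x
    refine ((ENNReal.continuous_rpow_const (y := r)).tendsto _).comp ?_
    have h1 : Filter.Tendsto (fun n : ℕ => min (S x) n) Filter.atTop (nhds (min (S x) ∞)) :=
      tendsto_const_nhds.min ENNReal.tendsto_nat_nhds_top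
    rw [min_eq_left le_top] at h1
    refine h1.congr' ?_
    filter_upwards [Filter.eventually_ge_atTop (spanningSetsIndex μ x)] with n hn
    have : x ∈ spanningSets μ n := monotone_spanningSets μ hn (mem_spanningSetsIndex μ x)
    simp [g, Set.indicator_of_mem this]
  set M := ∫⁻ u, (∫⁻ x, f (x, u) ^ r ∂μ) ^ (1 / r) ∂ν
  have hmain : ∫⁻ x, S x ^ r ∂μ ≤ M ^ r := by
    calc ∫⁻ x, S x ^ r ∂μ = ∫⁻ x, Filter.liminf (fun n => g n x ^ r) Filter.atTop ∂μ :=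
          lintegral_congr fun x => (hlim x).liminf_eq.symm
      _ ≤ Filter.liminf (fun n => ∫⁻ x, g n x ^ r ∂μ) Filter.atTop :=
          lintegral_liminf_le fun n => (hg n).pow_const _
      _ ≤ M ^ r := by
          refine Filter.liminf_le_of_le (by isBoundedDefault) fun b hb => ?_
          obtain ⟨n, hn⟩ := hb.exists
          refine hn.trans ?_
          have := ENNReal.rpow_le_rpow (hbd n) hr0.le
          rwa [← ENNReal.rpow_mul, one_div_mul_cancel hr0.ne', ENNReal.rpow_one] at this
  calc (∫⁻ x, S x ^ r ∂μ) ^ (1 / r) ≤ (M ^ r) ^ (1 / r) := by gcongr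
    _ = M := by rw [← ENNReal.rpow_mul, mul_one_div_cancel hr0.ne', ENNReal.rpow_one]

end OneVariable

/-! ### Mixed norms -/

section MixedNorm

variable {n : ℕ}

/-- The head is placed second in the product, so that iterated integration integrates it first, in
agreement with the innermost norm. -/
theorem measurePreserving_finCons (n : ℕ) : MeasurePreserving
    (fun q : (Fin n → ℝ) × ℝ => (Fin.cons q.2 q.1 : Fin (n + 1) → ℝ))
    (volume.prod volume) volume := by
  have h := ((volume_preserving_piFinSuccAbove (fun _ : Fin (n + 1) => ℝ) 0).symm).comp
    (Measure.measurePreserving_swap (μ := (volume : Measure (Fin n → ℝ)))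
      (ν := (volume : Measure ℝ)))
  have e : (fun q : (Fin n → ℝ) × ℝ => (Fin.cons q.2 q.1 : Fin (n + 1) → ℝ)) =
      (MeasurableEquiv.piFinSuccAbove (fun _ : Fin (n + 1) => ℝ) 0).symm ∘ Prod.swap := by
    ext q i
    refine Fin.cases ?_ (fun i => ?_) i <;> simp [MeasurableEquiv.piFinSuccAbove]
  rw [e]
  exact h

theorem measurable_finCons {γ : Type*} [MeasurableSpace γ] {f : γ → ℝ} {g : γ → Fin n → ℝ}
    (hf : Measurable f) (hg : Measurable g) :
    Measurable fun c => (Fin.cons (f c) (g c) : Fin (n + 1) → ℝ) :=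
  (measurePreserving_finCons n).measurable.comp (hg.prodMk hf)

theorem measurable_slice {G : (Fin (n + 1) → ℝ) → ℝ≥0∞} (hG : Measurable G) (y : Fin n → ℝ) :
    Measurable fun t : ℝ => G (Fin.cons t y) :=
  hG.comp (measurable_finCons measurable_id measurable_const)

theorem lintegral_eq_lintegral_finCons {G : (Fin (n + 1) → ℝ) → ℝ≥0∞} (hG : Measurable G) :
    ∫⁻ x, G x = ∫⁻ y : Fin n → ℝ, ∫⁻ t : ℝ, G (Fin.cons t y) := by
  rw [← (measurePreserving_finCons n).lintegral_comp hG,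
    lintegral_prod]
  exact (hG.comp (measurable_finCons measurable_snd measurable_fst)).aemeasurable

theorem measurable_innerNorm {p : ℝ≥0∞} (hp : 1 ≤ p) {G : (Fin (n + 1) → ℝ) → ℝ≥0∞}
    (hG : Measurable G) :
    Measurable fun y : Fin n → ℝ => eLpNorm (fun t : ℝ => G (Fin.cons t y)) p volume :=
  measurable_eLpNorm_section hp (f := fun q : (Fin n → ℝ) × ℝ => G (Fin.cons q.2 q.1))
    (hG.comp (measurable_finCons measurable_snd measurable_fst))

theorem mixedNorm_mono {n : ℕ} {p : Fin n → ℝ≥0∞} {G H : (Fin n → ℝ) → ℝ≥0∞}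
    (h : ∀ x, G x ≤ H x) : mixedNorm n p G ≤ mixedNorm n p H := by
  induction n with
  | zero => exact h _
  | succ n ih => exact ih fun y => eLpNorm_mono_enorm fun t => h _

/-- Almost every slice agrees almost everywhere, by Fubini; on the one-point space volume is a Dirac
mass. This lets weights that are only almost everywhere measurable be replaced by measurable ones.
-/
theorem mixedNorm_congr_ae {n : ℕ} {p : Fin n → ℝ≥0∞} {G H : (Fin n → ℝ) → ℝ≥0∞}
    (h : G =ᵐ[volume] H) : mixedNorm n p G = mixedNorm n p H := by
  induction n with
  | zero =>
    rw [Measure.volume_pi_eq_dirac Fin.elim0, Filter.EventuallyEq, ae_dirac_eq] at h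
    exact h
  | succ n ih =>
    refine ih ?_
    have h1 := (measurePreserving_finCons n).quasiMeasurePreserving.ae h
    filter_upwards [Measure.ae_ae_of_ae_prod h1] with y hy
    exact eLpNorm_congr_ae hy

theorem mixedNorm_const_mul {n : ℕ} {p : Fin n → ℝ≥0∞} (hp : ∀ i, 1 ≤ p i) {a : ℝ≥0∞}
    (ha : a ≠ ∞) (G : (Fin n → ℝ) → ℝ≥0∞) :
    mixedNorm n p (fun x => a * G x) = a * mixedNorm n p G := by
  induction n with
  | zero => rfl
  | succ n ih =>
    rw [mixedNorm, mixedNorm, ← ih fun i => hp i.succ]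
    simp_rw [eLpNorm_const_mul_ennreal (hp 0) ha]

theorem mixedNorm_add_le {n : ℕ} {p : Fin n → ℝ≥0∞} (hp : ∀ i, 1 ≤ p i)
    {G H : (Fin n → ℝ) → ℝ≥0∞} (hG : Measurable G) (hH : Measurable H) :
    mixedNorm n p (fun x => G x + H x) ≤ mixedNorm n p G + mixedNorm n p H := by
  induction n with
  | zero => exact le_rfl
  | succ n ih =>
    refine le_trans (mixedNorm_mono (n := n) fun y => ?_) (ih (fun i => hp i.succ)
      (measurable_innerNorm (hp 0) hG) (measurable_innerNorm (hp 0) hH))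
    exact eLpNorm_add_le
      (measurable_slice hG _).aestronglyMeasurable
      (measurable_slice hH _).aestronglyMeasurable (hp 0)

theorem mixedNorm_comp_add {n : ℕ} {p : Fin n → ℝ≥0∞} (hp : ∀ i, 1 ≤ p i)
    {G : (Fin n → ℝ) → ℝ≥0∞} (hG : Measurable G) (a : Fin n → ℝ) :
    mixedNorm n p (fun x => G (x + a)) = mixedNorm n p G := by
  induction n with
  | zero => exact congrArg G (Subsingleton.elim _ _)
  | succ n ih =>
    rw [mixedNorm, mixedNorm,
      ← ih (fun i => hp i.succ) (measurable_innerNorm (hp 0) hG) (fun i => a i.succ)]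
    congr 1
    ext y
    rw [← eLpNorm_comp_measurePreserving (p := p 0)
      (measurable_slice hG (y + fun i : Fin n => a i.succ)).aestronglyMeasurable
      (measurePreserving_add_right volume (a 0))]
    congr 1
    ext t
    refine congrArg G (funext fun i => ?_)
    refine Fin.cases ?_ (fun i => ?_) i <;> simp

/-- Minkowski's integral inequality for mixed norms. -/
theorem mixedNorm_lintegral_le {β : Type*} [MeasurableSpace β] {ν : Measure β} [SFinite ν]
    {n : ℕ} {p : Fin n → ℝ≥0∞} (hp : ∀ i, 1 ≤ p i) {F : (Fin n → ℝ) × β → ℝ≥0∞}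
    (hF : Measurable F) :
    mixedNorm n p (fun x => ∫⁻ u, F (x, u) ∂ν) ≤ ∫⁻ u, mixedNorm n p (fun x => F (x, u)) ∂ν := by
  induction n with
  | zero => exact le_rfl
  | succ n ih =>
    -- The induction hypothesis is applied to the inner norm as a function of `(y, u)`, so joint
    -- measurability is needed with `t` as the last variable.
    have h1 : Measurable fun q : ((Fin n → ℝ) × β) × ℝ =>
        F ((Fin.cons q.2 q.1.1 : Fin (n + 1) → ℝ), q.1.2) := by
      refine hF.comp (Measurable.prodMk (measurable_finCons ?_ ?_) ?_) <;> fun_prop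
    refine le_trans (mixedNorm_mono (n := n) fun y => ?_)
      (ih (fun i => hp i.succ) (measurable_eLpNorm_section (hp 0) h1))
    exact eLpNorm_lintegral_le (hp 0) (f := fun z : ℝ × β => F (Fin.cons z.1 y, z.2))
      (h1.comp (f := fun z : ℝ × β => ((y, z.2), z.1)) (by fun_prop))

/-- Hölder's inequality for mixed norms. -/
theorem lintegral_mul_le_mixedNorm {n : ℕ} {p q : Fin n → ℝ≥0∞}
    (hpq : ∀ i, (p i).HolderConjugate (q i)) {G H : (Fin n → ℝ) → ℝ≥0∞}
    (hG : Measurable G) (hH : Measurable H) :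
    ∫⁻ x, G x * H x ≤ mixedNorm n p G * mixedNorm n q H := by
  induction n with
  | zero => 
    rw [Measure.volume_pi_eq_dirac Fin.elim0, lintegral_dirac]
    exact le_rfl
  | succ n ih =>
    have hp : 1 ≤ p 0 := have := hpq 0; ENNReal.HolderConjugate.one_le (p 0) (q 0)
    have hq : 1 ≤ q 0 := have := hpq 0; ENNReal.HolderConjugate.one_le (q 0) (p 0)
    rw [lintegral_eq_lintegral_finCons (G := fun x => G x * H x) (hG.mul hH)]
    refine le_trans (lintegral_mono fun y => ?_) (ih (fun i => hpq i.succ)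
      (measurable_innerNorm hp hG) (measurable_innerNorm hq hH))
    exact lintegral_mul_le_eLpNorm_mul_eLpNorm (hpq 0)
      (measurable_slice hG _)
      (measurable_slice hH _)

theorem mixedNorm_one {n : ℕ} {G : (Fin n → ℝ) → ℝ≥0∞} (hG : Measurable G) :
    mixedNorm n (fun _ => 1) G = ∫⁻ x, G x := by
  induction n with
  | zero =>
    rw [Measure.volume_pi_eq_dirac Fin.elim0, lintegral_dirac]
    rfl
  | succ n ih =>
    rw [mixedNorm, ih (measurable_innerNorm le_rfl hG), lintegral_eq_lintegral_finCons hG]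
    simp [eLpNorm_one_eq_lintegral_enorm]

/-- The mixed norm of a tensor product is the product of the one-variable norms: the remaining
factors are a finite constant for the inner norm. -/
theorem mixedNorm_prod_lt_top {n : ℕ} {p : Fin n → ℝ≥0∞} (hp : ∀ i, 1 ≤ p i) {r : ℝ → ℝ≥0}
    (hr : ∀ i, eLpNorm (fun t => (r t : ℝ≥0∞)) (p i) volume < ∞) :
    mixedNorm n p (fun x => ∏ i, (r (x i) : ℝ≥0∞)) < ∞ := by
  induction n with
  | zero => simp [mixedNorm]
  | succ n ih =>
    have h1 : ∀ y : Fin n → ℝ,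
        eLpNorm (fun t => ∏ i, (r ((Fin.cons t y : Fin (n + 1) → ℝ) i) : ℝ≥0∞)) (p 0) volume =
        eLpNorm (fun t => (r t : ℝ≥0∞)) (p 0) volume * ∏ i, (r (y i) : ℝ≥0∞) := by
      intro y
      simp_rw [Fin.prod_univ_succ, Fin.cons_zero, Fin.cons_succ, mul_comm (r _ : ℝ≥0∞)]
      rw [eLpNorm_const_mul_ennreal (hp 0) (ENNReal.prod_ne_top fun i _ => ENNReal.coe_ne_top), mul_comm]
    rw [mixedNorm]
    simp_rw [h1]
    rw [mixedNorm_const_mul (fun i => hp i.succ) (hr 0).ne]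
    exact ENNReal.mul_lt_top (hr 0) (ih (fun i => hp i.succ) fun i => hr i.succ)

end MixedNorm

/-! ### Weights -/

section Weights

variable {d : ℕ} {v w : Phase d → ℝ}

/-- Coordinates are flipped one at a time, by induction on the set of flipped ones. -/
theorem IsCoordSymmetric.neg_eq (hv : IsCoordSymmetric v) (z : Phase d) : v (-z) = v z := by
  have h : ∀ s : Finset (Fin (d + d)), v (fun i => if i ∈ s then -z i else z i) = v z := by
    intro s
    induction s using Finset.induction_on with
    | empty => simp
    | insert a s ha ih =>
      rw [← ih, ← hv (fun i => if i ∈ s then -z i else z i) a]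
      congr 1
      ext i
      by_cases hi : i = a
      · subst hi
        simp [ha]
      · simp [hi]
  simpa using! h Finset.univ

/-- Since `v(y) ≤ v(y - z) v(z)`, a single zero would make `v` vanish everywhere. -/
theorem IsSubmultiplicative.pos (hv : IsSubmultiplicative v) (hv_ne : v ≠ 0) (z : Phase d) :
    0 < v z := by
  refine (hv.nonneg z).lt_of_ne' fun h0 => hv_ne ?_
  ext y
  have := hv.add_le (y - z) z
  rw [h0, mul_zero, sub_add_cancel] at this
  exact le_antisymm this (hv.nonneg y)

/-- `v(0) ≤ v(0)²` gives `v(0) ≥ 1`, and `v(0) ≤ v(z) v(-z) = v(z)²`. Hence an `L^1_v` bound is also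
an `L^1` bound. -/
theorem IsSubmultiplicative.one_le (hv : IsSubmultiplicative v) (hv_symm : IsCoordSymmetric v)
    (hv_ne : v ≠ 0) (z : Phase d) : 1 ≤ v z := by
  have h0 : 1 ≤ v 0 := by
    have h := hv.add_le 0 0
    rw [add_zero] at h
    nlinarith [hv.pos hv_ne 0]
  have h1 := hv.add_le z (-z)
  rw [add_neg_cancel, hv_symm.neg_eq] at h1
  nlinarith [hv.nonneg z]

theorem IsModerate.exists_pos_const (hw : IsModerate v w) (hv : IsWeight v) :
    ∃ C : ℝ, 0 < C ∧ ∀ z₁ z₂, w (z₁ + z₂) ≤ C * v z₁ * w z₂ := by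
  obtain ⟨C, hC⟩ := hw.add_le
  refine ⟨max C 1, by positivity, fun z₁ z₂ => (hC z₁ z₂).trans ?_⟩
  have := hv.nonneg z₁
  have := hw.nonneg z₂
  gcongr
  exact le_max_left _ _

theorem IsModerate.pos (hw : IsModerate v w) (hw_ne : w ≠ 0) (z : Phase d) : 0 < w z := by
  refine (hw.nonneg z).lt_of_ne' fun h0 => hw_ne ?_
  obtain ⟨C, hC⟩ := hw.add_le
  ext y
  have := hC (y - z) z
  rw [h0, mul_zero, sub_add_cancel] at this
  exact le_antisymm this (hw.nonneg y)

theorem IsSubmultiplicative.isModerate_self (hv : IsSubmultiplicative v) : IsModerate v v :=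
  { hv with add_le := ⟨1, fun z₁ z₂ => by simpa using hv.add_le z₁ z₂⟩ }

theorem IsWeight.aemeasurable (hv : IsWeight v) :
    AEMeasurable (fun z => ENNReal.ofReal (v z)) volume :=
  hv.locallyIntegrable.aestronglyMeasurable.aemeasurable.ennreal_ofReal

/-- Submultiplicativity for `z₂ = -z₁ + (z₁ + z₂)` and symmetry give `v(z₂) ≤ v(z₁) v(z₁ + z₂)`;
local integrability comes from `1/v ≤ 1`. Every estimate for moderate weights thus applies to `1/v`.
-/
theorem IsSubmultiplicative.isModerate_inv (hv : IsSubmultiplicative v)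
    (hv_symm : IsCoordSymmetric v) (hv_ne : v ≠ 0) : IsModerate v fun z => (v z)⁻¹ where
  nonneg z := inv_nonneg.2 (hv.nonneg z)
  locallyIntegrable := by
    refine (locallyIntegrable_const (1 : ℝ)).mono
      hv.locallyIntegrable.aestronglyMeasurable.aemeasurable.inv.aestronglyMeasurable
      (Filter.Eventually.of_forall fun z => ?_)
    have := hv.one_le hv_symm hv_ne z
    rw [Real.norm_of_nonneg (by positivity), norm_one]
    exact inv_le_one_of_one_le₀ this
  add_le := by
    refine ⟨1, fun z₁ z₂ => ?_⟩
    have h1 := hv.pos hv_ne z₁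
    have h2 := hv.pos hv_ne z₂
    have h3 := hv.pos hv_ne (z₁ + z₂)
    have h := hv.add_le (-z₁) (z₁ + z₂)
    rw [neg_add_cancel_left, hv_symm.neg_eq] at h
    rw [one_mul, ← div_eq_mul_inv, le_div_iff₀ h2, inv_mul_le_iff₀ h3, mul_comm]
    exact h

theorem exists_one_add_norm_toLp_le (n : ℕ) : ∃ C : ℝ, 1 ≤ C ∧ ∀ z : Fin n → ℝ,
    1 + ‖(WithLp.toLp 2 z : EuclideanSpace ℝ (Fin n))‖ ≤ C * (1 + ‖z‖) := by
  set L : (Fin n → ℝ) →L[ℝ] EuclideanSpace ℝ (Fin n) :=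
    (EuclideanSpace.equiv (Fin n) ℝ).symm.toContinuousLinearMap
  refine ⟨max 1 ‖L‖, le_max_left _ _, fun z => ?_⟩
  have h := L.le_opNorm z
  have h1 : ‖L‖ ≤ max 1 ‖L‖ := le_max_right _ _
  have h2 : 1 ≤ max 1 ‖L‖ := le_max_left _ _
  change 1 + ‖L z‖ ≤ _
  nlinarith [norm_nonneg z]

/-- Decay is measured below in the sup norm of `Phase d` with integer powers; hence the change of
norm and the rounding of the exponent. -/
theorem HasPolynomialGrowth.exists_le_pow (hv : HasPolynomialGrowth v) :
    ∃ (C : ℝ) (m : ℕ), 0 ≤ C ∧ ∀ z : Phase d, v z ≤ C * (1 + ‖z‖) ^ m := by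
  obtain ⟨C, s, hC, hs, h⟩ := hv
  obtain ⟨A, hA, hAz⟩ := exists_one_add_norm_toLp_le (d + d)
  refine ⟨C * A ^ ⌈s⌉₊, ⌈s⌉₊, by positivity, fun z => (h z).trans ?_⟩
  rw [mul_assoc, ← mul_pow]
  gcongr
  calc _ ≤ (1 + ‖(WithLp.toLp 2 z : EuclideanSpace ℝ (Fin (d + d)))‖) ^ (⌈s⌉₊ : ℝ) := by
        apply Real.rpow_le_rpow_of_exponent_le
        · linarith [norm_nonneg (WithLp.toLp 2 z : EuclideanSpace ℝ (Fin (d + d)))]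
        · exact Nat.le_ceil s
    _ = (1 + ‖(WithLp.toLp 2 z : EuclideanSpace ℝ (Fin (d + d)))‖) ^ ⌈s⌉₊ :=
        Real.rpow_natCast _ _
    _ ≤ _ := by
        gcongr
        exact hAz z

/-- The function is at most `1`, so its powers with exponent at least `1` are dominated by the
function itself, which is integrable. -/
theorem eLpNorm_inv_one_add_sq_lt_top {p : ℝ≥0∞} (hp : 1 ≤ p) :
    eLpNorm (fun t : ℝ => ((Real.toNNReal (1 + t ^ 2)⁻¹ : ℝ≥0) : ℝ≥0∞)) p volume < ∞ := by
  have hle : ∀ t : ℝ, ((Real.toNNReal (1 + t ^ 2)⁻¹ : ℝ≥0) : ℝ≥0∞) ≤ 1 := by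
    intro t
    rw [← ENNReal.coe_one, ENNReal.coe_le_coe, Real.toNNReal_le_one]
    exact inv_le_one_of_one_le₀ (by nlinarith [sq_nonneg t])
  by_cases hp' : p = ∞
  · subst hp'
    rw [eLpNorm_top_ennreal]
    exact (essSup_le_of_ae_le 1 (Filter.Eventually.of_forall hle)).trans_lt ENNReal.one_lt_top
  · rw [eLpNorm_eq_lintegral_ennreal hp hp']
    have h1 := one_le_toReal_of_one_le hp hp'
    refine ENNReal.rpow_lt_top_of_nonneg (by positivity) (ne_top_of_le_ne_top
      (b := ∫⁻ t : ℝ, ENNReal.ofReal (1 + t ^ 2)⁻¹) ?_ (lintegral_mono fun t => ?_))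
    · exact (integrable_inv_one_add_sq.lintegral_lt_top).ne
    · calc _ ≤ ((Real.toNNReal (1 + t ^ 2)⁻¹ : ℝ≥0) : ℝ≥0∞) ^ (1 : ℝ) :=
            ENNReal.rpow_le_rpow_of_exponent_ge (hle t) h1
        _ = _ := by rw [ENNReal.rpow_one]; rfl

/-- Each `1 + z_i²` is at most `(1 + ‖z‖)²`, so the power `2n` is enough to dominate by a tensor
product. -/
theorem mixedNorm_inv_pow_lt_top {n : ℕ} {p : Fin n → ℝ≥0∞} (hp : ∀ i, 1 ≤ p i) (C : ℝ≥0) :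
    mixedNorm n p (fun z => ENNReal.ofReal (C * ((1 + ‖z‖) ^ (2 * n))⁻¹)) < ∞ := by
  have h := mixedNorm_prod_lt_top hp (r := fun t => Real.toNNReal (1 + t ^ 2)⁻¹)
    fun i => eLpNorm_inv_one_add_sq_lt_top (hp i)
  refine lt_of_le_of_lt (mixedNorm_mono (H := fun z => (C : ℝ≥0∞) *
    ∏ i, ((Real.toNNReal (1 + z i ^ 2)⁻¹ : ℝ≥0) : ℝ≥0∞)) fun z => ?_) ?_
  · rw [ENNReal.ofReal_mul C.coe_nonneg, ENNReal.ofReal_coe_nnreal]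
    gcongr
    rw [← ENNReal.ofNNReal_finsetProd, ENNReal.ofReal, ENNReal.coe_le_coe,
      ← Real.toNNReal_prod_of_nonneg fun i _ => by positivity]
    refine Real.toNNReal_mono ?_
    rw [Finset.prod_inv_distrib]
    refine inv_anti₀ (Finset.prod_pos fun i _ => by positivity) ?_
    calc ∏ i, (1 + z i ^ 2) ≤ ∏ _i : Fin n, (1 + ‖z‖) ^ 2 := by
          refine Finset.prod_le_prod (fun i _ => by positivity) fun i _ => ?_
          have h1 := norm_le_pi_norm z i
          rw [Real.norm_eq_abs] at h1
          nlinarith [abs_nonneg (z i), sq_abs (z i), norm_nonneg z]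
      _ = (1 + ‖z‖) ^ (2 * n) := by simp [pow_mul]
  · rw [mixedNorm_const_mul hp ENNReal.coe_ne_top]
    exact ENNReal.mul_lt_top ENNReal.coe_lt_top h

/-- Rapid decay of a function on `ℝⁿ`. -/
def HasRapidDecay {n : ℕ} {E : Type*} [Norm E] (F : (Fin n → ℝ) → E) : Prop :=
  ∀ N : ℕ, ∃ C : ℝ, 0 ≤ C ∧ ∀ z, ‖F z‖ ≤ C * ((1 + ‖z‖) ^ N)⁻¹

theorem HasRapidDecay.mixedNorm_lt_top {E : Type*} [NormedAddCommGroup E] {F : Phase d → E}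
    (hF : HasRapidDecay F)
    (hv : HasPolynomialGrowth v) {p : Fin (d + d) → ℝ≥0∞} (hp : ∀ i, 1 ≤ p i) :
    mixedNorm (d + d) p (fun z => ‖F z‖ₑ * ENNReal.ofReal (v z)) < ∞ := by
  obtain ⟨C, m, hC, h⟩ := hv.exists_le_pow
  -- The exponent `m` absorbs the weight, and `2 (d + d)` makes the mixed norm finite.
  obtain ⟨A, hA, hF⟩ := hF (2 * (d + d) + m)
  refine lt_of_le_of_lt (mixedNorm_mono fun z => ?_)
    (mixedNorm_inv_pow_lt_top hp (A * C).toNNReal)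
  rw [← ofReal_norm, ← ENNReal.ofReal_mul (norm_nonneg _), Real.coe_toNNReal _ (by positivity)]
  refine ENNReal.ofReal_le_ofReal ?_
  calc ‖F z‖ * v z ≤ ‖F z‖ * (C * (1 + ‖z‖) ^ m) := by
        gcongr
        exact h z
    _ ≤ (A * ((1 + ‖z‖) ^ (2 * (d + d) + m))⁻¹) * (C * (1 + ‖z‖) ^ m) := by
        gcongr
        exact hF z
    _ = _ := by
        have : (1 + ‖z‖) ≠ 0 := by positivity
        rw [pow_add]
        field_simp

/-- Hölder's inequality against a strictly positive `K` gives `∫ G K = 0`. As `0 * ∞ = 0`,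
finiteness of the norm of `K` plays no role. -/
theorem ae_eq_zero_of_mixedNorm_eq_zero {n : ℕ} {p : Fin n → ℝ≥0∞} (hp : ∀ i, 1 ≤ p i)
    {G : (Fin n → ℝ) → ℝ≥0∞} (hG : Measurable G) (h : mixedNorm n p G = 0) :
    G =ᵐ[volume] 0 := by
  set K : (Fin n → ℝ) → ℝ≥0∞ := fun z => ENNReal.ofReal ((1 : ℝ≥0) * ((1 + ‖z‖) ^ (2 * n))⁻¹)
  have hK : Measurable K := by fun_prop
  have h1 := lintegral_mul_le_mixedNorm (fun i => ENNReal.HolderConjugate.conjExponent (hp i)) hG hK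
  rw [h, zero_mul, nonpos_iff_eq_zero, lintegral_eq_zero_iff (by fun_prop)] at h1
  filter_upwards [h1] with z hz
  have : K z ≠ 0 := by
    simp only [K, ne_eq, ENNReal.ofReal_eq_zero, not_le]
    positivity
  simpa [this] using hz

/-- Young's inequality for weighted mixed norms. -/
theorem mixedNorm_convolution_le (hv : IsWeight v) (hv_symm : IsCoordSymmetric v)
    (hw : IsWeight w) {C : ℝ} (hC : 0 < C) (hvw : ∀ z₁ z₂, w (z₁ + z₂) ≤ C * v z₁ * w z₂)
    {p : Fin (d + d) → ℝ≥0∞} (hp : ∀ i, 1 ≤ p i)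
    {F K : Phase d → ℝ≥0∞} (hF : Measurable F) (hK : Measurable K) (hK' : ∀ z, K z ≠ ∞) :
    mixedNorm (d + d) p (fun x => (∫⁻ s, F (x + s) * K s) * ENNReal.ofReal (w x)) ≤
      (ENNReal.ofReal C * ∫⁻ s, K s * ENNReal.ofReal (v s)) *
        mixedNorm (d + d) p (fun x => F x * ENNReal.ofReal (w x)) := by
  set V : Phase d → ℝ≥0∞ := fun z => ENNReal.ofReal (v z)
  set W : Phase d → ℝ≥0∞ := fun z => ENNReal.ofReal (w z)
  have hV : AEMeasurable V volume := hv.aemeasurable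
  have hW : AEMeasurable W volume := hw.aemeasurable
  set V₀ := hV.mk V
  set W₀ := hW.mk W
  have hV₀ : Measurable V₀ := hV.measurable_mk
  have hW₀ : Measurable W₀ := hW.measurable_mk
  set c := ENNReal.ofReal C
  -- Moderateness for `x = -s + (s + x)`, with the sign removed by the symmetry of `v`. It moves the
  -- weight inside the convolution.
  have hpt : ∀ x s, W x ≤ c * V s * W (x + s) := by
    intro x s
    have h := hvw (-s) (s + x)
    rw [neg_add_cancel_left, hv_symm.neg_eq, add_comm s] at h
    calc W x ≤ ENNReal.ofReal (C * v s * w (x + s)) := ENNReal.ofReal_le_ofReal h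
      _ = _ := by
        rw [ENNReal.ofReal_mul (mul_nonneg hC.le (hv.nonneg s)), ENNReal.ofReal_mul hC.le]
  have hN : mixedNorm (d + d) p (fun x => F x * W₀ x) = mixedNorm (d + d) p (fun x => F x * W x) :=
    mixedNorm_congr_ae <| by
      filter_upwards [hW.ae_eq_mk] with x hx
      rw [hx]
  calc mixedNorm (d + d) p (fun x => (∫⁻ s, F (x + s) * K s) * W x)
      ≤ mixedNorm (d + d) p (fun x => ∫⁻ s, c * (K s * V₀ s) * (F (x + s) * W₀ (x + s))) := by
        refine mixedNorm_mono fun x => ?_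
        rw [← lintegral_mul_const _ (by fun_prop)]
        refine lintegral_mono_ae ?_
        have hx := (measurePreserving_add_left (volume : Measure (Phase d)) x
          ).quasiMeasurePreserving.ae hW.ae_eq_mk
        filter_upwards [hV.ae_eq_mk, hx] with s hs hxs
        rw [show V₀ s = V s from hs.symm, show W₀ (x + s) = W (x + s) from hxs.symm]
        calc F (x + s) * K s * W x ≤ F (x + s) * K s * (c * V s * W (x + s)) := by
              gcongr
              exact hpt x s
          _ = _ := by ring
    _ ≤ ∫⁻ s, mixedNorm (d + d) p (fun x => c * (K s * V₀ s) * (F (x + s) * W₀ (x + s))) :=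
        mixedNorm_lintegral_le hp
          (F := fun q : Phase d × Phase d =>
            c * (K q.2 * V₀ q.2) * (F (q.1 + q.2) * W₀ (q.1 + q.2))) (by fun_prop)
    _ = ∫⁻ s, c * (K s * V s) * mixedNorm (d + d) p (fun x => F x * W x) := by
        refine lintegral_congr_ae ?_
        filter_upwards [hV.ae_eq_mk] with s hs
        have hs' : V₀ s = V s := hs.symm
        rw [hs', mixedNorm_const_mul hp (by
          exact ENNReal.mul_ne_top ENNReal.ofReal_ne_top
            (ENNReal.mul_ne_top (hK' s) ENNReal.ofReal_ne_top)), ← hN]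
        congr 1
        exact mixedNorm_comp_add hp (G := fun x => F x * W₀ x) (by fun_prop) s
    _ = _ := by
        rw [lintegral_mul_const'' _ (by fun_prop), lintegral_const_mul'' _ (by fun_prop)]

end Weights

/-! ### Integrals of families of Schwartz functions -/

section WeakIntegral

open scoped BoundedContinuousFunction

variable {V : Type} [NormedAddCommGroup V] [NormedSpace ℝ V]
variable {Z : Type*} [TopologicalSpace Z]

theorem continuous_schwartz_apply {F : Type} [NormedAddCommGroup F] [NormedSpace ℝ F]
    {Γ : Z → 𝓢(V, F)} (hΓ : Continuous Γ) (t : V) : Continuous fun z => Γ z t := by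
  have h := (SchwartzMap.toBoundedContinuousFunctionCLM ℝ V F).continuous.comp hΓ
  exact (BoundedContinuousFunction.evalCLM ℝ t).continuous.comp h

theorem continuous_seminorm_comp {F : Type} [NormedAddCommGroup F] [NormedSpace ℝ F]
    {Γ : Z → 𝓢(V, F)} (hΓ : Continuous Γ) (k n : ℕ) :
    Continuous fun z => SchwartzMap.seminorm ℝ k n (Γ z) :=
  ((schwartz_withSeminorms ℝ V F).continuous_seminorm (k, n)).comp hΓ

theorem seminorm_fderivCLM_le {F : Type} [NormedAddCommGroup F] [NormedSpace ℝ F]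
    (k n : ℕ) (f : 𝓢(V, F)) :
    SchwartzMap.seminorm ℝ k n (SchwartzMap.fderivCLM ℝ V F f) ≤
      SchwartzMap.seminorm ℝ k (n + 1) f := by
  refine SchwartzMap.seminorm_le_bound ℝ k n _ (apply_nonneg _ _) fun x => ?_
  have : (SchwartzMap.fderivCLM ℝ V F f : V → V →L[ℝ] F) = fderiv ℝ f := rfl
  rw [this, norm_iteratedFDeriv_fderiv]
  exact f.le_seminorm ℝ k (n + 1) x

variable [SecondCountableTopology Z] [MeasurableSpace Z] [OpensMeasurableSpace Z] {μ : Measure Z}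

/-- Differentiation under the integral sign, dominated by the seminorm of index `(0, 1)`, which
bounds the derivative uniformly in `t`. -/
theorem fderiv_eq_integral_fderiv {F : Type} [NormedAddCommGroup F] [NormedSpace ℝ F]
    {Γ : Z → 𝓢(V, F)} (hΓ : Continuous Γ)
    (hint : ∀ k n, Integrable (fun z => SchwartzMap.seminorm ℝ k n (Γ z)) μ)
    {G : 𝓢(V, F)} (hG : ∀ t, G t = ∫ z, Γ z t ∂μ) (t : V) :
    fderiv ℝ G t = ∫ z, fderiv ℝ (Γ z) t ∂μ := by
  have hG' : (G : V → F) = fun t => ∫ z, Γ z t ∂μ := funext hG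
  rw [hG']
  refine (hasFDerivAt_integral_of_dominated_of_fderiv_le
    (F' := fun t z => fderiv ℝ (Γ z) t)
    (bound := fun z => SchwartzMap.seminorm ℝ 0 1 (Γ z)) Filter.univ_mem
    (Filter.Eventually.of_forall fun t => (continuous_schwartz_apply hΓ t).aestronglyMeasurable)
    ?_ ?_ ?_ (hint 0 1) ?_).fderiv
  · refine (hint 0 0).mono' (continuous_schwartz_apply hΓ t).aestronglyMeasurable
      (Filter.Eventually.of_forall fun z => SchwartzMap.norm_le_seminorm ℝ _ _)
  · exact (continuous_schwartz_apply
      ((SchwartzMap.fderivCLM ℝ V F).continuous.comp hΓ) t).aestronglyMeasurable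
  · refine Filter.Eventually.of_forall fun z x _ => ?_
    have := SchwartzMap.norm_iteratedFDeriv_le_seminorm ℝ (Γ z) 1 x
    rwa [norm_iteratedFDeriv_one] at this
  · exact Filter.Eventually.of_forall fun z x _ => (Γ z).hasFDerivAt x

theorem iteratedFDeriv_eq_integral {F : Type} [NormedAddCommGroup F] [NormedSpace ℝ F]
    [CompleteSpace F] {Γ : Z → 𝓢(V, F)} (hΓ : Continuous Γ)
    (hint : ∀ k n, Integrable (fun z => SchwartzMap.seminorm ℝ k n (Γ z)) μ)
    {G : 𝓢(V, F)} (hG : ∀ t, G t = ∫ z, Γ z t ∂μ) (l : ℕ) (t : V) :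
    iteratedFDeriv ℝ l G t = ∫ z, iteratedFDeriv ℝ l (Γ z) t ∂μ := by
  -- One derivative turns the family into one with values in `V →L[ℝ] F`, so the target space must
  -- vary in the induction.
  induction l generalizing F with
  | zero =>
    simp_rw [iteratedFDeriv_zero_eq_comp, Function.comp_apply, hG t]
    exact (((continuousMultilinearCurryFin0 ℝ V F).symm.toContinuousLinearEquiv
      ).integral_comp_comm _).symm
  | succ l ih =>
    have hD : Continuous fun z => SchwartzMap.fderivCLM ℝ V F (Γ z) :=
      (SchwartzMap.fderivCLM ℝ V F).continuous.comp hΓ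
    have h := ih (Γ := fun z => SchwartzMap.fderivCLM ℝ V F (Γ z))
      (G := SchwartzMap.fderivCLM ℝ V F G) hD
      (fun k n => (hint k (n + 1)).mono' (continuous_seminorm_comp hD k n).aestronglyMeasurable
        (Filter.Eventually.of_forall fun z => by
          rw [Real.norm_of_nonneg (apply_nonneg _ _)]
          exact seminorm_fderivCLM_le k n _))
      (fun t => fderiv_eq_integral_fderiv hΓ hint hG t)
    simp_rw [iteratedFDeriv_succ_eq_comp_right, Function.comp_apply]
    refine (congrArg _ h).trans ?_
    exact (ContinuousLinearEquiv.integral_comp_comm (𝕜 := ℝ) (E := V [×l]→L[ℝ] V →L[ℝ] F)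
      (F := V [×(l + 1)]→L[ℝ] F) (continuousMultilinearCurryRightEquiv' ℝ l V F
        ).symm.toContinuousLinearEquiv
      (μ := μ) fun z => iteratedFDeriv ℝ l (fderiv ℝ (Γ z)) t).symm

/-- The space of values of the derivative of order `l` of a complex-valued function on `V`. -/
def DerivSpace (V : Type) [NormedAddCommGroup V] [NormedSpace ℝ V] (l : ℕ) : Type :=
  V [×l]→L[ℝ] ℂ

instance (l : ℕ) : NormedAddCommGroup (DerivSpace V l) :=
  inferInstanceAs (NormedAddCommGroup (V [×l]→L[ℝ] ℂ))

instance (l : ℕ) : NormedSpace ℂ (DerivSpace V l) :=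
  inferInstanceAs (NormedSpace ℂ (V [×l]→L[ℝ] ℂ))

instance (l : ℕ) : NormedSpace ℝ (DerivSpace V l) :=
  inferInstanceAs (NormedSpace ℝ (V [×l]→L[ℝ] ℂ))

instance (l : ℕ) : SMulCommClass ℝ ℂ (DerivSpace V l) :=
  inferInstanceAs (SMulCommClass ℝ ℂ (V [×l]→L[ℝ] ℂ))

instance (l : ℕ) : CompleteSpace (DerivSpace V l) :=
  inferInstanceAs (CompleteSpace (V [×l]→L[ℝ] ℂ))

/-- The derivative of order `l`. -/
def iterDeriv (l : ℕ) (g : 𝓢(V, ℂ)) (t : V) : DerivSpace V l := iteratedFDeriv ℝ l g t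

theorem continuous_iterDeriv (l : ℕ) (g : 𝓢(V, ℂ)) : Continuous (iterDeriv l g) :=
  (g.smooth l).continuous_iteratedFDeriv le_rfl

theorem norm_weighted_iterDeriv_le (k l : ℕ) (g : 𝓢(V, ℂ)) (t : V) :
    ‖(‖t‖ ^ k : ℝ) • iterDeriv l g t‖ ≤ SchwartzMap.seminorm ℝ k l g := by
  rw [norm_smul, norm_pow, norm_norm]
  exact g.le_seminorm ℝ k l t

/-- The function `t ↦ |t|^k D^l g(t)`. -/
def weightedDeriv (k l : ℕ) (g : 𝓢(V, ℂ)) : V →ᵇ DerivSpace V l :=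
  BoundedContinuousFunction.ofNormedAddCommGroup (fun t => (‖t‖ ^ k : ℝ) • iterDeriv l g t)
    ((continuous_norm.pow k).smul (continuous_iterDeriv l g))
    (SchwartzMap.seminorm ℝ k l g) (norm_weighted_iterDeriv_le k l g)

theorem weightedDeriv_apply (k l : ℕ) (g : 𝓢(V, ℂ)) (t : V) :
    weightedDeriv k l g t = (‖t‖ ^ k : ℝ) • iterDeriv l g t := rfl

theorem norm_weightedDeriv (k l : ℕ) (g : 𝓢(V, ℂ)) :
    ‖weightedDeriv k l g‖ = SchwartzMap.seminorm ℝ k l g := by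
  apply le_antisymm
  · exact (BoundedContinuousFunction.norm_le (apply_nonneg _ _)).2
      (norm_weighted_iterDeriv_le k l g)
  · refine SchwartzMap.seminorm_le_bound ℝ k l g
      (norm_nonneg (weightedDeriv k l g)) fun t => ?_
    have := (weightedDeriv k l g).norm_coe_le_norm t
    rwa [weightedDeriv_apply, norm_smul, norm_pow, norm_norm] at this

/-- The map `g ↦ |t|^k D^l g(t)` into the bounded continuous functions. -/
def weightedDerivCLM (V : Type) [NormedAddCommGroup V] [NormedSpace ℝ V] (k l : ℕ) :
    𝓢(V, ℂ) →L[ℂ] (V →ᵇ DerivSpace V l) :=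
  SchwartzMap.mkCLMtoNormedSpace (weightedDeriv k l)
    (fun f g => by
      ext1 t
      rw [BoundedContinuousFunction.add_apply, weightedDeriv_apply, weightedDeriv_apply,
        weightedDeriv_apply, ← smul_add]
      congr 1
      exact iteratedFDeriv_add_apply (f.smooth l).contDiffAt (g.smooth l).contDiffAt)
    (fun a f => by
      ext1 t
      rw [RingHom.id_apply, BoundedContinuousFunction.smul_apply, weightedDeriv_apply,
        weightedDeriv_apply, ← smul_comm]
      congr 1
      exact iteratedFDeriv_const_smul_apply (f.smooth l).contDiffAt)
    ⟨{(k, l)}, 1, zero_le_one, fun f => by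
      rw [Finset.sup_singleton, one_mul]
      exact (norm_weightedDeriv k l f).le⟩

theorem weightedDerivCLM_apply (k l : ℕ) (g : 𝓢(V, ℂ)) (t : V) :
    weightedDerivCLM V k l g t = (‖t‖ ^ k : ℝ) • iterDeriv l g t := rfl

theorem norm_weightedDerivCLM (k l : ℕ) (g : 𝓢(V, ℂ)) :
    ‖weightedDerivCLM V k l g‖ = SchwartzMap.seminorm ℝ k l g :=
  norm_weightedDeriv k l g

/-- Tempered distributions factor through a Banach space of finitely many derivatives. -/
theorem exists_factorization (f : 𝓢(V, ℂ) →L[ℂ] ℂ) : ∃ (s : Finset (ℕ × ℕ))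
    (L : (∀ i : s, V →ᵇ DerivSpace V i.1.2) →L[ℂ] ℂ),
    ∀ g, f g = L (fun i => weightedDerivCLM V i.1.1 i.1.2 g) := by
  obtain ⟨s₀, C, hC0, hC⟩ := Seminorm.bound_of_continuous (schwartz_withSeminorms ℂ V ℂ)
    ((normSeminorm ℂ ℂ).comp f.toLinearMap) (continuous_norm.comp f.continuous)
  -- The index `(0, 0)` puts the sup norm of `g` among the controlled quantities, which makes `J`
  -- injective.
  set s := insert (0, 0) s₀
  set J : 𝓢(V, ℂ) →L[ℂ] (∀ i : s, V →ᵇ DerivSpace V i.1.2) :=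
    ContinuousLinearMap.pi fun i => weightedDerivCLM V i.1.1 i.1.2
  have hJ : ∀ g, ∀ i ∈ s, SchwartzMap.seminorm ℂ i.1 i.2 g ≤ ‖J g‖ := by
    intro g i hi
    have h1 : SchwartzMap.seminorm ℂ i.1 i.2 g = SchwartzMap.seminorm ℝ i.1 i.2 g := rfl
    rw [h1, ← norm_weightedDerivCLM]
    exact norm_le_pi_norm (J g) ⟨i, hi⟩
  have hf : ∀ g, ‖f g‖ ≤ C * ‖J g‖ := by
    intro g
    refine (hC g).trans ?_
    rw [smul_apply, NNReal.smul_def, smul_eq_mul]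
    gcongr
    refine Seminorm.finset_sup_apply_le (norm_nonneg _) fun i hi => ?_
    exact hJ g i (Finset.mem_insert_of_mem hi)
  have hinj : Function.Injective J := by
    refine (injective_iff_map_eq_zero _).2 fun g hg => ?_
    ext t
    have h1 := hJ g (0, 0) (Finset.mem_insert_self _ _)
    rw [hg, norm_zero (E := ∀ i : s, V →ᵇ DerivSpace V i.1.2)] at h1
    have h2 := (SchwartzMap.norm_le_seminorm ℂ g t).trans h1
    simpa using h2
  -- On the range of `J` the functional is bounded for the Banach norm, and Hahn-Banach extends it.
  set e := LinearEquiv.ofInjective J.toLinearMap hinj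
  set f₀ : StrongDual ℂ (LinearMap.range J.toLinearMap) :=
    LinearMap.mkContinuous (f.toLinearMap ∘ₗ e.symm.toLinearMap) C fun x => by
      have h1 := hf (e.symm x)
      have h2 : J (e.symm x) = x := congrArg Subtype.val (e.apply_symm_apply x)
      rw [h2] at h1
      exact h1
  obtain ⟨L, hL, -⟩ := exists_extension_norm_eq _ f₀
  refine ⟨s, L, fun g => ?_⟩
  have h1 := hL (e g)
  have h2 : f₀ (e g) = f g := congrArg f (e.symm_apply_apply g)
  rw [← h2, ← h1]
  rfl

/-- A tempered distribution may be applied under the integral sign of an absolutely convergent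
integral of Schwartz functions. -/
theorem apply_eq_integral_apply (f : 𝓢'(V, ℂ))
    {Γ : Z → 𝓢(V, ℂ)} (hΓ : Continuous Γ)
    (hint : ∀ k n, Integrable (fun z => SchwartzMap.seminorm ℝ k n (Γ z)) μ)
    {G : 𝓢(V, ℂ)} (hG : ∀ t, G t = ∫ z, Γ z t ∂μ) :
    Integrable (fun z => f (Γ z)) μ ∧ f G = ∫ z, f (Γ z) ∂μ := by
  obtain ⟨s, L, hL⟩ := exists_factorization (V := V) f
  have hJi : ∀ k l, Integrable (fun z => weightedDerivCLM V k l (Γ z)) μ := fun k l =>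
    (hint k l).mono' (((weightedDerivCLM V k l).continuous.comp hΓ).aestronglyMeasurable)
      (Filter.Eventually.of_forall fun z => (norm_weightedDerivCLM k l _).le)
  have hJ : Integrable (fun z => fun i : s => weightedDerivCLM V i.1.1 i.1.2 (Γ z)) μ :=
    Integrable.of_eval fun i => hJi i.1.1 i.1.2
  have hL' : ∀ g : 𝓢(V, ℂ), f g = L (fun i => weightedDerivCLM V i.1.1 i.1.2 g) := hL
  simp_rw [hL']
  refine ⟨L.integrable_comp hJ, ?_⟩
  -- `L` commutes with the Bochner integral; it remains to identify that integral with the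
  -- derivatives of `G`, coordinate by coordinate and point by point.
  rw [L.integral_comp_comm hJ]
  congr 1
  ext1 i
  rw [eval_integral fun i => hJi i.1.1 i.1.2]
  ext1 t
  have h1 := (BoundedContinuousFunction.evalCLM ℝ t).integral_comp_comm (hJi i.1.1 i.1.2)
  refine Eq.trans ?_ h1
  simp only [BoundedContinuousFunction.evalCLM_apply, weightedDerivCLM_apply]
  rw [integral_smul]
  exact congrArg _ (iteratedFDeriv_eq_integral hΓ hint hG i.1.2 t)

end WeakIntegral

/-! ### Continuity and growth of time-frequency shifts of Schwartz functions -/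

section Translation

variable {V : Type} [NormedAddCommGroup V] [NormedSpace ℝ V]

/-- The supremum of the Schwartz seminorms of order at most `m`. -/
def supSeminorm (m : ℕ × ℕ) : Seminorm ℝ 𝓢(V, ℂ) :=
  (Finset.Iic m).sup fun m => SchwartzMap.seminorm ℝ m.1 m.2

theorem seminorm_le_supSeminorm {k n : ℕ} {m : ℕ × ℕ} (h : (k, n) ≤ m) (g : 𝓢(V, ℂ)) :
    SchwartzMap.seminorm ℝ k n g ≤ supSeminorm m g :=
  Seminorm.le_def.1 (Finset.le_sup (f := fun m : ℕ × ℕ => SchwartzMap.seminorm ℝ (F := ℂ) m.1 m.2)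
    (Finset.mem_Iic.2 h)) g

theorem supSeminorm_le {m : ℕ × ℕ} {g : 𝓢(V, ℂ)} {C : ℝ} (hC : 0 ≤ C)
    (h : ∀ k n, (k, n) ≤ m → SchwartzMap.seminorm ℝ k n g ≤ C) : supSeminorm m g ≤ C :=
  Seminorm.finset_sup_apply_le hC fun i hi => h i.1 i.2 (Finset.mem_Iic.1 hi)

theorem continuous_supSeminorm (m : ℕ × ℕ) : Continuous (supSeminorm (V := V) m) := by
  have : ∀ s : Finset (ℕ × ℕ), Continuous
      ⇑(s.sup fun m : ℕ × ℕ => SchwartzMap.seminorm ℝ (E := V) (F := ℂ) m.1 m.2) := by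
    intro s
    induction s using Finset.induction_on with
    | empty => exact continuous_const
    | insert a s ha ih =>
      rw [Finset.sup_insert]
      exact ((schwartz_withSeminorms ℝ V ℂ).continuous_seminorm a).max ih
  exact this _

theorem norm_pow_le_of_sub {V : Type*} [SeminormedAddCommGroup V] (k : ℕ) (a t : V) :
    ‖t‖ ^ k ≤ (1 + ‖a‖) ^ k * (1 + ‖t - a‖) ^ k := by
  rw [← mul_pow]
  gcongr
  have h : ‖t‖ ≤ ‖t - a‖ + ‖a‖ := by simpa using norm_add_le (t - a) a
  nlinarith [norm_nonneg a, norm_nonneg (t - a), mul_nonneg (norm_nonneg a) (norm_nonneg (t - a))]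

theorem iteratedFDeriv_compSubConstCLM (n : ℕ) (a : V) (g : 𝓢(V, ℂ)) (t : V) :
    iteratedFDeriv ℝ n (SchwartzMap.compSubConstCLM ℂ a g) t = iteratedFDeriv ℝ n g (t - a) :=
  iteratedFDeriv_comp_sub n a t

theorem seminorm_translate_le (k n : ℕ) (a : V) (g : 𝓢(V, ℂ)) :
    SchwartzMap.seminorm ℝ k n (SchwartzMap.compSubConstCLM ℂ a g) ≤
      (1 + ‖a‖) ^ k * (2 ^ k * supSeminorm (k, n) g) := by
  refine SchwartzMap.seminorm_le_bound ℝ k n _ (by positivity) fun t => ?_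
  rw [iteratedFDeriv_compSubConstCLM]
  calc ‖t‖ ^ k * ‖iteratedFDeriv ℝ n g (t - a)‖
      ≤ ((1 + ‖a‖) ^ k * (1 + ‖t - a‖) ^ k) * ‖iteratedFDeriv ℝ n g (t - a)‖ := by
        gcongr
        exact norm_pow_le_of_sub k a t
    _ = (1 + ‖a‖) ^ k * ((1 + ‖t - a‖) ^ k * ‖iteratedFDeriv ℝ n g (t - a)‖) := by ring
    _ ≤ _ := mul_le_mul_of_nonneg_left
        (SchwartzMap.one_add_le_sup_seminorm_apply (𝕜 := ℝ) (m := (k, n)) le_rfl le_rfl g _)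
        (by positivity)

/-- The mean value inequality for the derivative of order `n` on the ball of radius `‖a‖` around
`t`, on which `‖t‖^k` is comparable with `(1 + ‖y‖)^k`. -/
theorem seminorm_translate_sub_le (k n : ℕ) (a : V) (g : 𝓢(V, ℂ)) :
    SchwartzMap.seminorm ℝ k n (SchwartzMap.compSubConstCLM ℂ a g - g) ≤
      (1 + ‖a‖) ^ k * (2 ^ k * supSeminorm (k, n + 1) g) * ‖a‖ := by
  refine SchwartzMap.seminorm_le_bound ℝ k n _ (by positivity) fun t => ?_
  have h1 : iteratedFDeriv ℝ n (SchwartzMap.compSubConstCLM ℂ a g - g : 𝓢(V, ℂ)) t =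
      iteratedFDeriv ℝ n g (t - a) - iteratedFDeriv ℝ n g t := by
    rw [← iteratedFDeriv_compSubConstCLM]
    exact iteratedFDeriv_sub_apply (SchwartzMap.smooth _ n).contDiffAt (g.smooth n).contDiffAt
  rw [h1]
  have hd : ∀ y, DifferentiableAt ℝ (iteratedFDeriv ℝ n g) y := fun y =>
    ((g.smooth (n + 1)).differentiable_iteratedFDeriv (by exact_mod_cast Nat.lt_succ_self n)) y
  -- The Lipschitz constant used below divides by `‖t‖^k`, so `t` of norm zero is separate; there
  -- `0^0 = 1` leaves a genuine estimate when `k = 0`.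
  rcases (norm_nonneg t).eq_or_lt with ht | ht
  · rcases Nat.eq_zero_or_pos k with rfl | hk
    · have h := Convex.norm_image_sub_le_of_norm_fderiv_le (𝕜 := ℝ) (s := Set.univ)
        (f := iteratedFDeriv ℝ n g) (C := 2 ^ 0 * supSeminorm (0, n + 1) g) (x := t) (y := t - a)
        (fun y _ => hd y) (fun y _ => by
          rw [norm_fderiv_iteratedFDeriv]
          have := SchwartzMap.one_add_le_sup_seminorm_apply (𝕜 := ℝ) (m := (0, n + 1))
            le_rfl le_rfl g y
          simpa using! this) convex_univ trivial trivial
      simpa using! h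
    · rw [← ht, zero_pow hk.ne', zero_mul]
      positivity
  have htk : 0 < ‖t‖ ^ k := by positivity
  have h := Convex.norm_image_sub_le_of_norm_fderiv_le (𝕜 := ℝ) (s := Metric.closedBall t ‖a‖)
    (f := iteratedFDeriv ℝ n g)
    (C := (1 + ‖a‖) ^ k * (2 ^ k * supSeminorm (k, n + 1) g) / ‖t‖ ^ k) (x := t) (y := t - a)
    (fun y _ => hd y) (fun y hy => by
      rw [norm_fderiv_iteratedFDeriv, le_div_iff₀ htk]
      have h2 := SchwartzMap.one_add_le_sup_seminorm_apply (𝕜 := ℝ) (m := (k, n + 1))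
        le_rfl le_rfl g y
      have h3 : ‖t‖ ^ k ≤ (1 + ‖a‖) ^ k * (1 + ‖y‖) ^ k := by
        refine (norm_pow_le_of_sub k (t - y) t).trans ?_
        rw [sub_sub_cancel]
        have h4 : ‖t - y‖ ≤ ‖a‖ := by
          rwa [← dist_eq_norm, dist_comm, ← Metric.mem_closedBall]
        gcongr
      calc ‖iteratedFDeriv ℝ (n + 1) g y‖ * ‖t‖ ^ k
          ≤ ‖iteratedFDeriv ℝ (n + 1) g y‖ * ((1 + ‖a‖) ^ k * (1 + ‖y‖) ^ k) := by gcongr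
        _ = (1 + ‖a‖) ^ k * ((1 + ‖y‖) ^ k * ‖iteratedFDeriv ℝ (n + 1) g y‖) := by ring
        _ ≤ _ := mul_le_mul_of_nonneg_left h2 (by positivity))
    (convex_closedBall t ‖a‖) (Metric.mem_closedBall_self (norm_nonneg a)) (by simp)
  rw [sub_sub_cancel_left, norm_neg] at h
  calc ‖t‖ ^ k * ‖iteratedFDeriv ℝ n g (t - a) - iteratedFDeriv ℝ n g t‖
      ≤ ‖t‖ ^ k * ((1 + ‖a‖) ^ k * (2 ^ k * supSeminorm (k, n + 1) g) / ‖t‖ ^ k * ‖a‖) := by gcongr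
    _ = _ := by field_simp

/-- The difference from the value at `z₀` splits into the translate of `Γ z - Γ z₀` and the effect
of translating the fixed function `g₀` by `a z - a z₀`. The two preceding bounds control one part
each. -/
theorem continuous_translate {Z : Type*} [TopologicalSpace Z] {a : Z → V} (ha : Continuous a)
    {Γ : Z → 𝓢(V, ℂ)} (hΓ : Continuous Γ) :
    Continuous fun z => SchwartzMap.compSubConstCLM ℂ (a z) (Γ z) := by
  refine continuous_iff_continuousAt.2 fun z₀ => ?_
  refine ((schwartz_withSeminorms ℝ V ℂ).tendsto_nhds _ _).2 fun i ε hε => ?_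
  obtain ⟨k, n⟩ := i
  set g₀ := SchwartzMap.compSubConstCLM ℂ (a z₀) (Γ z₀)
  have hb : Continuous fun z => (1 + ‖a z‖) ^ k * (2 ^ k * supSeminorm (k, n) (Γ z - Γ z₀)) +
      (1 + ‖a z - a z₀‖) ^ k * (2 ^ k * supSeminorm (k, n + 1) g₀) * ‖a z - a z₀‖ := by
    have h1 : Continuous fun z => supSeminorm (k, n) (Γ z - Γ z₀) :=
      (continuous_supSeminorm _).comp (hΓ.sub continuous_const)
    fun_prop
  have hlim := hb.tendsto z₀
  simp only [sub_self, map_zero, mul_zero, norm_zero, add_zero] at hlim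
  filter_upwards [hlim.eventually_lt_const hε] with z hz
  refine lt_of_le_of_lt ?_ hz
  have hsplit : SchwartzMap.compSubConstCLM ℂ (a z) (Γ z) - g₀ =
      SchwartzMap.compSubConstCLM ℂ (a z) (Γ z - Γ z₀) +
        (SchwartzMap.compSubConstCLM ℂ (a z - a z₀) g₀ - g₀) := by
    rw [SchwartzMap.compSubConstCLM_comp, add_sub_cancel, map_sub]
    abel
  rw [hsplit]
  refine (map_add_le_add _ _ _).trans (add_le_add ?_ ?_)
  · exact seminorm_translate_le k n _ _
  · exact seminorm_translate_sub_le k n _ _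

/-- Polynomial growth of all seminorms of a family of Schwartz functions. -/
def HasPolyGrowth {Z : Type*} [Norm Z] (Γ : Z → 𝓢(V, ℂ)) : Prop :=
  ∀ m : ℕ × ℕ, ∃ (C : ℝ) (N : ℕ), 0 ≤ C ∧ ∀ z, supSeminorm m (Γ z) ≤ C * (1 + ‖z‖) ^ N

variable {Z : Type*} [SeminormedAddGroup Z]

theorem hasPolyGrowth_const (g : 𝓢(V, ℂ)) : HasPolyGrowth fun _ : Z => g :=
  fun m => ⟨supSeminorm m g, 0, apply_nonneg _ _, fun z => by simp⟩

/-- By continuity each seminorm of the image is bounded by finitely many seminorms of `Γ z`, hence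
by one supremum seminorm. -/
theorem HasPolyGrowth.clm {W : Type} [NormedAddCommGroup W] [NormedSpace ℝ W]
    {Γ : Z → 𝓢(V, ℂ)} (hΓ : HasPolyGrowth Γ) (L : 𝓢(V, ℂ) →L[ℝ] 𝓢(W, ℂ)) :
    HasPolyGrowth fun z => L (Γ z) := by
  intro m
  obtain ⟨s, C, -, hC⟩ := Seminorm.bound_of_continuous (schwartz_withSeminorms ℝ V ℂ)
    ((supSeminorm m).comp L.toLinearMap) ((continuous_supSeminorm m).comp L.continuous)
  set m' : ℕ × ℕ := s.sup id
  obtain ⟨A, N, hA, h⟩ := hΓ m'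
  refine ⟨C * A, N, by positivity, fun z => ?_⟩
  calc supSeminorm m (L (Γ z)) ≤ (C • s.sup (schwartzSeminormFamily ℝ V ℂ)) (Γ z) := hC _
    _ = C * s.sup (schwartzSeminormFamily ℝ V ℂ) (Γ z) := by
        rw [smul_apply, NNReal.smul_def, smul_eq_mul]
    _ ≤ C * supSeminorm m' (Γ z) := by
        gcongr
        refine Seminorm.finset_sup_apply_le (apply_nonneg _ _) fun i hi => ?_
        exact seminorm_le_supSeminorm (Finset.le_sup (f := id) hi) _
    _ ≤ C * (A * (1 + ‖z‖) ^ N) := by gcongr; exact h z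
    _ = _ := by ring

theorem HasPolyGrowth.translate {Γ : Z → 𝓢(V, ℂ)} (hΓ : HasPolyGrowth Γ) {a : Z → V} {B : ℝ}
    (ha : ∀ z, 1 + ‖a z‖ ≤ B * (1 + ‖z‖)) :
    HasPolyGrowth fun z => SchwartzMap.compSubConstCLM ℂ (a z) (Γ z) := by
  intro m
  obtain ⟨A, N, hA, h⟩ := hΓ m
  have hB : 1 ≤ B := by
    have h1 := ha 0
    rw [norm_zero, add_zero, mul_one] at h1
    linarith [norm_nonneg (a 0)]
  refine ⟨B ^ m.1 * 2 ^ m.1 * A, m.1 + N, by positivity, fun z => ?_⟩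
  refine supSeminorm_le (by positivity) fun k n hkn => ?_
  have hk : k ≤ m.1 := hkn.1
  calc _ ≤ (1 + ‖a z‖) ^ k * (2 ^ k * supSeminorm (k, n) (Γ z)) := seminorm_translate_le k n _ _
    _ ≤ (1 + ‖a z‖) ^ m.1 * (2 ^ m.1 * supSeminorm m (Γ z)) := by
        have h2 : supSeminorm (k, n) (Γ z) ≤ supSeminorm m (Γ z) :=
          supSeminorm_le (apply_nonneg _ _) fun k' n' h' => seminorm_le_supSeminorm (h'.trans hkn) _
        have h3 : 1 ≤ 1 + ‖a z‖ := by linarith [norm_nonneg (a z)]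
        gcongr
        exact one_le_two
    _ ≤ (B * (1 + ‖z‖)) ^ m.1 * (2 ^ m.1 * (A * (1 + ‖z‖) ^ N)) := by
        gcongr
        · exact ha z
        · exact h z
    _ = _ := by rw [mul_pow, pow_add]; ring

end Translation

/-! ### Time-frequency shifts as translations on both sides of the Fourier transform -/

section Shift

open FourierTransform

variable {d : ℕ}

theorem character_eq (ξ t : Space d) : character ξ t = Real.fourierChar (inner ℝ t ξ) := by
  rw [character, Real.fourierChar_apply]
  congr 1
  push_cast
  ring

theorem norm_character (ξ t : Space d) : ‖character ξ t‖ = 1 := by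
  rw [character_eq]
  exact Circle.norm_coe _

theorem fourier_smulLeft_character (ξ : Space d) (g : 𝓢(Space d, ℂ)) :
    𝓕 (SchwartzMap.smulLeftCLM ℂ (character ξ) g) = SchwartzMap.compSubConstCLM ℂ ξ (𝓕 g) := by
  ext η
  rw [SchwartzMap.compSubConstCLM_apply, SchwartzMap.fourier_coe, SchwartzMap.fourier_coe,
    Real.fourier_eq', Real.fourier_eq']
  congr 1
  ext t
  rw [SchwartzMap.smulLeftCLM_apply_apply (hasTemperateGrowth_character ξ), character, smul_eq_mul,
    smul_eq_mul, smul_eq_mul, ← mul_assoc, ← Complex.exp_add, inner_sub_right]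
  congr 2
  push_cast
  ring

/-- Modulation is translation on the Fourier side, so continuity and polynomial growth of `z ↦ π_z
g` reduce to translations and continuous linear maps. -/
theorem shift_eq_fourierInv (z : Phase d) (g : 𝓢(Space d, ℂ)) :
    shift z g = 𝓕⁻ (SchwartzMap.compSubConstCLM ℂ (freqPart z)
      (𝓕 (SchwartzMap.compSubConstCLM ℂ (timePart z) g))) := by
  rw [← fourier_smulLeft_character, fourierInv_fourier_eq, shift]

theorem continuous_timePart : Continuous (timePart : Phase d → Space d) := by
  unfold timePart
  fun_prop

theorem continuous_freqPart : Continuous (freqPart : Phase d → Space d) := by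
  unfold freqPart
  fun_prop

theorem continuous_shift (g : 𝓢(Space d, ℂ)) : Continuous fun z : Phase d => shift z g := by
  simp_rw [shift_eq_fourierInv]
  refine (fourierInvCLM ℂ 𝓢(Space d, ℂ)).continuous.comp
    (continuous_translate continuous_freqPart ?_)
  exact (fourierCLM ℂ 𝓢(Space d, ℂ)).continuous.comp
    (continuous_translate continuous_timePart continuous_const)

theorem exists_norm_timePart_freqPart_le (d : ℕ) : ∃ B : ℝ, ∀ z : Phase d,
    1 + ‖timePart z‖ ≤ B * (1 + ‖z‖) ∧ 1 + ‖freqPart z‖ ≤ B * (1 + ‖z‖) := by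
  obtain ⟨B, hB, h⟩ := exists_one_add_norm_toLp_le d
  refine ⟨B, fun z => ⟨(h _).trans ?_, (h _).trans ?_⟩⟩ <;> gcongr <;>
    exact (pi_norm_le_iff_of_nonneg (norm_nonneg z)).2 fun i => norm_le_pi_norm z _

theorem hasPolyGrowth_shift (g : 𝓢(Space d, ℂ)) : HasPolyGrowth fun z : Phase d => shift z g := by
  simp_rw [shift_eq_fourierInv]
  obtain ⟨B, hB⟩ := exists_norm_timePart_freqPart_le d
  exact ((((hasPolyGrowth_const g).translate fun z => (hB z).1).clm
    ((fourierCLM ℂ 𝓢(Space d, ℂ)).restrictScalars ℝ)).translate fun z => (hB z).2).clm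
    ((fourierInvCLM ℂ 𝓢(Space d, ℂ)).restrictScalars ℝ)

/-- Complex conjugation of Schwartz functions as a real linear map. -/
def conjCLM (d : ℕ) : 𝓢(Space d, ℂ) →L[ℝ] 𝓢(Space d, ℂ) :=
  SchwartzMap.postcompCLM (Complex.conjCLE : ℂ →L[ℝ] ℂ)

theorem conjS_conjS (g : 𝓢(Space d, ℂ)) : conjS (conjS g) = g := by
  ext t
  simp [conjS_apply]

theorem continuous_conjS_shift (g : 𝓢(Space d, ℂ)) :
    Continuous fun z : Phase d => conjS (shift z g) :=
  (conjCLM d).continuous.comp (continuous_shift g)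

theorem hasPolyGrowth_conjS_shift (g : 𝓢(Space d, ℂ)) :
    HasPolyGrowth fun z : Phase d => conjS (shift z g) :=
  (hasPolyGrowth_shift g).clm (conjCLM d)

theorem continuous_gabor (φ : 𝓢(Space d, ℂ)) (f : 𝓢'(Space d, ℂ)) : Continuous (gabor φ f) :=
  (map_continuous f).comp (continuous_conjS_shift φ)

end Shift

/-! ### Decay of the Gabor transform of Schwartz functions -/

section Decay

open FourierTransform

variable {d : ℕ}

theorem exists_pow_mul_norm_le (h : 𝓢(Space d, ℂ)) (N : ℕ) :
    ∃ C : ℝ, 0 ≤ C ∧ ∀ t, (1 + ‖t‖) ^ N * ‖h t‖ ≤ C := by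
  refine ⟨2 ^ N * supSeminorm (N, 0) h, by positivity, fun t => ?_⟩
  have := SchwartzMap.one_add_le_sup_seminorm_apply (𝕜 := ℝ) (m := (N, 0)) le_rfl le_rfl h t
  simpa using! this

theorem integrable_pow_mul_norm (h : 𝓢(Space d, ℂ)) (N : ℕ) :
    Integrable fun t => (1 + ‖t‖) ^ N * ‖h t‖ := by
  have h1 : Integrable fun t => ∑ i ∈ Finset.range (N + 1), (N.choose i : ℝ) * (‖t‖ ^ i * ‖h t‖) :=
    integrable_finsetSum _ fun i _ => (SchwartzMap.integrable_pow_mul volume h i).const_mul _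
  refine h1.congr (Filter.Eventually.of_forall fun t => ?_)
  simp only
  rw [add_comm 1 ‖t‖, add_pow, Finset.sum_mul]
  refine Finset.sum_congr rfl fun i _ => ?_
  ring

/-- `(1 + ‖a‖)^N ≤ (1 + ‖t‖)^N (1 + ‖t - a‖)^N`: the decay of `h` absorbs the second factor and that
of `g` the first. -/
theorem exists_integral_translate_le (g h : 𝓢(Space d, ℂ)) (N : ℕ) :
    ∃ C : ℝ, 0 ≤ C ∧ ∀ a, ∫ t, ‖g t‖ * ‖h (t - a)‖ ≤ C * ((1 + ‖a‖) ^ N)⁻¹ := by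
  obtain ⟨C, hC, hh⟩ := exists_pow_mul_norm_le h N
  refine ⟨C * ∫ t, (1 + ‖t‖) ^ N * ‖g t‖, by positivity, fun a => ?_⟩
  have hpos : 0 < (1 + ‖a‖) ^ N := by positivity
  have h1 : ∀ t, ‖g t‖ * ‖h (t - a)‖ ≤ (C * ((1 + ‖a‖) ^ N)⁻¹) * ((1 + ‖t‖) ^ N * ‖g t‖) := by
    intro t
    have h2 : (1 + ‖a‖) ^ N ≤ (1 + ‖t‖) ^ N * (1 + ‖t - a‖) ^ N := by
      rw [← mul_pow]
      gcongr
      have h3 : ‖a‖ ≤ ‖t‖ + ‖t - a‖ := by simpa using norm_sub_le t (t - a)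
      nlinarith [mul_nonneg (norm_nonneg t) (norm_nonneg (t - a))]
    have h4 : (1 + ‖a‖) ^ N * ‖h (t - a)‖ ≤ (1 + ‖t‖) ^ N * C :=
      calc _ ≤ (1 + ‖t‖) ^ N * (1 + ‖t - a‖) ^ N * ‖h (t - a)‖ := by gcongr
        _ = (1 + ‖t‖) ^ N * ((1 + ‖t - a‖) ^ N * ‖h (t - a)‖) := by ring
        _ ≤ _ := by gcongr; exact hh _
    calc ‖g t‖ * ‖h (t - a)‖
        = ((1 + ‖a‖) ^ N)⁻¹ * ‖g t‖ * ((1 + ‖a‖) ^ N * ‖h (t - a)‖) := by field_simp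
      _ ≤ ((1 + ‖a‖) ^ N)⁻¹ * ‖g t‖ * ((1 + ‖t‖) ^ N * C) := by gcongr
      _ = _ := by ring
  calc ∫ t, ‖g t‖ * ‖h (t - a)‖
      ≤ ∫ t, (C * ((1 + ‖a‖) ^ N)⁻¹) * ((1 + ‖t‖) ^ N * ‖g t‖) :=
        integral_mono_of_nonneg (Filter.Eventually.of_forall fun t => by positivity)
          ((integrable_pow_mul_norm g N).const_mul _) (Filter.Eventually.of_forall h1)
    _ = _ := by
        rw [integral_const_mul]
        ring

theorem gabor_coe (φ g : 𝓢(Space d, ℂ)) (z : Phase d) :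
    gabor φ (g : 𝓢'(Space d, ℂ)) z = ∫ t, conj (shift z φ t) * g t := by
  rw [gabor, SchwartzMap.coe_apply]
  rfl

theorem norm_shift_apply (z : Phase d) (g : 𝓢(Space d, ℂ)) (t : Space d) :
    ‖shift z g t‖ = ‖g (t - timePart z)‖ := by
  rw [shift_apply, shiftFun, norm_mul, norm_character, one_mul]

theorem norm_fourier_translate (a : Space d) (g : 𝓢(Space d, ℂ)) (η : Space d) :
    ‖𝓕 (SchwartzMap.compSubConstCLM ℂ a g) η‖ = ‖𝓕 g η‖ := by
  have h := congrFun (VectorFourier.fourierIntegral_comp_add_right Real.fourierChar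
    (volume : Measure (Space d)) (innerₗ (Space d)) g (-a)) η
  have h2 : (g ∘ fun v : Space d => v + -a) = SchwartzMap.compSubConstCLM ℂ a g := by
    ext t
    simp [sub_eq_add_neg]
  rw [h2] at h
  have h3 := congrArg norm h
  rw [Circle.norm_smul] at h3
  exact h3

theorem norm_fourier_shift (z : Phase d) (g : 𝓢(Space d, ℂ)) (η : Space d) :
    ‖𝓕 (shift z g) η‖ = ‖𝓕 g (η - freqPart z)‖ := by
  rw [shift, fourier_smulLeft_character, SchwartzMap.compSubConstCLM_apply,
    norm_fourier_translate]

theorem norm_le_max_timePart_freqPart (z : Phase d) :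
    ‖z‖ ≤ max ‖timePart z‖ ‖freqPart z‖ := by
  refine (pi_norm_le_iff_of_nonneg (le_max_of_le_left (norm_nonneg _))).2 fun i => ?_
  refine Fin.addCases (fun i => ?_) (fun i => ?_) i
  · exact le_max_of_le_left (PiLp.norm_apply_le (timePart z) i)
  · exact le_max_of_le_right (PiLp.norm_apply_le (freqPart z) i)

/-- Decay in time comes from the integral of `|g|` against translates of `|φ|`, decay in frequency
from the same integral after Parseval; the larger of the two parts controls `‖z‖`. -/
theorem hasRapidDecay_gabor (φ g : 𝓢(Space d, ℂ)) :
    HasRapidDecay (gabor φ (g : 𝓢'(Space d, ℂ))) := by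
  intro N
  obtain ⟨A, hA, h1⟩ := exists_integral_translate_le g φ N
  obtain ⟨B, hB, h2⟩ := exists_integral_translate_le (𝓕 g) (𝓕 φ) N
  refine ⟨max A B, by positivity, fun z => ?_⟩
  have e1 : ‖gabor φ (g : 𝓢'(Space d, ℂ)) z‖ ≤ A * ((1 + ‖timePart z‖) ^ N)⁻¹ := by
    rw [gabor_coe]
    refine (norm_integral_le_integral_norm _).trans (le_trans (le_of_eq ?_) (h1 (timePart z)))
    congr 1
    ext t
    rw [norm_mul, RCLike.norm_conj, norm_shift_apply, mul_comm]
  have e2 : ‖gabor φ (g : 𝓢'(Space d, ℂ)) z‖ ≤ B * ((1 + ‖freqPart z‖) ^ N)⁻¹ := by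
    have h := SchwartzMap.integral_inner_fourier_fourier (shift z φ) g
    simp only [RCLike.inner_apply, mul_comm _ (conj _)] at h
    rw [gabor_coe, ← h]
    refine (norm_integral_le_integral_norm _).trans (le_trans (le_of_eq ?_) (h2 (freqPart z)))
    congr 1
    ext t
    rw [norm_mul, RCLike.norm_conj, norm_fourier_shift, mul_comm]
  rcases le_max_iff.1 (norm_le_max_timePart_freqPart z) with h | h
  · refine e1.trans ?_
    gcongr
    exact le_max_left _ _
  · refine e2.trans ?_
    gcongr
    exact le_max_right _ _

theorem HasRapidDecay.integrable {n : ℕ} {F : (Fin n → ℝ) → ℂ} (hF : HasRapidDecay F)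
    (hc : Continuous F) : Integrable F := by
  obtain ⟨C, hC, h⟩ := hF (n + 1)
  have h1 : Integrable fun z : Fin n → ℝ => C * (1 + ‖z‖) ^ (-((n + 1 : ℕ) : ℝ)) :=
    (integrable_one_add_norm (by simp)).const_mul C
  refine h1.mono' hc.aestronglyMeasurable (Filter.Eventually.of_forall fun z => ?_)
  rw [Real.rpow_neg (by positivity), Real.rpow_natCast]
  exact h z

theorem HasRapidDecay.mul_pow_integrable {n : ℕ} {F : (Fin n → ℝ) → ℂ} (hF : HasRapidDecay F)
    (hc : Continuous F) (N : ℕ) : Integrable fun z => ‖F z‖ * (1 + ‖z‖) ^ N := by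
  obtain ⟨C, hC, h⟩ := hF (n + 1 + N)
  have h1 : Integrable fun z : Fin n → ℝ => C * (1 + ‖z‖) ^ (-((n + 1 : ℕ) : ℝ)) :=
    (integrable_one_add_norm (by simp)).const_mul C
  refine h1.mono' (by fun_prop) (Filter.Eventually.of_forall fun z => ?_)
  rw [Real.rpow_neg (by positivity), Real.rpow_natCast, norm_mul, norm_norm, norm_pow,
    Real.norm_of_nonneg (by positivity : 0 ≤ 1 + ‖z‖)]
  calc ‖F z‖ * (1 + ‖z‖) ^ N ≤ C * ((1 + ‖z‖) ^ (n + 1 + N))⁻¹ * (1 + ‖z‖) ^ N := by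
        gcongr
        exact h z
    _ = _ := by
        have : (1 + ‖z‖) ≠ 0 := by positivity
        rw [pow_add]
        field_simp

end Decay

/-! ### Inversion with Schwartz windows -/

section Inversion

open FourierTransform

variable {d : ℕ}

/-- Phase space as the product of time and frequency. -/
def phaseEquiv (d : ℕ) : Phase d ≃ᵐ Space d × Space d :=
  ((MeasurableEquiv.piCongrLeft (fun _ => ℝ) finSumFinEquiv).symm.trans
    (MeasurableEquiv.sumPiEquivProdPi fun _ : Fin d ⊕ Fin d => ℝ)).trans
    ((MeasurableEquiv.toLp 2 (Fin d → ℝ)).prodCongr (MeasurableEquiv.toLp 2 (Fin d → ℝ)))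

theorem phaseEquiv_apply (z : Phase d) : phaseEquiv d z = (timePart z, freqPart z) := rfl

theorem measurePreserving_phaseEquiv (d : ℕ) :
    MeasurePreserving (phaseEquiv d) volume (volume.prod volume) := by
  have h1 := (volume_measurePreserving_piCongrLeft (fun _ : Fin (d + d) => ℝ) finSumFinEquiv).symm
  have h2 := volume_measurePreserving_sumPiEquivProdPi fun _ : Fin d ⊕ Fin d => ℝ
  have h3 := (PiLp.volume_preserving_toLp (Fin d)).prod (PiLp.volume_preserving_toLp (Fin d))
  exact h3.comp (h2.comp h1)

/-- In this form the frequency integral in the inversion formula is an inverse Fourier transform. -/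
theorem gabor_eq_fourier (b h : 𝓢(Space d, ℂ)) (z : Phase d) :
    gabor b (h : 𝓢'(Space d, ℂ)) z = 𝓕 (SchwartzMap.smulLeftCLM ℂ h
      (SchwartzMap.compSubConstCLM ℂ (timePart z) (conjS b))) (freqPart z) := by
  rw [gabor_coe, SchwartzMap.fourier_coe, Real.fourier_eq']
  congr 1
  ext t
  rw [SchwartzMap.smulLeftCLM_apply_apply h.hasTemperateGrowth, shift_apply, shiftFun, map_mul,
    character, ← Complex.exp_conj, SchwartzMap.compSubConstCLM_apply, conjS_apply, smul_eq_mul,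
    smul_eq_mul]
  simp only [map_mul, Complex.conj_ofReal, Complex.conj_I, Complex.conj_ofNat]
  rw [mul_assoc, mul_comm (conj _) (h t)]
  congr 2
  push_cast
  ring

/-- Inversion of the Gabor transform on Schwartz functions. -/
theorem integral_gabor_mul_shift (a b h : 𝓢(Space d, ℂ)) (t : Space d) :
    ∫ z : Phase d, gabor b (h : 𝓢'(Space d, ℂ)) z * shift z a t =
      (∫ s, a s * conj (b s)) * h t := by
  set P : Space d → 𝓢(Space d, ℂ) := fun x => SchwartzMap.smulLeftCLM ℂ h
    (SchwartzMap.compSubConstCLM ℂ x (conjS b))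
  set Q : Space d × Space d → ℂ := fun q => 𝓕 (P q.1) q.2 * (character q.2 t * a (t - q.1))
  have hQ : ∀ z : Phase d, gabor b (h : 𝓢'(Space d, ℂ)) z * shift z a t = Q (phaseEquiv d z) := by
    intro z
    rw [gabor_eq_fourier, shift_apply, shiftFun, phaseEquiv_apply]
  have hint : Integrable fun z : Phase d => gabor b (h : 𝓢'(Space d, ℂ)) z * shift z a t := by
    refine ((hasRapidDecay_gabor b h).integrable (continuous_gabor b _)).mul_bdd
      (c := SchwartzMap.seminorm ℝ 0 0 a)
      (continuous_schwartz_apply (continuous_shift a) t).aestronglyMeasurable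
      (Filter.Eventually.of_forall fun z => ?_)
    rw [norm_shift_apply]
    exact SchwartzMap.norm_le_seminorm ℝ a _
  simp_rw [hQ] at hint ⊢
  rw [(measurePreserving_phaseEquiv d).integral_comp' Q, integral_prod]
  -- Fourier inversion in `ξ` leaves `h(t) a(t - x) conj (b(t - x))`, and the integral over `x` is
  -- then the constant `∫ a conj b`.
  · have hin : ∀ x, ∫ ξ, Q (x, ξ) = h t * (fun y => a y * conj (b y)) (t - x) := by
      intro x
      have h1 : ∫ ξ, Q (x, ξ) = (∫ ξ, character ξ t * 𝓕 (P x) ξ) * a (t - x) := by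
        rw [← integral_mul_const]
        congr 1
        ext ξ
        simp only [Q]
        ring
      have h2 : ∫ ξ, character ξ t * 𝓕 (P x) ξ = P x t := by
        have h3 : 𝓕⁻ (𝓕 (P x)) t = P x t := by rw [fourierInv_fourier_eq]
        rw [SchwartzMap.fourierInv_coe, Real.fourierInv_eq'] at h3
        rw [← h3]
        congr 1
        ext ξ
        rw [smul_eq_mul, character, real_inner_comm]
        congr 2
        push_cast
        ring
      rw [h1, h2]
      simp only [P, SchwartzMap.smulLeftCLM_apply_apply h.hasTemperateGrowth,
        SchwartzMap.compSubConstCLM_apply, conjS_apply, smul_eq_mul]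
      ring
    simp_rw [hin]
    rw [integral_const_mul, integral_sub_left_eq_self (fun y => a y * conj (b y)), mul_comm]
  · exact ((measurePreserving_phaseEquiv d).integrable_comp_emb
      (phaseEquiv d).measurableEmbedding).1 hint

/-- The orthogonality relation of Gabor transforms, for a tempered distribution and a Schwartz
function. -/
theorem integral_gabor_mul_conj_gabor (f : 𝓢'(Space d, ℂ)) (a b h : 𝓢(Space d, ℂ)) :
    (Integrable fun z : Phase d => gabor a f z * conj (gabor b (h : 𝓢'(Space d, ℂ)) z)) ∧
    ∫ z : Phase d, gabor a f z * conj (gabor b (h : 𝓢'(Space d, ℂ)) z) =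
      (∫ s, b s * conj (a s)) * f (conjS h) := by
  set k : Phase d → ℂ := fun z => conj (gabor b (h : 𝓢'(Space d, ℂ)) z)
  have hk : Continuous k := Complex.continuous_conj.comp (continuous_gabor b _)
  -- The conjugated inversion formula exhibits `⟨b, a⟩ conj h` as the integral of this family, to
  -- which `f` is applied.
  set Γ : Phase d → 𝓢(Space d, ℂ) := fun z => k z • conjS (shift z a)
  have hΓ : Continuous Γ := hk.smul (continuous_conjS_shift a)
  -- The rapid decay of `V_b h` beats the polynomial growth of the seminorms of `π_z a`.
  have hint : ∀ m n, Integrable fun z => SchwartzMap.seminorm ℝ m n (Γ z) := by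
    intro m n
    obtain ⟨C, N, hC, hN⟩ := hasPolyGrowth_conjS_shift a (m, n)
    refine (((hasRapidDecay_gabor b h).mul_pow_integrable (continuous_gabor b _) N).const_mul C
      ).mono' (continuous_seminorm_comp hΓ m n).aestronglyMeasurable
      (Filter.Eventually.of_forall fun z => ?_)
    rw [Real.norm_of_nonneg (apply_nonneg _ _)]
    have h1 : SchwartzMap.seminorm ℝ m n (Γ z) =
        ‖k z‖ * SchwartzMap.seminorm ℝ m n (conjS (shift z a)) :=
      map_smul_eq_mul (SchwartzMap.seminorm ℂ m n) (k z) (conjS (shift z a))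
    rw [h1, RCLike.norm_conj]
    calc _ ≤ ‖gabor b (h : 𝓢'(Space d, ℂ)) z‖ * (C * (1 + ‖z‖) ^ N) := by
          gcongr
          exact (seminorm_le_supSeminorm le_rfl _).trans (hN z)
      _ = _ := by ring
  have hG : ∀ t, ((∫ s, b s * conj (a s)) • conjS h) t = ∫ z, Γ z t := by
    intro t
    have h1 := congrArg conj (integral_gabor_mul_shift a b h t)
    rw [← integral_conj, map_mul, ← integral_conj] at h1
    simp only [map_mul, Complex.conj_conj] at h1
    simp only [mul_comm (b _)]
    exact h1.symm
  obtain ⟨h1, h2⟩ := apply_eq_integral_apply f hΓ hint hG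
  have h3 : ∀ z, f (Γ z) = gabor a f z * conj (gabor b (h : 𝓢'(Space d, ℂ)) z) := by
    intro z
    simp only [Γ, map_smul, smul_eq_mul, mul_comm (k z)]
    rfl
  simp_rw [h3] at h1 h2
  refine ⟨h1, ?_⟩
  rw [← h2, map_smul, smul_eq_mul]

end Inversion

/-! ### Mixed norms of almost everywhere measurable functions -/

section AEMeasurable

variable {n : ℕ} {p : Fin n → ℝ≥0∞}

theorem mixedNorm_one_of_aemeasurable {G : (Fin n → ℝ) → ℝ≥0∞} (hG : AEMeasurable G) :
    mixedNorm n (fun _ => 1) G = ∫⁻ x, G x := by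
  rw [mixedNorm_congr_ae hG.ae_eq_mk, mixedNorm_one hG.measurable_mk,
    lintegral_congr_ae hG.ae_eq_mk]

theorem lintegral_mul_le_mixedNorm_of_aemeasurable {q : Fin n → ℝ≥0∞}
    (hpq : ∀ i, (p i).HolderConjugate (q i)) {G H : (Fin n → ℝ) → ℝ≥0∞}
    (hG : AEMeasurable G) (hH : AEMeasurable H) :
    ∫⁻ x, G x * H x ≤ mixedNorm n p G * mixedNorm n q H := by
  rw [mixedNorm_congr_ae hG.ae_eq_mk, mixedNorm_congr_ae hH.ae_eq_mk,
    lintegral_congr_ae (f := fun x => G x * H x) (hG.ae_eq_mk.mul hH.ae_eq_mk)]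
  exact lintegral_mul_le_mixedNorm hpq hG.measurable_mk hH.measurable_mk

theorem mixedNorm_comp_add_of_aemeasurable (hp : ∀ i, 1 ≤ p i) {G : (Fin n → ℝ) → ℝ≥0∞}
    (hG : AEMeasurable G) (a : Fin n → ℝ) :
    mixedNorm n p (fun x => G (x + a)) = mixedNorm n p G := by
  rw [mixedNorm_congr_ae hG.ae_eq_mk, ← mixedNorm_comp_add hp hG.measurable_mk a]
  exact mixedNorm_congr_ae
    ((measurePreserving_add_right volume a).quasiMeasurePreserving.ae hG.ae_eq_mk)

theorem mixedNorm_add_le_of_aemeasurable (hp : ∀ i, 1 ≤ p i) {G H : (Fin n → ℝ) → ℝ≥0∞}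
    (hG : AEMeasurable G) (hH : AEMeasurable H) :
    mixedNorm n p (fun x => G x + H x) ≤ mixedNorm n p G + mixedNorm n p H := by
  rw [mixedNorm_congr_ae hG.ae_eq_mk, mixedNorm_congr_ae hH.ae_eq_mk]
  refine le_trans (mixedNorm_congr_ae ?_).le
    (mixedNorm_add_le hp hG.measurable_mk hH.measurable_mk)
  exact hG.ae_eq_mk.add hH.ae_eq_mk

theorem ae_eq_zero_of_mixedNorm_eq_zero_of_aemeasurable (hp : ∀ i, 1 ≤ p i)
    {G : (Fin n → ℝ) → ℝ≥0∞} (hG : AEMeasurable G) (h : mixedNorm n p G = 0) :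
    G =ᵐ[volume] 0 := by
  rw [mixedNorm_congr_ae hG.ae_eq_mk] at h
  exact hG.ae_eq_mk.trans (ae_eq_zero_of_mixedNorm_eq_zero hp hG.measurable_mk h)

theorem mixedNorm_top_const_le (n : ℕ) (a : ℝ≥0∞) :
    mixedNorm n (fun _ => ∞) (fun _ => a) ≤ a := by
  induction n with
  | zero => exact le_rfl
  | succ n ih =>
    refine le_trans (mixedNorm_mono (n := n) fun y => ?_) ih
    rw [eLpNorm_top_ennreal]
    exact essSup_le_of_ae_le a (Filter.Eventually.of_forall fun _ => le_rfl)

end AEMeasurable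

/-! ### Permutation of the coordinates -/

section Permute

variable {d : ℕ} (c : Equiv.Perm (Fin (d + d)))

/-- The permutation of the coordinates as a measurable equivalence. -/
def permuteEquiv : Phase d ≃ᵐ Phase d := (MeasurableEquiv.piCongrLeft (fun _ => ℝ) c).symm

theorem measurePreserving_permute : MeasurePreserving (permute c) volume volume :=
  (volume_measurePreserving_piCongrLeft (fun _ => ℝ) c).symm

theorem measurable_permute : Measurable (permute c) := (measurePreserving_permute c).measurable

theorem lintegral_permute (F : Phase d → ℝ≥0∞) : ∫⁻ z, F (permute c z) = ∫⁻ z, F z :=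
  (measurePreserving_permute c).lintegral_comp_emb (permuteEquiv c).measurableEmbedding F

theorem integral_permute (F : Phase d → ℂ) : ∫ z, F (permute c z) = ∫ z, F z :=
  (measurePreserving_permute c).integral_comp (permuteEquiv c).measurableEmbedding F

theorem permute_add (x y : Phase d) : permute c (x + y) = permute c x + permute c y := rfl

theorem permute_neg (x : Phase d) : permute c (-x) = -permute c x := rfl

theorem norm_permute (z : Phase d) : ‖permute c z‖ = ‖z‖ := by
  refine le_antisymm ?_ ?_
  · exact (pi_norm_le_iff_of_nonneg (norm_nonneg _)).2 fun i => norm_le_pi_norm z (c i)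
  · refine (pi_norm_le_iff_of_nonneg (norm_nonneg _)).2 fun i => ?_
    have := norm_le_pi_norm (permute c z) (c.symm i)
    simpa [permute] using this

theorem HasRapidDecay.comp_permute {F : Phase d → ℂ} (hF : HasRapidDecay F) :
    HasRapidDecay fun z => F (permute c z) := by
  intro N
  obtain ⟨C, hC, h⟩ := hF N
  exact ⟨C, hC, fun z => by simpa only [norm_permute] using h (permute c z)⟩

end Permute

/-! ### Weighted mixed norms -/

section PermutedNorm

variable {d : ℕ} {c : Equiv.Perm (Fin (d + d))} {v w : Phase d → ℝ} {p : Fin (d + d) → ℝ≥0∞}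

theorem aemeasurable_weighted (hw : IsWeight w) {F : Phase d → ℂ} (hF : Measurable F) :
    AEMeasurable fun z => ‖F (permute c z)‖ₑ * ENNReal.ofReal (w z) :=
  (hF.comp (measurable_permute c)).enorm.aemeasurable.mul hw.aemeasurable

theorem permutedNorm_add_le (hw : IsWeight w) (hp : ∀ i, 1 ≤ p i) {F G : Phase d → ℂ}
    (hF : Measurable F) (hG : Measurable G) :
    permutedNorm c w p (fun z => F z + G z) ≤ permutedNorm c w p F + permutedNorm c w p G := by
  refine le_trans (mixedNorm_mono fun z => ?_) (mixedNorm_add_le_of_aemeasurable hp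
    (aemeasurable_weighted hw hF) (aemeasurable_weighted hw hG))
  rw [← add_mul]
  gcongr
  exact enorm_add_le _ _

theorem permutedNorm_const_mul (hp : ∀ i, 1 ≤ p i) (a : ℂ) (F : Phase d → ℂ) :
    permutedNorm c w p (fun z => a * F z) = ‖a‖ₑ * permutedNorm c w p F := by
  rw [permutedNorm, permutedNorm, ← mixedNorm_const_mul hp enorm_ne_top]
  simp_rw [enorm_mul, mul_assoc]

theorem permutedNorm_one (hw : IsWeight w) {F : Phase d → ℂ} (hF : Measurable F) :
    permutedNorm c w (fun _ => 1) F =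
      ∫⁻ z, ‖F (permute c z)‖ₑ * ENNReal.ofReal (w z) :=
  mixedNorm_one_of_aemeasurable (aemeasurable_weighted hw hF)

theorem ae_eq_zero_of_permutedNorm_eq_zero (hw : IsWeight w) (hw_pos : ∀ z, 0 < w z)
    (hp : ∀ i, 1 ≤ p i) {F : Phase d → ℂ} (hF : Measurable F)
    (h : permutedNorm c w p F = 0) : F =ᵐ[volume] 0 := by
  have h1 := ae_eq_zero_of_mixedNorm_eq_zero_of_aemeasurable hp
    (aemeasurable_weighted (c := c) hw hF) h
  have h2 : ∀ᵐ z, F (permute c z) = 0 := by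
    filter_upwards [h1] with z hz
    have h3 : ENNReal.ofReal (w z) ≠ 0 := by simpa using hw_pos z
    simpa [h3] using hz
  have h4 : ∫⁻ z, ‖F z‖ₑ = 0 := by
    rw [← lintegral_permute c, ← lintegral_zero (μ := (volume : Measure (Phase d)))]
    refine lintegral_congr_ae ?_
    filter_upwards [h2] with z hz
    simp [hz]
  rw [lintegral_eq_zero_iff hF.enorm] at h4
  filter_upwards [h4] with z hz
  simpa using hz

/-- The duality estimate between the exponents `∞` and `1`. -/
theorem lintegral_mul_le_top_one (hv : IsWeight v) (hv' : IsWeight fun z => (v z)⁻¹)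
    (hv_pos : ∀ z, 0 < v z) {F G : Phase d → ℝ≥0∞} (hF : Measurable F) (hG : Measurable G) :
    ∫⁻ z, F z * G z ≤
      mixedNorm (d + d) (fun _ => ∞) (fun z => F (permute c z) * ENNReal.ofReal (v z)⁻¹) *
        ∫⁻ z, G (permute c z) * ENNReal.ofReal (v z) := by
  have hGm : AEMeasurable fun z => G (permute c z) * ENNReal.ofReal (v z) :=
    (hG.comp (measurable_permute c)).aemeasurable.mul hv.aemeasurable
  have hFm : AEMeasurable fun z => F (permute c z) * ENNReal.ofReal (v z)⁻¹ :=
    (hF.comp (measurable_permute c)).aemeasurable.mul hv'.aemeasurable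
  rw [← mixedNorm_one_of_aemeasurable hGm, ← lintegral_permute c]
  refine le_trans (le_of_eq (lintegral_congr fun z => ?_))
    (lintegral_mul_le_mixedNorm_of_aemeasurable
      (fun _ => ENNReal.HolderConjugate.top_one) hFm hGm)
  have h1 : ENNReal.ofReal (v z)⁻¹ * ENNReal.ofReal (v z) = 1 := by
    rw [← ENNReal.ofReal_mul (hv'.nonneg z), inv_mul_cancel₀ (hv_pos z).ne', ENNReal.ofReal_one]
  calc F (permute c z) * G (permute c z)
      = F (permute c z) * G (permute c z) * (ENNReal.ofReal (v z)⁻¹ * ENNReal.ofReal (v z)) := by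
        rw [h1, mul_one]
    _ = _ := by ring

end PermutedNorm

/-! ### Covariance of the Gabor transform and the bracket -/

section Covariance

variable {d : ℕ}

theorem character_conj (ξ t : Space d) : conj (character ξ t) = character (-ξ) t := by
  rw [character, character, ← Complex.exp_conj]
  congr 1
  simp [Complex.conj_ofNat]

theorem character_add_right (ξ s t : Space d) :
    character ξ (s + t) = character ξ s * character ξ t := by
  rw [character, character, character, ← Complex.exp_add, inner_add_left]
  congr 1
  push_cast
  ring

theorem character_add_left (ξ η t : Space d) :
    character (ξ + η) t = character ξ t * character η t := by
  rw [character, character, character, ← Complex.exp_add, inner_add_right]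
  congr 1
  push_cast
  ring

theorem timePart_sub (z u : Phase d) : timePart (z - u) = timePart z - timePart u := rfl

theorem freqPart_sub (z u : Phase d) : freqPart (z - u) = freqPart z - freqPart u := rfl

theorem shiftDist_apply (z : Phase d) (f : 𝓢'(Space d, ℂ)) (h : 𝓢(Space d, ℂ)) :
    shiftDist z f h = f (SchwartzMap.compSubConstCLM ℂ (-timePart z)
      (SchwartzMap.smulLeftCLM ℂ (character (freqPart z)) h)) := rfl

/-- Norm estimates only use that the factor in front is unimodular; the inversion formula needs the
exact phase. -/
theorem gabor_shiftDist (φ : 𝓢(Space d, ℂ)) (ψ : 𝓢'(Space d, ℂ)) (z u : Phase d) :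
    gabor φ (shiftDist z ψ) u =
      character (freqPart z - freqPart u) (timePart z) * gabor φ ψ (u - z) := by
  rw [gabor, shiftDist_apply, gabor, ← smul_eq_mul, ← map_smul]
  congr 1
  ext t
  have h1 : t + timePart z - timePart u = t - (timePart u - timePart z) := by abel
  rw [SchwartzMap.compSubConstCLM_apply,
    SchwartzMap.smulLeftCLM_apply_apply (hasTemperateGrowth_character _), smul_apply,
    conjS_apply, conjS_apply, shift_apply, shift_apply, shiftFun, shiftFun, map_mul, map_mul,
    character_conj, character_conj, sub_neg_eq_add, h1, timePart_sub, freqPart_sub,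
    character_add_right, character_add_right, neg_sub, sub_eq_add_neg (freqPart z),
    character_add_left, character_add_left, smul_eq_mul, smul_eq_mul]
  ring

theorem norm_gabor_shiftDist (φ : 𝓢(Space d, ℂ)) (ψ : 𝓢'(Space d, ℂ)) (z u : Phase d) :
    ‖gabor φ (shiftDist z ψ) u‖ = ‖gabor φ ψ (u - z)‖ := by
  rw [gabor_shiftDist, norm_mul, norm_character, one_mul]

theorem enorm_gabor_shiftDist (φ : 𝓢(Space d, ℂ)) (ψ : 𝓢'(Space d, ℂ)) (z u : Phase d) :
    ‖gabor φ (shiftDist z ψ) u‖ₑ = ‖gabor φ ψ (u - z)‖ₑ := by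
  rw [← ofReal_norm, ← ofReal_norm, norm_gabor_shiftDist]

theorem continuous_character : Continuous fun q : Space d × Space d => character q.1 q.2 := by
  unfold character
  fun_prop

theorem continuous_gabor_shiftDist (φ : 𝓢(Space d, ℂ)) (ψ : 𝓢'(Space d, ℂ)) :
    Continuous fun q : Phase d × Phase d => gabor φ (shiftDist q.1 ψ) q.2 := by
  simp_rw [gabor_shiftDist]
  refine Continuous.mul ?_ ((continuous_gabor φ ψ).comp (continuous_snd.sub continuous_fst))
  refine continuous_character.comp (Continuous.prodMk ?_ (continuous_timePart.comp continuous_fst))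
  exact (continuous_freqPart.comp continuous_fst).sub (continuous_freqPart.comp continuous_snd)

theorem integral_mul_conj_eq (φ : 𝓢(Space d, ℂ)) :
    ∫ s, φ s * conj (φ s) = ((∫ t, ‖φ t‖ ^ 2 : ℝ) : ℂ) := by
  refine Eq.trans ?_ integral_ofReal
  congr 1
  ext t
  rw [RCLike.mul_conj]
  norm_cast

theorem integral_norm_sq_pos {φ : 𝓢(Space d, ℂ)} (hφ : φ ≠ 0) : 0 < ∫ t, ‖φ t‖ ^ 2 := by
  obtain ⟨t, ht⟩ : ∃ t, φ t ≠ 0 := by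
    by_contra h
    push Not at h
    exact hφ (by ext t; simpa using h t)
  have h2 : Integrable fun t => ‖φ t‖ ^ 2 := (φ.memLp 2).integrable_norm_pow (by norm_num)
  refine (integral_pos_iff_support_of_nonneg (fun t => by positivity) h2).2 ?_
  exact IsOpen.measure_pos volume (by
    refine isOpen_ne_fun ?_ continuous_const
    fun_prop) ⟨t, by simpa using ht⟩

/-- The bracket with a Schwartz function is the usual one. -/
theorem bracket_coe {φ : 𝓢(Space d, ℂ)} (hφ : φ ≠ 0) (f : 𝓢'(Space d, ℂ)) (g : 𝓢(Space d, ℂ)) :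
    bracket φ f (g : 𝓢'(Space d, ℂ)) = f (conjS g) := by
  rw [bracket, (integral_gabor_mul_conj_gabor f φ φ g).2, integral_mul_conj_eq, ← mul_assoc,
    inv_mul_cancel₀, one_mul]
  exact_mod_cast (integral_norm_sq_pos hφ).ne'

/-- Through this identity the estimates for general windows include the change of one Schwartz
window into another. -/
theorem gaborDist_coe {φ : 𝓢(Space d, ℂ)} (hφ : φ ≠ 0) (g : 𝓢(Space d, ℂ)) (f : 𝓢'(Space d, ℂ)) :
    gaborDist φ (g : 𝓢'(Space d, ℂ)) f = gabor g f := by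
  ext z
  rw [gaborDist, shiftDist_coe, bracket_coe hφ, gabor]

/-- The bracket recovers every value of `f` from its Gabor transform. -/
theorem eq_zero_of_gabor_ae_eq_zero {φ : 𝓢(Space d, ℂ)} (hφ : φ ≠ 0) {f : 𝓢'(Space d, ℂ)}
    (h : gabor φ f =ᵐ[volume] 0) : f = 0 := by
  ext g
  have h1 := bracket_coe hφ f (conjS g)
  rw [conjS_conjS] at h1
  have h2 : ∫ z, gabor φ f z * conj (gabor φ (conjS g : 𝓢'(Space d, ℂ)) z) = 0 := by
    refine integral_eq_zero_of_ae ?_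
    filter_upwards [h] with z hz
    simp [hz]
  rw [← h1, bracket, h2, mul_zero]
  rfl

theorem measurable_gaborDist (φ : 𝓢(Space d, ℂ)) (ψ f : 𝓢'(Space d, ℂ)) :
    Measurable (gaborDist φ ψ f) := by
  have h : StronglyMeasurable fun q : Phase d × Phase d =>
      gabor φ f q.2 * conj (gabor φ (shiftDist q.1 ψ) q.2) :=
    (((continuous_gabor φ f).comp continuous_snd).mul
      (Complex.continuous_conj.comp (continuous_gabor_shiftDist φ ψ))).stronglyMeasurable
  exact (h.integral_prod_right'.measurable).const_mul _

/-- The substitution `u = c(x + s)` writes the correlation in the permuted coordinates, in which the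
mixed norm is taken. -/
theorem lintegral_convolution_permute (c : Equiv.Perm (Fin (d + d))) (A B : Phase d → ℝ≥0∞)
    (x : Phase d) : ∫⁻ u, A u * B (u - permute c x) =
      ∫⁻ s, A (permute c (x + s)) * B (permute c s) := by
  rw [← lintegral_permute c, ← lintegral_add_left_eq_self _ x]
  refine lintegral_congr fun s => ?_
  rw [permute_add, add_sub_cancel_left]

/-- Covariance with the phase discarded. No convergence is required, since the norm of an integral
is always at most the lower integral of the norm. -/
theorem enorm_gaborDist_le (φ : 𝓢(Space d, ℂ)) (ψ f : 𝓢'(Space d, ℂ)) (z : Phase d) :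
    ‖gaborDist φ ψ f z‖ₑ ≤ ‖((∫ t, ‖φ t‖ ^ 2 : ℝ) : ℂ)⁻¹‖ₑ *
      ∫⁻ u, ‖gabor φ f u‖ₑ * ‖gabor φ ψ (u - z)‖ₑ := by
  rw [gaborDist, bracket, enorm_mul]
  gcongr
  refine (enorm_integral_le_lintegral_enorm _).trans (le_of_eq (lintegral_congr fun u => ?_))
  rw [enorm_mul, RCLike.enorm_conj, enorm_gabor_shiftDist]

end Covariance

/-! ### Norm estimates -/

section NormEstimates

variable {d : ℕ} {c : Equiv.Perm (Fin (d + d))} {v w : Phase d → ℝ} {p : Fin (d + d) → ℝ≥0∞}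

theorem measurable_gabor (φ : 𝓢(Space d, ℂ)) (f : 𝓢'(Space d, ℂ)) : Measurable (gabor φ f) :=
  (continuous_gabor φ f).measurable

theorem modNorm_one (hw : IsWeight w) (φ : 𝓢(Space d, ℂ)) (f : 𝓢'(Space d, ℂ)) :
    modNorm φ c w (fun _ => 1) f =
      ∫⁻ z, ‖gabor φ f (permute c z)‖ₑ * ENNReal.ofReal (w z) :=
  permutedNorm_one hw (measurable_gabor φ f)

theorem modNorm_coe_lt_top (hw_growth : HasPolynomialGrowth w) (hp : ∀ i, 1 ≤ p i)
    (φ g : 𝓢(Space d, ℂ)) : modNorm φ c w p (g : 𝓢'(Space d, ℂ)) < ∞ :=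
  (hasRapidDecay_gabor φ g).comp_permute c |>.mixedNorm_lt_top hw_growth hp

/-- The constant of the Gabor transform with a change of window. -/
def invNormSq (φ : 𝓢(Space d, ℂ)) : ℝ≥0∞ := ‖((∫ t, ‖φ t‖ ^ 2 : ℝ) : ℂ)⁻¹‖ₑ

theorem invNormSq_ne_top (φ : 𝓢(Space d, ℂ)) : invNormSq φ ≠ ∞ := enorm_ne_top

/-- Young's inequality applied to the correlation bound; this is the upper estimate in (b). -/
theorem permutedNorm_gaborDist_le (hv : IsWeight v) (hv_symm : IsCoordSymmetric v)
    (hw : IsWeight w) {C : ℝ} (hC : 0 < C) (hvw : ∀ z₁ z₂, w (z₁ + z₂) ≤ C * v z₁ * w z₂)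
    (hp : ∀ i, 1 ≤ p i) (φ : 𝓢(Space d, ℂ)) (ψ f : 𝓢'(Space d, ℂ)) :
    permutedNorm c w p (gaborDist φ ψ f) ≤
      invNormSq φ * (ENNReal.ofReal C * modNorm φ c v (fun _ => 1) ψ) * modNorm φ c w p f := by
  have h1 := mixedNorm_convolution_le hv hv_symm hw hC hvw hp
    (F := fun x => ‖gabor φ f (permute c x)‖ₑ) (K := fun s => ‖gabor φ ψ (permute c s)‖ₑ)
    ((measurable_gabor φ f).comp (measurable_permute c)).enorm
    ((measurable_gabor φ ψ).comp (measurable_permute c)).enorm fun _ => enorm_ne_top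
  rw [← modNorm_one hv] at h1
  refine le_trans (mixedNorm_mono (H := fun x => invNormSq φ *
    ((∫⁻ s, ‖gabor φ f (permute c (x + s))‖ₑ * ‖gabor φ ψ (permute c s)‖ₑ) *
      ENNReal.ofReal (w x))) fun x => ?_) ?_
  · rw [← mul_assoc]
    gcongr
    refine (enorm_gaborDist_le φ ψ f _).trans (le_of_eq ?_)
    rw [lintegral_convolution_permute c (fun u => ‖gabor φ f u‖ₑ) fun u => ‖gabor φ ψ u‖ₑ]
    rfl
  · rw [mixedNorm_const_mul hp (invNormSq_ne_top φ), mul_assoc]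
    gcongr
    exact h1

/-- The change of window is bounded on all tempered distributions. -/
theorem exists_modNorm_le (hv : IsSubmultiplicative v) (hv_growth : HasPolynomialGrowth v)
    (hv_symm : IsCoordSymmetric v) (hw : IsModerate v w) {φ : 𝓢(Space d, ℂ)} (hφ : φ ≠ 0)
    (hp : ∀ i, 1 ≤ p i) (φ' : 𝓢(Space d, ℂ)) :
    ∃ B : ℝ≥0, 0 < B ∧ ∀ f : 𝓢'(Space d, ℂ), modNorm φ' c w p f ≤ B * modNorm φ c w p f := by
  obtain ⟨C, hC, hvw⟩ := hw.exists_pos_const hv.toIsWeight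
  set K := invNormSq φ * (ENNReal.ofReal C * modNorm φ c v (fun _ => 1) (φ' : 𝓢'(Space d, ℂ)))
  have hK : K ≠ ∞ := ENNReal.mul_ne_top (invNormSq_ne_top φ) (ENNReal.mul_ne_top
    ENNReal.ofReal_ne_top (modNorm_coe_lt_top hv_growth (fun _ => le_rfl) φ φ').ne)
  -- The `+ 1` keeps the constant positive even if `K = 0`.
  refine ⟨K.toNNReal + 1, by positivity, fun f => ?_⟩
  have h := permutedNorm_gaborDist_le (c := c) hv.toIsWeight hv_symm hw.toIsWeight hC hvw hp φ
    (φ' : 𝓢'(Space d, ℂ)) f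
  rw [gaborDist_coe hφ] at h
  refine h.trans ?_
  gcongr
  rw [ENNReal.coe_add, ENNReal.coe_toNNReal hK]
  exact le_self_add

theorem mul_le_of_le_mul {a b : ℝ≥0∞} {B : ℝ≥0} (hB : 0 < B) (h : a ≤ B * b) :
    ((B⁻¹ : ℝ≥0) : ℝ≥0∞) * a ≤ b := by
  rw [ENNReal.coe_inv hB.ne', mul_comm, ← div_eq_mul_inv]
  exact ENNReal.div_le_of_le_mul' h

theorem lintegral_gabor_mul_gabor_le (hv : IsSubmultiplicative v) (hv_symm : IsCoordSymmetric v)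
    (hv_ne : v ≠ 0) (φ : 𝓢(Space d, ℂ)) (f g : 𝓢'(Space d, ℂ)) :
    ∫⁻ z, ‖gabor φ f z‖ₑ * ‖gabor φ g z‖ₑ ≤
      modNorm φ c (fun z => (v z)⁻¹) (fun _ => ∞) f * modNorm φ c v (fun _ => 1) g := by
  rw [modNorm_one hv.toIsWeight]
  exact lintegral_mul_le_top_one hv.toIsWeight (hv.isModerate_inv hv_symm hv_ne).toIsWeight
    (hv.pos hv_ne) (measurable_gabor φ f).enorm (measurable_gabor φ g).enorm

theorem integrable_gabor_mul_conj_gabor (hv : IsSubmultiplicative v)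
    (hv_symm : IsCoordSymmetric v) (hv_ne : v ≠ 0) {φ : 𝓢(Space d, ℂ)} {f g : 𝓢'(Space d, ℂ)}
    (hf : f ∈ mixedModSpace φ c (fun z => (v z)⁻¹) fun _ => ∞)
    (hg : g ∈ mixedModSpace φ c v fun _ => 1) :
    Integrable fun z => gabor φ f z * conj (gabor φ g z) := by
  refine ⟨((continuous_gabor φ f).mul
    (Complex.continuous_conj.comp (continuous_gabor φ g))).aestronglyMeasurable, ?_⟩
  refine lt_of_le_of_lt (le_trans (le_of_eq (lintegral_congr fun z => ?_))
    (lintegral_gabor_mul_gabor_le (c := c) hv hv_symm hv_ne φ f g)) (ENNReal.mul_lt_top hf hg)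
  rw [enorm_mul, RCLike.enorm_conj]

theorem enorm_bracket_le (hv : IsSubmultiplicative v) (hv_symm : IsCoordSymmetric v)
    (hv_ne : v ≠ 0) (φ : 𝓢(Space d, ℂ)) (f g : 𝓢'(Space d, ℂ)) :
    ‖bracket φ f g‖ₑ ≤ (invNormSq φ).toNNReal *
      modNorm φ c (fun z => (v z)⁻¹) (fun _ => ∞) f * modNorm φ c v (fun _ => 1) g := by
  rw [ENNReal.coe_toNNReal (invNormSq_ne_top φ), bracket, enorm_mul, mul_assoc]
  refine mul_le_mul' le_rfl ((enorm_integral_le_lintegral_enorm _).trans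
    (le_trans (le_of_eq (lintegral_congr fun z => ?_))
      (lintegral_gabor_mul_gabor_le (c := c) hv hv_symm hv_ne φ f g)))
  rw [enorm_mul, RCLike.enorm_conj]

/-- The reproducing formula bounds `|V_φ f|` by its correlation with `|V_φ φ|`. The weights are
distributed by `w(0) ≤ C v(x) v(s) w(x + s)`, and Hölder's inequality gives a bound uniform in `x`.
-/
theorem modNorm_top_inv_le (hv : IsSubmultiplicative v) (hv_symm : IsCoordSymmetric v)
    (hv_ne : v ≠ 0) (hw : IsModerate v w) (hw_ne : w ≠ 0) (hp : ∀ i, 1 ≤ p i)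
    {φ : 𝓢(Space d, ℂ)} (hφ : φ ≠ 0) {q : Fin (d + d) → ℝ≥0∞}
    (hpq : ∀ i, (p i).HolderConjugate (q i)) {C : ℝ} (hC : 0 < C)
    (hvw : ∀ z₁ z₂, w (z₁ + z₂) ≤ C * v z₁ * w z₂) (f : 𝓢'(Space d, ℂ)) :
    modNorm φ c (fun z => (v z)⁻¹) (fun _ => ∞) f ≤ invNormSq φ * (modNorm φ c w p f *
      (ENNReal.ofReal (C / w 0) * modNorm φ c v q (φ : 𝓢'(Space d, ℂ)))) := by
  have hq : ∀ i, 1 ≤ q i := fun i => have := hpq i; ENNReal.HolderConjugate.one_le (q i) (p i)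
  have hv_pos := hv.pos hv_ne
  have hw_pos := hw.pos hw_ne
  refine le_trans (mixedNorm_mono (n := d + d) fun x => ?_) (mixedNorm_top_const_le (d + d) _)
  have hwv : ∀ s, w 0 ≤ C * (v x * v s) * w (x + s) := by
    intro s
    have h := hvw (-(x + s)) (x + s)
    rw [neg_add_cancel, hv_symm.neg_eq] at h
    refine h.trans ?_
    have := hv.add_le x s
    have := hw.nonneg (x + s)
    gcongr
  have hpt : ∀ s, ENNReal.ofReal (v x)⁻¹ ≤
      ENNReal.ofReal (w (x + s)) * (ENNReal.ofReal (C / w 0) * ENNReal.ofReal (v s)) := by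
    intro s
    rw [← ENNReal.ofReal_mul (by have := hw_pos 0; positivity), ← ENNReal.ofReal_mul (hw.nonneg _)]
    refine ENNReal.ofReal_le_ofReal ?_
    have h0 := hw_pos 0
    rw [inv_le_iff_one_le_mul₀ (hv_pos x), show w (x + s) * (C / w 0 * v s) * v x =
      C * (v x * v s) * w (x + s) / w 0 by ring, one_le_div h0]
    exact hwv s
  have hA : AEMeasurable fun x => ‖gabor φ f (permute c x)‖ₑ * ENNReal.ofReal (w x) :=
    aemeasurable_weighted hw.toIsWeight (measurable_gabor φ f)
  have hB : AEMeasurable fun s => ENNReal.ofReal (C / w 0) *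
      (‖gabor φ (φ : 𝓢'(Space d, ℂ)) (permute c s)‖ₑ * ENNReal.ofReal (v s)) :=
    (aemeasurable_weighted hv.toIsWeight (measurable_gabor φ _)).const_mul _
  have hA' : AEMeasurable fun s =>
      ‖gabor φ f (permute c (x + s))‖ₑ * ENNReal.ofReal (w (x + s)) :=
    hA.comp_quasiMeasurePreserving
      (measurePreserving_add_left (volume : Measure (Phase d)) x).quasiMeasurePreserving
  have h1 := enorm_gaborDist_le φ (φ : 𝓢'(Space d, ℂ)) f (permute c x)
  rw [gaborDist_coe hφ, lintegral_convolution_permute c (fun u => ‖gabor φ f u‖ₑ)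
    fun u => ‖gabor φ (φ : 𝓢'(Space d, ℂ)) u‖ₑ] at h1
  calc ‖gabor φ f (permute c x)‖ₑ * ENNReal.ofReal (v x)⁻¹
      ≤ invNormSq φ * ((∫⁻ s, ‖gabor φ f (permute c (x + s))‖ₑ *
          ‖gabor φ (φ : 𝓢'(Space d, ℂ)) (permute c s)‖ₑ) * ENNReal.ofReal (v x)⁻¹) := by
        rw [← mul_assoc]
        gcongr
        exact h1
    _ ≤ invNormSq φ * ∫⁻ s, (‖gabor φ f (permute c (x + s))‖ₑ * ENNReal.ofReal (w (x + s))) *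
          (ENNReal.ofReal (C / w 0) *
            (‖gabor φ (φ : 𝓢'(Space d, ℂ)) (permute c s)‖ₑ * ENNReal.ofReal (v s))) := by
        rw [← lintegral_mul_const' _ _ ENNReal.ofReal_ne_top]
        refine mul_le_mul' le_rfl (lintegral_mono fun s => ?_)
        calc _ ≤ ‖gabor φ f (permute c (x + s))‖ₑ *
              ‖gabor φ (φ : 𝓢'(Space d, ℂ)) (permute c s)‖ₑ *
              (ENNReal.ofReal (w (x + s)) *
                (ENNReal.ofReal (C / w 0) * ENNReal.ofReal (v s))) := by
              gcongr
              exact hpt s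
          _ = _ := by ring
    _ ≤ _ := by
        refine mul_le_mul' le_rfl
          ((lintegral_mul_le_mixedNorm_of_aemeasurable hpq hA' hB).trans (le_of_eq ?_))
        congr 1
        · simp_rw [add_comm x]
          exact mixedNorm_comp_add_of_aemeasurable hp hA x
        · exact mixedNorm_const_mul hq ENNReal.ofReal_ne_top _

theorem mixedModSpace_subset (hv : IsSubmultiplicative v) (hv_growth : HasPolynomialGrowth v)
    (hv_symm : IsCoordSymmetric v)
    (hv_ne : v ≠ 0) (hw : IsModerate v w) (hw_ne : w ≠ 0) (hp : ∀ i, 1 ≤ p i)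
    {φ : 𝓢(Space d, ℂ)} (hφ : φ ≠ 0) :
    mixedModSpace φ c w p ⊆ mixedModSpace φ c (fun z => (v z)⁻¹) fun _ => ∞ := by
  intro f hf
  obtain ⟨C, hC, hvw⟩ := hw.exists_pos_const hv.toIsWeight
  have hpq := fun i => ENNReal.HolderConjugate.conjExponent (hp i)
  refine lt_of_le_of_lt
    (modNorm_top_inv_le hv hv_symm hv_ne hw hw_ne hp hφ hpq hC hvw f) ?_
  refine ENNReal.mul_lt_top (invNormSq_ne_top φ).lt_top (ENNReal.mul_lt_top hf
    (ENNReal.mul_lt_top ENNReal.ofReal_lt_top (modNorm_coe_lt_top hv_growth (fun i => ?_) φ φ)))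
  have := hpq i
  exact ENNReal.HolderConjugate.one_le _ (p i)

end NormEstimates

/-! ### Square integrable windows -/

section SquareIntegrable

variable {d : ℕ}

theorem norm_toLp_shift (z : Phase d) (g : 𝓢(Space d, ℂ)) :
    ‖(shift z g).toLp 2‖ = ‖g.toLp 2‖ := by
  rw [SchwartzMap.norm_toLp' (by norm_num) (by norm_num),
    SchwartzMap.norm_toLp' (by norm_num) (by norm_num)]
  simp_rw [norm_shift_apply]
  rw [integral_sub_right_eq_self fun t => ‖g t‖ ^ (2 : ℝ≥0∞).toReal]

theorem norm_toLp_conjS (g : 𝓢(Space d, ℂ)) : ‖(conjS g).toLp 2‖ = ‖g.toLp 2‖ := by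
  rw [SchwartzMap.norm_toLp' (by norm_num) (by norm_num),
    SchwartzMap.norm_toLp' (by norm_num) (by norm_num)]
  simp_rw [conjS_apply, RCLike.norm_conj]

theorem toTemperedDistribution_conjS (x : Lp ℂ 2 (volume : Measure (Space d)))
    (h : 𝓢(Space d, ℂ)) :
    Lp.toTemperedDistribution x (conjS h) = inner ℂ (h.toLp 2) x := by
  rw [Lp.toTemperedDistribution_apply, L2.inner_def]
  refine integral_congr_ae ?_
  filter_upwards [h.coeFn_toLp 2] with t ht
  rw [ht, RCLike.inner_apply, conjS_apply, smul_eq_mul, mul_comm]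

theorem gabor_toTemperedDistribution (b : 𝓢(Space d, ℂ))
    (x : Lp ℂ 2 (volume : Measure (Space d))) (z : Phase d) :
    gabor b (Lp.toTemperedDistribution x) z = inner ℂ ((shift z b).toLp 2) x :=
  toTemperedDistribution_conjS x _

theorem norm_gabor_toTemperedDistribution_le (b : 𝓢(Space d, ℂ))
    (x : Lp ℂ 2 (volume : Measure (Space d))) (z : Phase d) :
    ‖gabor b (Lp.toTemperedDistribution x) z‖ ≤ ‖b.toLp 2‖ * ‖x‖ := by
  rw [gabor_toTemperedDistribution, ← norm_toLp_shift z b]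
  exact norm_inner_le_norm _ _

theorem toTemperedDistribution_toLp (h : 𝓢(Space d, ℂ)) :
    Lp.toTemperedDistribution (h.toLp 2) = (h : 𝓢'(Space d, ℂ)) :=
  Lp.toTemperedDistribution_toLp_eq h

/-- Tempered distributions with an integrable Gabor transform are square integrable functions. -/
theorem exists_toTemperedDistribution_eq {φ : 𝓢(Space d, ℂ)} (hφ : φ ≠ 0) {ψ : 𝓢'(Space d, ℂ)}
    (hψ : Integrable (gabor φ ψ)) :
    ∃ x : Lp ℂ 2 (volume : Measure (Space d)), Lp.toTemperedDistribution x = ψ := by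
  set e : 𝓢(Space d, ℂ) →ₗ[ℂ] Lp ℂ 2 (volume : Measure (Space d)) :=
    (SchwartzMap.toLpCLM ℂ ℂ 2 (volume : Measure (Space d))).toLinearMap
  have he : DenseRange e := SchwartzMap.denseRange_toLpCLM (by norm_num)
  -- From `ψ(h) = ⟨ψ, conj h⟩`: one factor of the bracket integral is integrable, and Cauchy-Schwarz
  -- bounds the other by `‖φ‖₂ ‖h‖₂`.
  set C : ℝ := ‖((∫ t, ‖φ t‖ ^ 2 : ℝ) : ℂ)⁻¹‖ * ((∫ z, ‖gabor φ ψ z‖) * ‖φ.toLp 2‖)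
  have hC : ∀ h : 𝓢(Space d, ℂ), ‖ψ h‖ ≤ C * ‖e h‖ := by
    intro h
    have h1 := bracket_coe hφ ψ (conjS h)
    rw [conjS_conjS] at h1
    rw [← h1, bracket, norm_mul, mul_assoc]
    gcongr
    refine (norm_integral_le_integral_norm _).trans ?_
    rw [mul_assoc, ← integral_mul_const]
    refine integral_mono_of_nonneg (Filter.Eventually.of_forall fun z => norm_nonneg _)
      (hψ.norm.mul_const _) (Filter.Eventually.of_forall fun z => ?_)
    simp only [norm_mul, RCLike.norm_conj]
    gcongr
    rw [← toTemperedDistribution_toLp]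
    refine (norm_gabor_toTemperedDistribution_le φ _ z).trans (le_of_eq ?_)
    rw [norm_toLp_conjS]
    rfl
  set T := (ψ : 𝓢(Space d, ℂ) →ₗ[ℂ] ℂ).extendOfNorm e
  have hT : ∀ h, T (e h) = ψ h := fun h => LinearMap.extendOfNorm_eq he ⟨C, hC⟩ h
  set y := (InnerProductSpace.toDual ℂ (Lp ℂ 2 (volume : Measure (Space d)))).symm T
  have hy : ∀ x, inner ℂ y x = T x := fun x => InnerProductSpace.toDual_symm_apply
  -- The inner product conjugates the Riesz representative, the distributional pairing does not.
  refine ⟨star y, ?_⟩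
  ext h
  rw [Lp.toTemperedDistribution_apply, ← hT, ← hy, L2.inner_def]
  refine integral_congr_ae ?_
  filter_upwards [h.coeFn_toLp 2, Lp.coeFn_star y] with t h1 h2
  have h3 : (e h : Space d → ℂ) t = h t := h1
  rw [h2, RCLike.inner_apply, h3]
  rfl

/-- The orthogonality relation of Gabor transforms, for square integrable functions. -/
theorem integral_gabor_mul_conj_gabor_of_integrable (a b : 𝓢(Space d, ℂ))
    (x y : Lp ℂ 2 (volume : Measure (Space d)))
    (hy : Integrable (gabor a (Lp.toTemperedDistribution y))) :
    ∫ z, gabor a (Lp.toTemperedDistribution y) z * conj (gabor b (Lp.toTemperedDistribution x) z) =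
      (∫ s, b s * conj (a s)) * inner ℂ x y := by
  have hd : DenseRange (SchwartzMap.toLpCLM ℝ ℂ 2 (volume : Measure (Space d))) :=
    SchwartzMap.denseRange_toLpCLM (by norm_num)
  obtain ⟨u, hu, hlim⟩ := mem_closure_iff_seq_limit.1 (hd x)
  choose h hh using hu
  have hh' : ∀ n, (h n).toLp 2 = u n := hh
  have heq : ∀ n, ∫ z, gabor a (Lp.toTemperedDistribution y) z *
      conj (gabor b (Lp.toTemperedDistribution (u n)) z) =
      (∫ s, b s * conj (a s)) * inner ℂ (u n) y := by
    intro n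
    rw [← hh' n, toTemperedDistribution_toLp, (integral_gabor_mul_conj_gabor _ a b (h n)).2,
      toTemperedDistribution_conjS]
  have h1 : Filter.Tendsto (fun n => (∫ s, b s * conj (a s)) * inner ℂ (u n) y) Filter.atTop
      (nhds ((∫ s, b s * conj (a s)) * inner ℂ x y)) :=
    (hlim.inner tendsto_const_nhds).const_mul _
  simp_rw [← heq] at h1
  refine tendsto_nhds_unique ?_ h1
  -- Dominated convergence: `V_a y` is integrable, and the transforms of the approximants are
  -- bounded uniformly by `‖b‖₂ M`.
  obtain ⟨M, hM⟩ := hlim.norm.bddAbove_range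
  refine tendsto_integral_of_dominated_convergence
    (fun z => ‖gabor a (Lp.toTemperedDistribution y) z‖ * (‖b.toLp 2‖ * M)) (fun n => ?_)
    (hy.norm.mul_const _) (fun n => Filter.Eventually.of_forall fun z => ?_)
    (Filter.Eventually.of_forall fun z => ?_)
  · exact ((continuous_gabor a _).mul
      (Complex.continuous_conj.comp (continuous_gabor b _))).aestronglyMeasurable
  · rw [norm_mul, RCLike.norm_conj]
    gcongr
    exact (norm_gabor_toTemperedDistribution_le b _ z).trans
      (mul_le_mul_of_nonneg_left (hM ⟨n, rfl⟩) (norm_nonneg _))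
  · simp_rw [gabor_toTemperedDistribution b]
    exact ((Complex.continuous_conj.tendsto _).comp
      (tendsto_const_nhds.inner hlim)).const_mul _

end SquareIntegrable

/-! ### The inversion formula -/

section Synthesis

variable {d : ℕ} {c : Equiv.Perm (Fin (d + d))} {v : Phase d → ℝ}

theorem character_mul_conj (ξ t : Space d) : character ξ t * conj (character ξ t) = 1 := by
  rw [RCLike.mul_conj, norm_character]
  norm_num

/-- `π_z π_u` is `π_(u+z)` up to a phase. It lets a transform with window `φ` at a shifted point be
read as one with window `π_u φ`. -/
theorem gabor_shift (u : Phase d) (φ : 𝓢(Space d, ℂ)) (f : 𝓢'(Space d, ℂ)) (z : Phase d) :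
    gabor (shift u φ) f z = character (freqPart u) (timePart z) * gabor φ f (u + z) := by
  rw [gabor, gabor, ← smul_eq_mul, ← map_smul]
  congr 1
  ext t
  have h1 : t - timePart z - timePart u = t - timePart (u + z) := by
    rw [show timePart (u + z) = timePart u + timePart z from rfl]
    abel
  have h2 : character (freqPart (u + z)) t = character (freqPart z) t * character (freqPart u) t := by
    rw [show freqPart (u + z) = freqPart u + freqPart z from rfl, add_comm, character_add_left]
  have h3 : character (freqPart u) t =
      character (freqPart u) (t - timePart z) * character (freqPart u) (timePart z) := by
    rw [← character_add_right, sub_add_cancel]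
  rw [smul_apply, conjS_apply, conjS_apply, shift_apply, shiftFun, shift_apply,
    shiftFun, shift_apply, shiftFun, h1, h2, h3, smul_eq_mul]
  simp only [map_mul]
  linear_combination (-(conj (character (freqPart z) t) *
    conj (character (freqPart u) (t - timePart z)) * conj (φ (t - timePart (u + z))))) *
    character_mul_conj (freqPart u) (timePart z)

theorem norm_gabor_shift (u : Phase d) (φ : 𝓢(Space d, ℂ)) (f : 𝓢'(Space d, ℂ)) (z : Phase d) :
    ‖gabor (shift u φ) f z‖ = ‖gabor φ f (u + z)‖ := by
  rw [gabor_shift, norm_mul, norm_character, one_mul]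

theorem shift_zero (φ : 𝓢(Space d, ℂ)) : shift 0 φ = φ := by
  ext t
  rw [shift_apply, shiftFun, show timePart (0 : Phase d) = 0 from rfl,
    show freqPart (0 : Phase d) = 0 from rfl, character, inner_zero_right]
  simp

/-- Covariance evaluated at the origin. The pairing becomes a Gabor transform with Schwartz window
`conj h`, so its continuity and its weighted integrability are already available. -/
theorem integral_shiftFun_mul (x : Lp ℂ 2 (volume : Measure (Space d))) (h : 𝓢(Space d, ℂ))
    (z : Phase d) :
    ∫ t, shiftFun z x t * h t = character (freqPart z) (timePart z) *
      gabor (conjS h) (Lp.toTemperedDistribution x) (-z) := by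
  have h1 := gabor_shiftDist (conjS h) (Lp.toTemperedDistribution x) z 0
  rw [gabor, shift_zero, conjS_conjS, zero_sub, show freqPart (0 : Phase d) = 0 from rfl,
    sub_zero] at h1
  rw [← h1, shiftDist_apply, Lp.toTemperedDistribution_apply,
    ← integral_add_right_eq_self (fun t => shiftFun z x t * h t) (timePart z)]
  congr 1
  ext t
  simp [hasTemperateGrowth_character, shiftFun]
  ring

theorem lintegral_permute_neg (hv_symm : IsCoordSymmetric v) (F : Phase d → ℝ≥0∞) :
    ∫⁻ z, F (-permute c z) * ENNReal.ofReal (v z) =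
      ∫⁻ z, F (permute c z) * ENNReal.ofReal (v z) := by
  rw [← lintegral_neg_eq_self]
  simp_rw [permute_neg, neg_neg, hv_symm.neg_eq]

/-- The integral over phase space of the product of the transform of the window and the
transform of the test function. -/
theorem integral_conj_gabor_shiftDist_mul (φ : 𝓢(Space d, ℂ))
    (x y : Lp ℂ 2 (volume : Measure (Space d)))
    (hy : Integrable (gabor φ (Lp.toTemperedDistribution y))) (h : 𝓢(Space d, ℂ)) (u : Phase d) :
    ∫ z, conj (gabor φ (shiftDist z (Lp.toTemperedDistribution y)) u) *
      ∫ t, shiftFun z x t * h t =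
    conj (gabor φ (conjS h : 𝓢'(Space d, ℂ)) u) * inner ℂ y x := by
  have hint : Integrable (gabor (shift u φ) (Lp.toTemperedDistribution y)) := by
    refine ⟨(continuous_gabor _ _).aestronglyMeasurable, ?_⟩
    refine lt_of_eq_of_lt (lintegral_congr fun z => ?_) (hy.comp_add_left u).2
    rw [← ofReal_norm, norm_gabor_shift, ofReal_norm]
  have h1 := congrArg conj
    (integral_gabor_mul_conj_gabor_of_integrable (shift u φ) (conjS h) x y hint)
  rw [← integral_conj, map_mul, ← integral_conj, inner_conj_symm] at h1
  rw [gabor_coe, ← integral_conj]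
  refine Eq.trans ?_ (h1.trans ?_)
  -- After `z ↦ -z` the phase of `integral_shiftFun_mul` cancels part of that of `gabor_shiftDist`;
  -- what remains is the phase in `gabor_shift`, so orthogonality for the windows `π_u φ` and `conj
  -- h` applies.
  · rw [← integral_neg_eq_self]
    refine integral_congr_ae (Filter.Eventually.of_forall fun z => ?_)
    simp only
    rw [integral_shiftFun_mul, gabor_shiftDist, gabor_shift, neg_neg, sub_neg_eq_add,
      show freqPart (-z) = -freqPart z from rfl, show timePart (-z) = -timePart z from rfl]
    have e1 : character (-freqPart z - freqPart u) (-timePart z) =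
        character (-freqPart z) (-timePart z) * character (freqPart u) (timePart z) := by
      rw [sub_eq_add_neg, character_add_left]
      congr 1
      rw [character, character, inner_neg_neg]
    rw [e1]
    simp only [map_mul, Complex.conj_conj]
    linear_combination (conj (character (freqPart u) (timePart z)) *
      conj (gabor φ (Lp.toTemperedDistribution y) (u + z)) *
      gabor (conjS h) (Lp.toTemperedDistribution x) z) *
      character_mul_conj (-freqPart z) (-timePart z)
  · congr 2
    ext s
    simp only [map_mul, Complex.conj_conj, mul_comm]

theorem continuous_integral_shiftFun_mul (x : Lp ℂ 2 (volume : Measure (Space d)))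
    (h : 𝓢(Space d, ℂ)) : Continuous fun z : Phase d => ∫ t, shiftFun z x t * h t := by
  simp_rw [integral_shiftFun_mul]
  exact (continuous_character.comp (continuous_freqPart.prodMk continuous_timePart)).mul
    ((continuous_gabor _ _).comp continuous_neg)

theorem integrable_gabor (hv : IsSubmultiplicative v) (hv_symm : IsCoordSymmetric v)
    (hv_ne : v ≠ 0) {φ : 𝓢(Space d, ℂ)} {ψ : 𝓢'(Space d, ℂ)}
    (hψ : ψ ∈ mixedModSpace φ c v fun _ => 1) : Integrable (gabor φ ψ) := by
  refine ⟨(continuous_gabor φ ψ).aestronglyMeasurable, ?_⟩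
  have h1 : ∫⁻ z, ‖gabor φ ψ (permute c z)‖ₑ * ENNReal.ofReal (v z) < ∞ := by
    rw [← modNorm_one hv.toIsWeight]
    exact hψ
  rw [HasFiniteIntegral, ← lintegral_permute c]
  refine lt_of_le_of_lt (lintegral_mono fun z => ?_) h1
  refine le_mul_of_one_le_right' ?_
  rw [ENNReal.one_le_ofReal]
  exact hv.one_le hv_symm hv_ne z

/-- This is the absolute convergence behind the exchange of integrals: the modulus, integrated over
the second variable, is `H(z) |S(z)|`, a product to which `L^∞_{1/v}`-`L^1_v` duality applies. -/
theorem integrable_synthesis_kernel (hv : IsSubmultiplicative v)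
    (hv_growth : HasPolynomialGrowth v) (hv_symm : IsCoordSymmetric v) (hv_ne : v ≠ 0)
    {φ : 𝓢(Space d, ℂ)} (hφ : φ ≠ 0) {f γ : 𝓢'(Space d, ℂ)}
    (hf : f ∈ mixedModSpace φ c (fun z => (v z)⁻¹) fun _ => ∞)
    (hγ : γ ∈ mixedModSpace φ c v fun _ => 1) (x : Lp ℂ 2 (volume : Measure (Space d)))
    (hx : Lp.toTemperedDistribution x ∈ mixedModSpace φ c v fun _ => 1) (h : 𝓢(Space d, ℂ)) :
    Integrable (fun q : Phase d × Phase d => gabor φ f q.2 *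
      (conj (gabor φ (shiftDist q.1 γ) q.2) * ∫ t, shiftFun q.1 x t * h t))
      (volume.prod volume) := by
  have hcont : Continuous fun q : Phase d × Phase d => gabor φ f q.2 *
      (conj (gabor φ (shiftDist q.1 γ) q.2) * ∫ t, shiftFun q.1 x t * h t) :=
    ((continuous_gabor φ f).comp continuous_snd).mul
      ((Complex.continuous_conj.comp (continuous_gabor_shiftDist φ γ)).mul
        ((continuous_integral_shiftFun_mul x h).comp continuous_fst))
  refine ⟨hcont.aestronglyMeasurable, ?_⟩
  set S : Phase d → ℂ := fun z => ∫ t, shiftFun z x t * h t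
  have hS : Continuous S := continuous_integral_shiftFun_mul x h
  set H : Phase d → ℝ≥0∞ := fun z => ∫⁻ u, ‖gabor φ f u‖ₑ * ‖gabor φ γ (u - z)‖ₑ
  have hH : Measurable H := by
    have : Measurable fun q : Phase d × Phase d => ‖gabor φ f q.2‖ₑ * ‖gabor φ γ (q.2 - q.1)‖ₑ :=
      ((measurable_gabor φ f).comp measurable_snd).enorm.mul
        ((measurable_gabor φ γ).comp (measurable_snd.sub measurable_fst)).enorm
    exact this.lintegral_prod_right'
  have hinv := hv.isModerate_inv hv_symm hv_ne
  obtain ⟨C, hC, hvw⟩ := hinv.exists_pos_const hv.toIsWeight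
  -- Young's inequality with the moderate weight `1/v`.
  have h1 : mixedNorm (d + d) (fun _ => ∞)
      (fun z => H (permute c z) * ENNReal.ofReal (v z)⁻¹) < ∞ := by
    have h2 := mixedNorm_convolution_le hv.toIsWeight hv_symm hinv.toIsWeight hC hvw
      (p := fun _ => ∞) (fun _ => le_top)
      (F := fun x => ‖gabor φ f (permute c x)‖ₑ) (K := fun s => ‖gabor φ γ (permute c s)‖ₑ)
      ((measurable_gabor φ f).comp (measurable_permute c)).enorm
      ((measurable_gabor φ γ).comp (measurable_permute c)).enorm fun _ => enorm_ne_top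
    rw [← modNorm_one hv.toIsWeight] at h2
    simp only [H]
    simp_rw [lintegral_convolution_permute c (fun u => ‖gabor φ f u‖ₑ) fun u => ‖gabor φ γ u‖ₑ]
    exact h2.trans_lt (ENNReal.mul_lt_top (ENNReal.mul_lt_top ENNReal.ofReal_lt_top hγ) hf)
  -- `|S|` is the reflected Gabor transform of `x` with window `conj h`: symmetry of `v` removes the
  -- reflection, and a change of window bounds the integral.
  have h3 : ∫⁻ z, ‖S (permute c z)‖ₑ * ENNReal.ofReal (v z) < ∞ := by
    have h4 : ∀ z, ‖S z‖ₑ = ‖gabor (conjS h) (Lp.toTemperedDistribution x) (-z)‖ₑ := fun z => by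
      simp only [S]
      rw [integral_shiftFun_mul, ← ofReal_norm, norm_mul, norm_character, one_mul, ofReal_norm]
    simp_rw [h4]
    rw [lintegral_permute_neg hv_symm
      fun z => ‖gabor (conjS h) (Lp.toTemperedDistribution x) z‖ₑ, ← modNorm_one hv.toIsWeight]
    obtain ⟨B, -, hB⟩ := exists_modNorm_le (c := c) hv hv_growth hv_symm hv.isModerate_self hφ
      (fun _ => le_rfl) (conjS h) (p := fun _ => 1)
    exact (hB _).trans_lt (ENNReal.mul_lt_top ENNReal.coe_lt_top hx)
  rw [HasFiniteIntegral, lintegral_prod _ hcont.enorm.measurable.aemeasurable]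
  refine lt_of_le_of_lt (le_of_eq ?_) ((lintegral_mul_le_top_one (c := c) hv.toIsWeight
    hinv.toIsWeight (hv.pos hv_ne) hH hS.measurable.enorm).trans_lt (ENNReal.mul_lt_top h1 h3))
  refine lintegral_congr fun z => ?_
  rw [← lintegral_mul_const' _ _ enorm_ne_top]
  refine lintegral_congr fun u => ?_
  rw [enorm_mul, enorm_mul, RCLike.enorm_conj, enorm_gabor_shiftDist, mul_assoc]

/-- The inversion formula for windows in the space with exponents `1`. -/
theorem integral_gaborDist_mul (hv : IsSubmultiplicative v)
    (hv_growth : HasPolynomialGrowth v) (hv_symm : IsCoordSymmetric v) (hv_ne : v ≠ 0)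
    {φ : 𝓢(Space d, ℂ)} (hφ : φ ≠ 0) {f : 𝓢'(Space d, ℂ)}
    (hf : f ∈ mixedModSpace φ c (fun z => (v z)⁻¹) fun _ => ∞)
    (x y : Lp ℂ 2 (volume : Measure (Space d)))
    (hx : Lp.toTemperedDistribution x ∈ mixedModSpace φ c v fun _ => 1)
    (hy : Lp.toTemperedDistribution y ∈ mixedModSpace φ c v fun _ => 1) (h : 𝓢(Space d, ℂ)) :
    (Integrable fun z => gaborDist φ (Lp.toTemperedDistribution y) f z *
      ∫ t, shiftFun z x t * h t) ∧
    ∫ z, gaborDist φ (Lp.toTemperedDistribution y) f z * ∫ t, shiftFun z x t * h t =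
      inner ℂ y x * f h := by
  have hint := integrable_synthesis_kernel hv hv_growth hv_symm hv_ne hφ hf hy x hx h
  have h1 : ∀ z, gaborDist φ (Lp.toTemperedDistribution y) f z * ∫ t, shiftFun z x t * h t =
      ((∫ t, ‖φ t‖ ^ 2 : ℝ) : ℂ)⁻¹ * ∫ u, gabor φ f u *
        (conj (gabor φ (shiftDist z (Lp.toTemperedDistribution y)) u) *
          ∫ t, shiftFun z x t * h t) := by
    intro z
    simp_rw [← mul_assoc]
    rw [integral_mul_const, ← mul_assoc]
    rfl
  simp_rw [h1]
  refine ⟨hint.integral_prod_left.const_mul _, ?_⟩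
  -- The integral over shifts is evaluated by orthogonality; the remaining integral over `u` is the
  -- bracket of `f` with `conj h`, which equals `f h`.
  rw [integral_const_mul, integral_integral_swap hint]
  simp_rw [integral_const_mul, integral_conj_gabor_shiftDist_mul φ x y
    (integrable_gabor hv hv_symm hv_ne hy) h, ← mul_assoc]
  rw [integral_mul_const, ← mul_assoc]
  have h2 := bracket_coe hφ f (conjS h)
  rw [bracket, conjS_conjS] at h2
  rw [h2, mul_comm]

end Synthesis

/-! ### Equivalent norms -/

section EquivalentNorms

variable {d : ℕ} {c : Equiv.Perm (Fin (d + d))} {v w : Phase d → ℝ} {p : Fin (d + d) → ℝ≥0∞}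

/-- The inversion formula with equal windows, tested against `conj (π_u φ)`, on which `f` takes the
value `V_φ f(u)`. -/
theorem enorm_gabor_le_of_synthesis (hv : IsSubmultiplicative v)
    (hv_growth : HasPolynomialGrowth v) (hv_symm : IsCoordSymmetric v) (hv_ne : v ≠ 0)
    {φ : 𝓢(Space d, ℂ)} (hφ : φ ≠ 0) {f : 𝓢'(Space d, ℂ)}
    (hf : f ∈ mixedModSpace φ c (fun z => (v z)⁻¹) fun _ => ∞)
    (x : Lp ℂ 2 (volume : Measure (Space d)))
    (hx : Lp.toTemperedDistribution x ∈ mixedModSpace φ c v fun _ => 1) (u : Phase d) :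
    ‖inner ℂ x x‖ₑ * ‖gabor φ f u‖ₑ ≤
      ∫⁻ z, ‖gaborDist φ (Lp.toTemperedDistribution x) f z‖ₑ *
        ‖gabor φ (Lp.toTemperedDistribution x) (-(z - u))‖ₑ := by
  have h := (integral_gaborDist_mul hv hv_growth hv_symm hv_ne hφ hf x x hx hx
    (conjS (shift u φ))).2
  rw [← enorm_mul, gabor, ← h]
  refine (enorm_integral_le_lintegral_enorm _).trans (le_of_eq (lintegral_congr fun z => ?_))
  rw [enorm_mul, integral_shiftFun_mul, conjS_conjS, enorm_mul,
    ← ofReal_norm (character _ _), norm_character, ENNReal.ofReal_one, one_mul,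
    ← ofReal_norm (gabor (shift u φ) _ _), norm_gabor_shift, ofReal_norm, neg_sub,
    ← sub_eq_add_neg]

/-- Young's inequality with the reflected kernel, whose weighted `L^1` norm is unchanged because `v`
is even. This is the lower estimate in (b), before division by `‖x‖₂²`. -/
theorem modNorm_le_permutedNorm_gaborDist (hv : IsSubmultiplicative v)
    (hv_growth : HasPolynomialGrowth v) (hv_symm : IsCoordSymmetric v) (hv_ne : v ≠ 0)
    (hw : IsWeight w) {C : ℝ} (hC : 0 < C) (hvw : ∀ z₁ z₂, w (z₁ + z₂) ≤ C * v z₁ * w z₂)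
    (hp : ∀ i, 1 ≤ p i) {φ : 𝓢(Space d, ℂ)} (hφ : φ ≠ 0) {f : 𝓢'(Space d, ℂ)}
    (hf : f ∈ mixedModSpace φ c (fun z => (v z)⁻¹) fun _ => ∞)
    (x : Lp ℂ 2 (volume : Measure (Space d)))
    (hx : Lp.toTemperedDistribution x ∈ mixedModSpace φ c v fun _ => 1) :
    ‖inner ℂ x x‖ₑ * modNorm φ c w p f ≤
      (ENNReal.ofReal C * modNorm φ c v (fun _ => 1) (Lp.toTemperedDistribution x)) *
        permutedNorm c w p (gaborDist φ (Lp.toTemperedDistribution x) f) := by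
  have h1 := mixedNorm_convolution_le hv.toIsWeight hv_symm hw hC hvw hp
    (F := fun z => ‖gaborDist φ (Lp.toTemperedDistribution x) f (permute c z)‖ₑ)
    (K := fun s => ‖gabor φ (Lp.toTemperedDistribution x) (-permute c s)‖ₑ)
    ((measurable_gaborDist φ _ f).comp (measurable_permute c)).enorm
    ((measurable_gabor φ _).comp (measurable_permute c).neg).enorm fun _ => enorm_ne_top
  rw [lintegral_permute_neg hv_symm fun z => ‖gabor φ (Lp.toTemperedDistribution x) z‖ₑ,
    ← modNorm_one hv.toIsWeight] at h1
  refine le_trans ?_ h1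
  rw [modNorm, permutedNorm, ← mixedNorm_const_mul hp enorm_ne_top]
  refine mixedNorm_mono fun z => ?_
  rw [← mul_assoc]
  gcongr
  refine (enorm_gabor_le_of_synthesis hv hv_growth hv_symm hv_ne hφ hf x hx _).trans
    (le_of_eq ?_)
  exact lintegral_convolution_permute c
    (fun z => ‖gaborDist φ (Lp.toTemperedDistribution x) f z‖ₑ)
    (fun z => ‖gabor φ (Lp.toTemperedDistribution x) (-z)‖ₑ) z

theorem exists_nnreal_pos_ge {K : ℝ≥0∞} (hK : K ≠ ∞) : ∃ B : ℝ≥0, 0 < B ∧ K ≤ B :=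
  ⟨K.toNNReal + 1, by positivity, by
    rw [ENNReal.coe_add, ENNReal.coe_toNNReal hK]
    exact le_self_add⟩

theorem exists_equivalent_norms (hv : IsSubmultiplicative v)
    (hv_growth : HasPolynomialGrowth v) (hv_symm : IsCoordSymmetric v) (hv_ne : v ≠ 0)
    (hw : IsModerate v w) (hp : ∀ i, 1 ≤ p i) {φ : 𝓢(Space d, ℂ)} (hφ : φ ≠ 0)
    {ψ : 𝓢'(Space d, ℂ)} (hψ : ψ ∈ mixedModSpace φ c v fun _ => 1) (hψ_ne : ψ ≠ 0) :
    ∃ A B : ℝ≥0, 0 < A ∧ 0 < B ∧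
      ∀ f ∈ mixedModSpace φ c (fun z => (v z)⁻¹) (fun _ => ∞),
        A * modNorm φ c w p f ≤ permutedNorm c w p (gaborDist φ ψ f) ∧
        permutedNorm c w p (gaborDist φ ψ f) ≤ B * modNorm φ c w p f := by
  obtain ⟨x, rfl⟩ := exists_toTemperedDistribution_eq hφ (integrable_gabor hv hv_symm hv_ne hψ)
  obtain ⟨C, hC, hvw⟩ := hw.exists_pos_const hv.toIsWeight
  have hx : x ≠ 0 := by
    rintro rfl
    refine hψ_ne ?_
    ext h
    exact DFunLike.congr_fun
      (map_zero (Lp.toTemperedDistributionCLM ℂ (volume : Measure (Space d)) 2)) h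
  have hN : ‖inner ℂ x x‖ₑ ≠ 0 := enorm_ne_zero.2 (inner_self_ne_zero.2 hx)
  have hψ' : modNorm φ c v (fun _ => 1) (Lp.toTemperedDistribution x) ≠ ∞ := ne_of_lt hψ
  have hK : ENNReal.ofReal C * modNorm φ c v (fun _ => 1) (Lp.toTemperedDistribution x) ≠ ∞ :=
    ENNReal.mul_ne_top ENNReal.ofReal_ne_top hψ'
  -- `A` majorizes the constant after division by `‖x‖₂²`, which is nonzero because `ψ ≠ 0`; the
  -- lower constant is its inverse.
  obtain ⟨A, hA, hA'⟩ := exists_nnreal_pos_ge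
    (ENNReal.mul_ne_top (ENNReal.inv_ne_top.2 hN) hK)
  obtain ⟨B, hB, hB'⟩ := exists_nnreal_pos_ge (ENNReal.mul_ne_top (invNormSq_ne_top φ) hK)
  refine ⟨A⁻¹, B, inv_pos.2 hA, hB, fun f hf => ⟨mul_le_of_le_mul hA ?_, ?_⟩⟩
  · have h1 := modNorm_le_permutedNorm_gaborDist hv hv_growth hv_symm hv_ne hw.toIsWeight hC hvw
      hp hφ hf x hψ
    calc modNorm φ c w p f
        = ‖inner ℂ x x‖ₑ⁻¹ * (‖inner ℂ x x‖ₑ * modNorm φ c w p f) := by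
          rw [← mul_assoc, ENNReal.inv_mul_cancel hN enorm_ne_top, one_mul]
      _ ≤ _ := mul_le_mul' le_rfl h1
      _ ≤ _ := by
          rw [← mul_assoc]
          exact mul_le_mul' hA' le_rfl
  · exact (permutedNorm_gaborDist_le hv.toIsWeight hv_symm hw.toIsWeight hC hvw hp φ _ f).trans
      (mul_le_mul' hB' le_rfl)

theorem modNorm_add_le (hw : IsWeight w) (hp : ∀ i, 1 ≤ p i) (φ : 𝓢(Space d, ℂ))
    (f g : 𝓢'(Space d, ℂ)) :
    modNorm φ c w p (f + g) ≤ modNorm φ c w p f + modNorm φ c w p g :=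
  permutedNorm_add_le hw hp (measurable_gabor φ f) (measurable_gabor φ g)

theorem modNorm_smul (hp : ∀ i, 1 ≤ p i) (φ : 𝓢(Space d, ℂ)) (a : ℂ) (f : 𝓢'(Space d, ℂ)) :
    modNorm φ c w p (a • f) = ‖a‖ₑ * modNorm φ c w p f :=
  permutedNorm_const_mul hp a (gabor φ f)

theorem eq_zero_of_modNorm_eq_zero (hw : IsWeight w) (hw_pos : ∀ z, 0 < w z)
    (hp : ∀ i, 1 ≤ p i) {φ : 𝓢(Space d, ℂ)} (hφ : φ ≠ 0) {f : 𝓢'(Space d, ℂ)}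
    (h : modNorm φ c w p f = 0) : f = 0 :=
  eq_zero_of_gabor_ae_eq_zero hφ
    (ae_eq_zero_of_permutedNorm_eq_zero hw hw_pos hp (measurable_gabor φ f) h)

theorem isNormOn_modNorm (hw : IsWeight w) (hw_pos : ∀ z, 0 < w z) (hp : ∀ i, 1 ≤ p i)
    {φ : 𝓢(Space d, ℂ)} (hφ : φ ≠ 0) :
    IsNormOn (mixedModSpace φ c w p) (modNorm φ c w p) where
  zero_mem := by
    -- Writing `0` as `0 • 0` reduces membership to homogeneity.
    rw [← zero_smul ℂ (0 : 𝓢'(Space d, ℂ)), mixedModSpace, Set.mem_ofPred_eq, modNorm_smul hp,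
      enorm_zero, zero_mul]
    exact ENNReal.zero_lt_top
  add_mem f hf g hg :=
    (modNorm_add_le hw hp φ f g).trans_lt (ENNReal.add_lt_top.2 ⟨hf, hg⟩)
  smul_mem a f hf := by
    rw [mixedModSpace, Set.mem_ofPred_eq, modNorm_smul hp]
    exact ENNReal.mul_lt_top enorm_lt_top hf
  finite _ hf := hf
  add_le f _ g _ := modNorm_add_le hw hp φ f g
  smul_eq a f _ := modNorm_smul hp φ a f
  eq_zero _ _ h := eq_zero_of_modNorm_eq_zero hw hw_pos hp hφ h

/-- Submultiplicativity bounds the cost of a translation by the factor `v(a)`. Hence the bracket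
that defines the transform converges at every point. -/
theorem shiftDist_mem_mixedModSpace (hv : IsSubmultiplicative v) {φ : 𝓢(Space d, ℂ)}
    {ψ : 𝓢'(Space d, ℂ)} (hψ : ψ ∈ mixedModSpace φ c v fun _ => 1) (z : Phase d) :
    shiftDist z ψ ∈ mixedModSpace φ c v fun _ => 1 := by
  obtain ⟨a, rfl⟩ : ∃ a, permute c a = z := (permuteEquiv c).surjective z
  rw [mixedModSpace, Set.mem_ofPred_eq, modNorm_one hv.toIsWeight] at hψ ⊢
  rw [← lintegral_add_left_eq_self _ a]
  refine lt_of_le_of_lt ?_ (ENNReal.mul_lt_top (ENNReal.ofReal_lt_top (r := v a)) hψ)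
  rw [← lintegral_const_mul' _ _ ENNReal.ofReal_ne_top]
  refine lintegral_mono fun s => ?_
  rw [enorm_gabor_shiftDist, permute_add, add_sub_cancel_left, mul_left_comm,
    ← ENNReal.ofReal_mul (hv.nonneg a)]
  gcongr
  exact hv.add_le a s

theorem gaborDist_smul (φ : 𝓢(Space d, ℂ)) (ψ : 𝓢'(Space d, ℂ)) (a : ℂ) (f : 𝓢'(Space d, ℂ)) :
    gaborDist φ ψ (a • f) = fun z => a * gaborDist φ ψ f z := by
  ext z
  have h : ∀ u, gabor φ (a • f) u = a * gabor φ f u := fun u => rfl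
  simp_rw [gaborDist, bracket, h, mul_assoc]
  rw [integral_const_mul, mul_left_comm]

/-- Unlike homogeneity, additivity of the integral requires both brackets to converge, hence the
restriction on `f` and `g`. -/
theorem gaborDist_add (hv : IsSubmultiplicative v) (hv_symm : IsCoordSymmetric v)
    (hv_ne : v ≠ 0) {φ : 𝓢(Space d, ℂ)} {ψ f g : 𝓢'(Space d, ℂ)}
    (hψ : ψ ∈ mixedModSpace φ c v fun _ => 1)
    (hf : f ∈ mixedModSpace φ c (fun z => (v z)⁻¹) fun _ => ∞)
    (hg : g ∈ mixedModSpace φ c (fun z => (v z)⁻¹) fun _ => ∞) :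
    gaborDist φ ψ (f + g) = fun z => gaborDist φ ψ f z + gaborDist φ ψ g z := by
  ext z
  have hz := shiftDist_mem_mixedModSpace hv hψ z
  have h : ∀ u, gabor φ (f + g) u = gabor φ f u + gabor φ g u := fun u => rfl
  simp_rw [gaborDist, bracket, h, add_mul]
  rw [integral_add (integrable_gabor_mul_conj_gabor hv hv_symm hv_ne hf hz)
    (integrable_gabor_mul_conj_gabor hv hv_symm hv_ne hg hz), mul_add]

theorem isNormOn_permutedNorm_gaborDist (hv : IsSubmultiplicative v)
    (hv_growth : HasPolynomialGrowth v) (hv_symm : IsCoordSymmetric v) (hv_ne : v ≠ 0)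
    (hw : IsModerate v w) (hw_ne : w ≠ 0) (hp : ∀ i, 1 ≤ p i) {φ : 𝓢(Space d, ℂ)} (hφ : φ ≠ 0)
    {ψ : 𝓢'(Space d, ℂ)} (hψ : ψ ∈ mixedModSpace φ c v fun _ => 1) (hψ_ne : ψ ≠ 0) :
    IsNormOn (mixedModSpace φ c w p) fun f => permutedNorm c w p (gaborDist φ ψ f) := by
  obtain ⟨A, B, hA, -, hAB⟩ :=
    exists_equivalent_norms hv hv_growth hv_symm hv_ne hw hp hφ hψ hψ_ne
  have hsub := mixedModSpace_subset (c := c) hv hv_growth hv_symm hv_ne hw hw_ne hp hφ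
  have hN := isNormOn_modNorm (c := c) hw.toIsWeight (hw.pos hw_ne) hp hφ
  refine ⟨hN.zero_mem, hN.add_mem, hN.smul_mem, fun f hf => ?_, fun f hf g hg => ?_,
    fun a f _ => ?_, fun f hf h => ?_⟩
  · exact (hAB f (hsub hf)).2.trans_lt (ENNReal.mul_lt_top ENNReal.coe_lt_top hf)
  · simp only [gaborDist_add hv hv_symm hv_ne hψ (hsub hf) (hsub hg)]
    exact permutedNorm_add_le hw.toIsWeight hp (measurable_gaborDist φ ψ f)
      (measurable_gaborDist φ ψ g)
  · simp only [gaborDist_smul]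
    exact permutedNorm_const_mul hp a _
  · have h1 := (hAB f (hsub hf)).1
    rw [h, nonpos_iff_eq_zero, mul_eq_zero] at h1
    exact hN.eq_zero f hf (h1.resolve_left (ENNReal.coe_ne_zero.2 hA.ne'))

end EquivalentNorms

end MixedModulation

end

theorem theorem4p1 {d : ℕ} (c : Equiv.Perm (Fin (d + d))) (v w : Phase d → ℝ)
    (hv : IsSubmultiplicative v) (hv_growth : HasPolynomialGrowth v)
    (hv_symm : IsCoordSymmetric v) (hv_ne : v ≠ 0)
    (hw : IsModerate v w) (hw_ne : w ≠ 0)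
    (φ : 𝓢(Space d, ℂ)) (hφ : φ ≠ 0)
    (p : Fin (d + d) → ℝ≥0∞) (hp : ∀ i, 1 ≤ p i)
    (ψ γ : 𝓢'(Space d, ℂ))
    (hψ : ψ ∈ mixedModSpace φ c v (fun _ => 1))
    (hγ : γ ∈ mixedModSpace φ c v (fun _ => 1)) :
    -- the bracket between the spaces with exponents `∞` and `1` is well defined, bounded, and
    -- extends the bracket between tempered distributions and Schwartz functions
    ((∀ f ∈ mixedModSpace φ c (fun z => (v z)⁻¹) (fun _ => ∞),
        (∀ g ∈ mixedModSpace φ c v (fun _ => 1),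
          Integrable fun z => gabor φ f z * conj (gabor φ g z)) ∧
        ∀ g : 𝓢(Space d, ℂ), bracket φ f (g : 𝓢'(Space d, ℂ)) = f (conjS g)) ∧
      (∃ K : ℝ≥0, ∀ f ∈ mixedModSpace φ c (fun z => (v z)⁻¹) (fun _ => ∞),
        ∀ g ∈ mixedModSpace φ c v (fun _ => 1),
          ‖bracket φ f g‖ₑ ≤ K * modNorm φ c (fun z => (v z)⁻¹) (fun _ => ∞) f *
            modNorm φ c v (fun _ => 1) g) ∧
      mixedModSpace φ c w p ⊆ mixedModSpace φ c (fun z => (v z)⁻¹) (fun _ => ∞)) ∧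
    -- (a) the windows are square integrable functions, and the inversion formula holds
    (∃ ψ₀ γ₀ : Lp ℂ 2 (volume : Measure (Space d)),
      Lp.toTemperedDistribution ψ₀ = ψ ∧ Lp.toTemperedDistribution γ₀ = γ ∧
      ∀ f ∈ mixedModSpace φ c w p, ∀ h : 𝓢(Space d, ℂ),
        Integrable (synthesisIntegrand c ψ₀ (fun x => gaborDist φ γ f (permute c x)) h) ∧
        synthesis c ψ₀ (fun x => gaborDist φ γ f (permute c x)) h = inner ℂ γ₀ ψ₀ * f h) ∧
    -- (b) equivalent norms
    (ψ ≠ 0 →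
      IsNormOn (mixedModSpace φ c w p) (modNorm φ c w p) ∧
      IsNormOn (mixedModSpace φ c w p) (fun f => permutedNorm c w p (gaborDist φ ψ f)) ∧
      ∃ A B : ℝ≥0, 0 < A ∧ 0 < B ∧
        ∀ f ∈ mixedModSpace φ c (fun z => (v z)⁻¹) (fun _ => ∞),
          A * modNorm φ c w p f ≤ permutedNorm c w p (gaborDist φ ψ f) ∧
          permutedNorm c w p (gaborDist φ ψ f) ≤ B * modNorm φ c w p f) ∧
    -- the space does not depend on the Schwartz window
    (∀ φ' : 𝓢(Space d, ℂ), φ' ≠ 0 →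
      mixedModSpace φ' c w p = mixedModSpace φ c w p ∧
      ∃ A B : ℝ≥0, 0 < A ∧ 0 < B ∧ ∀ f : 𝓢'(Space d, ℂ),
        A * modNorm φ c w p f ≤ modNorm φ' c w p f ∧
        modNorm φ' c w p f ≤ B * modNorm φ c w p f) := by
  have hsub := mixedModSpace_subset (c := c) hv hv_growth hv_symm hv_ne hw hw_ne hp hφ
  refine ⟨⟨fun f hf => ⟨fun g hg => integrable_gabor_mul_conj_gabor hv hv_symm hv_ne hf hg,
    bracket_coe hφ f⟩, ⟨(invNormSq φ).toNNReal, fun f _ g _ =>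
    enorm_bracket_le hv hv_symm hv_ne φ f g⟩, hsub⟩, ?_, fun hψ_ne =>
    ⟨isNormOn_modNorm hw.toIsWeight (hw.pos hw_ne) hp hφ,
      isNormOn_permutedNorm_gaborDist hv hv_growth hv_symm hv_ne hw hw_ne hp hφ hψ hψ_ne,
      exists_equivalent_norms hv hv_growth hv_symm hv_ne hw hp hφ hψ hψ_ne⟩, fun φ' hφ' => ?_⟩
  · obtain ⟨x, rfl⟩ := exists_toTemperedDistribution_eq hφ (integrable_gabor hv hv_symm hv_ne hψ)
    obtain ⟨y, rfl⟩ := exists_toTemperedDistribution_eq hφ (integrable_gabor hv hv_symm hv_ne hγ)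
    refine ⟨x, y, rfl, rfl, fun f hf h => ?_⟩
    obtain ⟨h1, h2⟩ :=
      integral_gaborDist_mul hv hv_growth hv_symm hv_ne hφ (hsub hf) x y hψ hγ h
    -- The inversion formula is an integral over `z = c(x)`; preservation of volume carries it to
    -- the variable `x`.
    exact ⟨(measurePreserving_permute c).integrable_comp_of_integrable h1,
      (integral_permute c _).trans h2⟩
  · obtain ⟨B, hB, hB'⟩ := exists_modNorm_le (c := c) hv hv_growth hv_symm hw hφ hp φ'
    -- The same estimate with the two windows exchanged; its inverse is the lower constant.
    obtain ⟨A, hA, hA'⟩ := exists_modNorm_le (c := c) hv hv_growth hv_symm hw hφ' hp φ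
    refine ⟨Set.ext fun f => ⟨fun hf => ?_, fun hf => ?_⟩, A⁻¹, B, inv_pos.2 hA, hB, fun f =>
      ⟨mul_le_of_le_mul hA (hA' f), hB' f⟩⟩
    · exact (hA' f).trans_lt (ENNReal.mul_lt_top ENNReal.coe_lt_top hf)
    · exact (hB' f).trans_lt (ENNReal.mul_lt_top ENNReal.coe_lt_top hf)
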